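/- Let $X_{\mathbb R}$ be a finite-dimensional real vector space, let $W\subset \mathrm{GL}(X_{\mathbb R})$ be a finite group generated by reflections, and let $\phi\in N_{\mathrm{GL}(X_{\mathbb R})}(W)$ be an element of finite order that preserves a chamber of the arrangement of reflecting hyperplanes of $W$. Let $S$ be the set of reflections in the walls of this chamber, so that $(W,S)$ is a Coxeter system on which $\phi$ acts by $s\mapsto \phi s\phi^{-1}$, and put $X=X_{\mathbb R}\otimes\mathbb C$. Let $B$ (resp. $B^+$) be the Artin–Tits braid group (resp. monoid) of $(W,S)$, and let $\mathbf S$ be the lift of $S$; $\phi$ also denotes the induced automorphism of $B$, and we compute in $B\rtimes\langle\phi\rangle$. For $I\subset S$ with lift $\mathbf I\subset\mathbf S$, let $W_I=\langle I\rangle$, let $B^+_{\mathbf I}$ be the submonoid of $B^+$ generated by $\mathbf I$, let $\mathbf w_{\mathbf I}\in B^+$ be the canonical lift of the longest element of $W_I$, and put $\pi_{\mathbf I}=\mathbf w_{\mathbf I}^2$, $\pi=\pi_{\mathbf S}$, $\pi/\pi_{\mathbf I}=\pi\,\pi_{\mathbf I}^{-1}\in B$. For a subspace $U\subset X$ let $C_W(U)$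 be the subgroup of elements of $W$ that fix $U$ pointwise. Let $d\ge 1$ be an integer and let $\mathbf w\in B^+$ be such that $(\mathbf w\phi)^d=\phi^d\,\pi/\pi_{\mathbf I}$ for some $\phi^d$-stable $\mathbf I\subset\mathbf S$. Then: (i) ${}^{\mathbf w\phi}\mathbf I=\mathbf I$, that is, $(\mathbf w\phi)\,\mathbf I\,(\mathbf w\phi)^{-1}=\mathbf I$. Denote by $w$ and $I$ the images in $W$ of $\mathbf w$ and $\mathbf I$, let $\zeta_d=e^{2i\pi/d}$, let $V\subset X$ be the $\zeta_d$-eigenspace of $w\phi$, and let $X^{W_I}$ be the fixed point space of $W_I$ in $X$. Then: (ii) $W_I=C_W(X^{W_I}\cap V)$; in particular $C_W(V)\subset W_I$. Further, the following two assertions are equivalent: (iii) $\mathbf w$ is maximal, that is, there do not exist a $\phi^d$-stable $\mathbf J\subsetneq\mathbf I$ and $\mathbf v\in B^+_{\mathbf I}$ such that $(\mathbf v\mathbf w\phi)^d=\phi^d\,\pi/\pi_{\mathbf J}$. (iv) No element of the coset $W_Iw\phi$ has a non-zero $\zeta_d$-eigenvector on the subspace of $X$ spanned by the root lines of the reflections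 of $W_I$. -/

import Mathlib

open scoped TensorProduct

noncomputable section

/-! ### Artin–Tits monoids and groups of a Coxeter matrix -/

section Artin

variable {ι : Type*}

/-- The braid relations `s t s ⋯ = t s t ⋯` (`M s t` factors on each side). An entry `0` of a
Coxeter matrix stands for `∞`, and then the relation is empty. -/
def braidRel (M : CoxeterMatrix ι) (a b : FreeMonoid ι) : Prop :=
  ∃ i j, a = FreeMonoid.ofList (CoxeterSystem.alternatingWord i j (M i j)) ∧
    b = FreeMonoid.ofList (CoxeterSystem.alternatingWord j i (M i j))

/-- The Artin–Tits monoid of a Coxeter matrix. -/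
abbrev ArtinMonoid (M : CoxeterMatrix ι) : Type _ := PresentedMonoid (braidRel M)

/-- The image in the free group of a positive word. -/
def freeWord : FreeMonoid ι →* FreeGroup ι := FreeMonoid.lift FreeGroup.of

/-- The braid relators. -/
def braidRelators (M : CoxeterMatrix ι) : Set (FreeGroup ι) :=
  {r | ∃ a b, braidRel M a b ∧ r = freeWord a * (freeWord b)⁻¹}

/-- The Artin–Tits group of a Coxeter matrix. -/
abbrev ArtinGroup (M : CoxeterMatrix ι) : Type _ := PresentedGroup (braidRelators M)

/-- A homomorphism out of the Artin–Tits group is given by images of the generators that satisfy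
the braid relations. -/
def ArtinGroup.lift {M : CoxeterMatrix ι} {G : Type*} [Group G] (f : ι → G)
    (hf : ∀ a b, braidRel M a b → FreeMonoid.lift f a = FreeMonoid.lift f b) :
    ArtinGroup M →* G :=
  PresentedGroup.toGroup (f := f) (by
    rintro r ⟨a, b, hab, rfl⟩
    have key : ∀ c : FreeMonoid ι, FreeGroup.lift f (freeWord c) = FreeMonoid.lift f c := by
      intro c
      have : (FreeGroup.lift f).comp freeWord = FreeMonoid.lift f := by
        apply FreeMonoid.hom_eq
        intro x
        simp [freeWord]
      exact DFunLike.congr_fun this c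
    rw [map_mul, map_inv, key, key, hf a b hab, mul_inv_cancel])

theorem ArtinGroup.lift_of {M : CoxeterMatrix ι} {G : Type*} [Group G] (f : ι → G)
    (hf : ∀ a b, braidRel M a b → FreeMonoid.lift f a = FreeMonoid.lift f b) (i : ι) :
    ArtinGroup.lift f hf (PresentedGroup.of i) = f i := PresentedGroup.toGroup.of _

theorem ArtinGroup.braid {M : CoxeterMatrix ι} (a b : FreeMonoid ι) (hab : braidRel M a b) :
    FreeMonoid.lift (PresentedGroup.of : ι → ArtinGroup M) a =
      FreeMonoid.lift (PresentedGroup.of : ι → ArtinGroup M) b := by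
  have key : ∀ c : FreeMonoid ι, FreeMonoid.lift (PresentedGroup.of : ι → ArtinGroup M) c =
      PresentedGroup.mk (braidRelators M) (freeWord c) := by
    intro c
    have : FreeMonoid.lift (PresentedGroup.of : ι → ArtinGroup M) =
        (PresentedGroup.mk (braidRelators M)).comp freeWord := by
      apply FreeMonoid.hom_eq
      intro x
      simp [freeWord, PresentedGroup.of]
    exact DFunLike.congr_fun this c
  rw [key, key]
  exact PresentedGroup.mk_eq_mk_of_mul_inv_mem ⟨a, b, hab, rfl⟩

/-- The canonical homomorphism from the Artin–Tits monoid to the Artin–Tits group. -/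
def ArtinMonoid.toGroup (M : CoxeterMatrix ι) : ArtinMonoid M →* ArtinGroup M :=
  PresentedMonoid.lift PresentedGroup.of ArtinGroup.braid

theorem braidRel_map {M : CoxeterMatrix ι} (e : ι ≃ ι) (he : ∀ i j, M (e i) (e j) = M i j)
    {a b : FreeMonoid ι} (hab : braidRel M a b) :
    braidRel M (FreeMonoid.map e a) (FreeMonoid.map e b) := by
  have key : ∀ (n : ℕ) (i j : ι), FreeMonoid.map e (FreeMonoid.ofList
      (CoxeterSystem.alternatingWord i j n)) =
        FreeMonoid.ofList (CoxeterSystem.alternatingWord (e i) (e j) n) := by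
    intro n
    induction n with
    | zero => intro i j; rfl
    | succ n ih =>
      intro i j
      have := ih j i
      simp only [CoxeterSystem.alternatingWord, List.concat_eq_append, FreeMonoid.ofList_append,
        map_mul, this]
      rfl
  obtain ⟨i, j, rfl, rfl⟩ := hab
  exact ⟨e i, e j, by rw [key, he], by rw [key, he]⟩

/-- The endomorphism of the Artin–Tits group induced by a symmetry of the Coxeter diagram. -/
def ArtinGroup.diagramHom {M : CoxeterMatrix ι} (e : ι ≃ ι)
    (he : ∀ i j, M (e i) (e j) = M i j) : ArtinGroup M →* ArtinGroup M :=
  ArtinGroup.lift (fun i => PresentedGroup.of (e i)) (by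
    intro a b hab
    have key : ∀ c : FreeMonoid ι,
        FreeMonoid.lift (fun i => (PresentedGroup.of (e i) : ArtinGroup M)) c =
          FreeMonoid.lift (PresentedGroup.of : ι → ArtinGroup M) (FreeMonoid.map e c) := by
      intro c
      have : FreeMonoid.lift (fun i => (PresentedGroup.of (e i) : ArtinGroup M)) =
          (FreeMonoid.lift (PresentedGroup.of : ι → ArtinGroup M)).comp (FreeMonoid.map e) := by
        apply FreeMonoid.hom_eq
        intro x
        simp
      exact DFunLike.congr_fun this c
    rw [key, key]
    exact ArtinGroup.braid _ _ (braidRel_map e he hab))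

/-- The automorphism of the Artin–Tits group induced by a symmetry of the Coxeter diagram. -/
def ArtinGroup.diagramAut {M : CoxeterMatrix ι} (e : ι ≃ ι)
    (he : ∀ i j, M (e i) (e j) = M i j) : MulAut (ArtinGroup M) :=
  have he' : ∀ i j, M (e.symm i) (e.symm j) = M i j := fun i j => by
    rw [← he (e.symm i) (e.symm j), e.apply_symm_apply, e.apply_symm_apply]
  MonoidHom.toMulEquiv (ArtinGroup.diagramHom e he) (ArtinGroup.diagramHom e.symm he')
    (by
      apply PresentedGroup.ext
      intro x
      simp [ArtinGroup.diagramHom, ArtinGroup.lift_of])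
    (by
      apply PresentedGroup.ext
      intro x
      simp [ArtinGroup.diagramHom, ArtinGroup.lift_of])

theorem ArtinGroup.diagramAut_of {M : CoxeterMatrix ι} (e : ι ≃ ι)
    (he : ∀ i j, M (e i) (e j) = M i j) (i : ι) :
    ArtinGroup.diagramAut e he (PresentedGroup.of i) = PresentedGroup.of (e i) := by
  change ArtinGroup.diagramHom e he (PresentedGroup.of i) = _
  exact ArtinGroup.lift_of (fun i => (PresentedGroup.of (e i) : ArtinGroup M)) _ i

end Artin

/-! ### Real reflections, chambers, and the reflections in the walls of a chamber -/

section Reflections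

variable {X : Type*} [AddCommGroup X] [Module ℝ X]

/-- `s` is a reflection `x ↦ x - f(x) α` with `f(α) = 2`. -/
def IsRealReflection (s : X ≃ₗ[ℝ] X) : Prop :=
  ∃ (α : X) (f : Module.Dual ℝ X) (h : f α = 2), s = Module.reflection h

/-- The reflections that belong to `W`; the fixed spaces of these are the reflecting hyperplanes. -/
def reflectionsOf (W : Subgroup (X ≃ₗ[ℝ] X)) : Set (X ≃ₗ[ℝ] X) :=
  {s | s ∈ W ∧ IsRealReflection s}

/-- `C` is a chamber of the hyperplane arrangement of `W`: the class of a point `x` outside all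
reflecting hyperplanes, under the relation of not being separated by (nor lying on) a hyperplane. -/
def IsChamber (W : Subgroup (X ≃ₗ[ℝ] X)) (C : Set X) : Prop :=
  ∃ x, (∀ s ∈ reflectionsOf W, s x ≠ x) ∧
    C = {y | ∀ s ∈ reflectionsOf W, ∀ z ∈ segment ℝ x y, s z ≠ z}

/-- The reflections of `W` in the walls of `C`: the fixed hyperplane of `s` contains a point `z` of
the boundary of `C` that lies on no other reflecting hyperplane. -/
def wallReflections (W : Subgroup (X ≃ₗ[ℝ] X)) (C : Set X) : Set (X ≃ₗ[ℝ] X) :=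
  {s | s ∈ reflectionsOf W ∧ ∃ z, s z = z ∧ (∀ t ∈ reflectionsOf W, t z = z → t = s) ∧
    ∃ x ∈ C, openSegment ℝ x z ⊆ C}

theorem IsRealReflection.conj {s : X ≃ₗ[ℝ] X} (hs : IsRealReflection s) (g : X ≃ₗ[ℝ] X) :
    IsRealReflection (g * s * g⁻¹) := by
  obtain ⟨α, f, h, rfl⟩ := hs
  refine ⟨g α, f ∘ₗ (g.symm : X →ₗ[ℝ] X), by simpa using h, ?_⟩
  ext x
  change g (Module.reflection h (g.symm x)) = _
  simp [Module.reflection_apply]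

theorem IsRealReflection.mul_self {s : X ≃ₗ[ℝ] X} (hs : IsRealReflection s) : s * s = 1 := by
  obtain ⟨α, f, h, rfl⟩ := hs
  ext x
  exact Module.involutive_reflection h x

theorem conj_mem_reflectionsOf {W : Subgroup (X ≃ₗ[ℝ] X)} {g s : X ≃ₗ[ℝ] X}
    (hg : g ∈ Subgroup.normalizer (W : Set (X ≃ₗ[ℝ] X))) (hs : s ∈ reflectionsOf W) :
    g * s * g⁻¹ ∈ reflectionsOf W :=
  ⟨(Subgroup.mem_normalizer_iff.1 hg s).1 hs.1, hs.2.conj g⟩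

theorem conj_mem_wallReflections {W : Subgroup (X ≃ₗ[ℝ] X)} {C : Set X} {g s : X ≃ₗ[ℝ] X}
    (hg : g ∈ Subgroup.normalizer (W : Set (X ≃ₗ[ℝ] X))) (hC : g '' C = C)
    (hs : s ∈ wallReflections W C) : g * s * g⁻¹ ∈ wallReflections W C := by
  obtain ⟨hs, z, hz, huniq, x, hx, hseg⟩ := hs
  refine ⟨conj_mem_reflectionsOf hg hs, g z, ?_, ?_, g x, hC ▸ Set.mem_image_of_mem g hx, ?_⟩
  · change g (s (g.symm (g z))) = g z
    rw [g.symm_apply_apply, hz]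
  · intro t ht htz
    have h1 : g⁻¹ * t * g⁻¹⁻¹ ∈ reflectionsOf W := conj_mem_reflectionsOf (inv_mem hg) ht
    have h2 : (g⁻¹ * t * g⁻¹⁻¹) z = z := by
      rw [inv_inv]
      change g.symm (t (g z)) = z
      rw [htz, g.symm_apply_apply]
    rw [← huniq _ h1 h2]
    group
  · have himg : g '' openSegment ℝ x z = openSegment ℝ (g x) (g z) :=
      image_openSegment ℝ (g : X →ₗ[ℝ] X).toAffineMap x z
    rw [← himg, ← hC]
    exact Set.image_mono hseg

end Reflections

/-! ### Finite order real reflection cosets -/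

/-- A finite order real reflection coset `Wφ ⊂ GL(X)`, with a chamber preserved by `φ`: `W` is a
finite group generated by reflections, and `φ` is an element of finite order that normalizes `W`. -/
structure RealReflectionCoset (X : Type*) [AddCommGroup X] [Module ℝ X] where
  W : Subgroup (X ≃ₗ[ℝ] X)
  finite : Finite W
  generated : Subgroup.closure (reflectionsOf W) = W
  φ : X ≃ₗ[ℝ] X
  normalizes : φ ∈ Subgroup.normalizer (W : Set (X ≃ₗ[ℝ] X))
  finOrder : IsOfFinOrder φ
  C : Set X
  isChamber : IsChamber W C
  map_chamber : φ '' C = C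

namespace RealReflectionCoset

variable {X : Type*} [AddCommGroup X] [Module ℝ X] (D : RealReflectionCoset X)

/-- The generating set `S` of `W` determined by the chamber. -/
abbrev S : Set (X ≃ₗ[ℝ] X) := wallReflections D.W D.C

theorem S_mul_self (s : D.S) : (s : X ≃ₗ[ℝ] X) * s = 1 := s.2.1.2.mul_self

/-- The Coxeter matrix of `(W, S)`: its entries are the orders of the products `s t`. -/
def coxeterMatrix : CoxeterMatrix D.S where
  M := Matrix.of fun s t => orderOf ((s : X ≃ₗ[ℝ] X) * t)
  isSymm := by
    ext s t
    change orderOf ((t : X ≃ₗ[ℝ] X) * s) = orderOf ((s : X ≃ₗ[ℝ] X) * t)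
    have hs := eq_inv_of_mul_eq_one_left (D.S_mul_self s)
    have ht := eq_inv_of_mul_eq_one_left (D.S_mul_self t)
    rw [← orderOf_inv ((s : X ≃ₗ[ℝ] X) * t), mul_inv_rev, ← hs, ← ht]
  diagonal s := by
    change orderOf ((s : X ≃ₗ[ℝ] X) * s) = 1
    rw [D.S_mul_self, orderOf_one]
  off_diagonal s t hst h := by
    apply hst
    have h1 : (s : X ≃ₗ[ℝ] X) * t = 1 := orderOf_eq_one_iff.1 h
    have ht := eq_inv_of_mul_eq_one_left (D.S_mul_self t)
    exact Subtype.ext ((eq_inv_of_mul_eq_one_left h1).trans ht.symm)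

/-- The braid monoid `B⁺` of `W`. -/
abbrev BraidMonoid : Type _ := ArtinMonoid D.coxeterMatrix

/-- The braid group `B` of `W`. -/
abbrev BraidGroup : Type _ := ArtinGroup D.coxeterMatrix

/-- The canonical map `B⁺ → B`. -/
def toB : D.BraidMonoid →* D.BraidGroup := ArtinMonoid.toGroup D.coxeterMatrix

/-- The lift to `B⁺` of an element of `S`. -/
def gen (s : D.S) : D.BraidMonoid := PresentedMonoid.of _ s

/-- The submonoid `B⁺_I` generated by the lift of `I ⊆ S`. -/
def parabolicMonoid (I : Set D.S) : Submonoid D.BraidMonoid := Submonoid.closure (D.gen '' I)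

theorem braid_in_W (a b : FreeMonoid D.S) (hab : braidRel D.coxeterMatrix a b) :
    FreeMonoid.lift (fun s : D.S => (s : X ≃ₗ[ℝ] X)) a =
      FreeMonoid.lift (fun s : D.S => (s : X ≃ₗ[ℝ] X)) b := by
  obtain ⟨i, j, rfl, rfl⟩ := hab
  let cs := D.coxeterMatrix.toCoxeterSystem
  have hl : D.coxeterMatrix.IsLiftable (fun s : D.S => (s : X ≃ₗ[ℝ] X)) := fun s t =>
    pow_orderOf_eq_one ((s : X ≃ₗ[ℝ] X) * t)
  have key : ∀ l : List D.S, FreeMonoid.lift (fun s : D.S => (s : X ≃ₗ[ℝ] X))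
      (FreeMonoid.ofList l) = cs.lift ⟨_, hl⟩ (cs.wordProd l) := by
    intro l
    induction l with
    | nil => simp
    | cons x l ih =>
      rw [FreeMonoid.ofList_cons, map_mul, ih, cs.wordProd_cons, map_mul, cs.lift_apply_simple]
      simp
  rw [key, key]
  have h := cs.prod_alternatingWord_eq_prod_alternatingWord_sub i j (D.coxeterMatrix i j)
    (by omega)
  rw [h, show D.coxeterMatrix i j * 2 - D.coxeterMatrix i j = D.coxeterMatrix i j by omega]

/-- The canonical map `B → W ⊂ GL(X)`. -/
def toW : D.BraidGroup →* (X ≃ₗ[ℝ] X) :=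
  ArtinGroup.lift (fun s : D.S => (s : X ≃ₗ[ℝ] X)) D.braid_in_W

/-- The standard parabolic subgroup `W_I`. -/
def parabolic (I : Set D.S) : Subgroup (X ≃ₗ[ℝ] X) :=
  Subgroup.closure ((fun s : D.S => (s : X ≃ₗ[ℝ] X)) '' I)

/-- The element of `W` represented by a word in `S`. -/
def wordValue (l : List D.S) : X ≃ₗ[ℝ] X := (l.map Subtype.val).prod

/-- The length of an element of `W` with respect to `S`. -/
def length (w : X ≃ₗ[ℝ] X) : ℕ := sInf {n | ∃ l : List D.S, D.wordValue l = w ∧ l.length = n}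

theorem parabolic_le (I : Set D.S) : D.parabolic I ≤ D.W := by
  rw [parabolic, Subgroup.closure_le]
  rintro _ ⟨s, -, rfl⟩
  exact s.2.1.1

theorem exists_word {I : Set D.S} {w : X ≃ₗ[ℝ] X} (hw : w ∈ D.parabolic I) :
    ∃ l : List D.S, D.wordValue l = w := by
  induction hw using Subgroup.closure_induction with
  | mem x hx =>
    obtain ⟨s, -, rfl⟩ := hx
    exact ⟨[s], by simp [wordValue]⟩
  | one => exact ⟨[], by simp [wordValue]⟩
  | mul x y _ _ hx hy =>
    obtain ⟨l, rfl⟩ := hx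
    obtain ⟨m, rfl⟩ := hy
    exact ⟨l ++ m, by simp [wordValue]⟩
  | inv x _ hx =>
    obtain ⟨l, rfl⟩ := hx
    refine ⟨l.reverse, ?_⟩
    clear * -
    induction l with
    | nil => simp [wordValue]
    | cons s l ih =>
      have hs := eq_inv_of_mul_eq_one_left (D.S_mul_self s)
      simp only [wordValue, List.reverse_cons, List.map_append, List.prod_append, List.map_cons,
        List.prod_cons, mul_inv_rev] at ih ⊢
      rw [ih, ← hs]
      simp

theorem exists_longestWord (I : Set D.S) : ∃ l : List D.S,
    D.wordValue l ∈ D.parabolic I ∧ l.length = D.length (D.wordValue l) ∧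
      ∀ u ∈ D.parabolic I, D.length u ≤ D.length (D.wordValue l) := by
  have hfin : (D.parabolic I : Set (X ≃ₗ[ℝ] X)).Finite :=
    (Set.finite_coe_iff.1 D.finite).subset (D.parabolic_le I)
  obtain ⟨w, hw, hmax⟩ := Set.exists_max_image _ D.length hfin ⟨1, one_mem _⟩
  obtain ⟨l₀, hl₀⟩ := D.exists_word hw
  obtain ⟨l, hl, hlen⟩ := Nat.sInf_mem
    (s := {n | ∃ l : List D.S, D.wordValue l = w ∧ l.length = n}) ⟨_, l₀, hl₀, rfl⟩
  subst hl
  exact ⟨l, hw, hlen, hmax⟩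

/-- A reduced word of the longest element `w_I` of `W_I`. -/
def longestWord (I : Set D.S) : List D.S := (D.exists_longestWord I).choose

/-- The canonical lift of `w_I` to `B⁺`, represented by a reduced word of `w_I` (all reduced words
of an element of `W` represent the same element of `B⁺`). -/
def longestLift (I : Set D.S) : D.BraidMonoid :=
  PresentedMonoid.mk _ (FreeMonoid.ofList (D.longestWord I))

/-- The element `π_I`, the square of the lift of `w_I`, in the braid group. -/
def piElt (I : Set D.S) : D.BraidGroup := D.toB (D.longestLift I) ^ 2

/-- The element `π / π_I` of the braid group, where `π = π_S`. -/
def piQuot (I : Set D.S) : D.BraidGroup := D.piElt Set.univ * (D.piElt I)⁻¹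

theorem inv_map_chamber : (D.φ⁻¹ : X ≃ₗ[ℝ] X) '' D.C = D.C := by
  conv_lhs => rw [← D.map_chamber]
  rw [Set.image_image]
  convert Set.image_id D.C using 2
  exact D.φ.symm_apply_apply _

/-- The permutation `s ↦ φ s φ⁻¹` of `S`. -/
def permS : Equiv.Perm D.S where
  toFun s := ⟨D.φ * s * D.φ⁻¹, conj_mem_wallReflections D.normalizes D.map_chamber s.2⟩
  invFun s := ⟨D.φ⁻¹ * s * D.φ⁻¹⁻¹,
    conj_mem_wallReflections (inv_mem D.normalizes) D.inv_map_chamber s.2⟩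
  left_inv s := by
    apply Subtype.ext
    change D.φ⁻¹ * (D.φ * s * D.φ⁻¹) * D.φ⁻¹⁻¹ = s
    group
  right_inv s := by
    apply Subtype.ext
    change D.φ * (D.φ⁻¹ * s * D.φ⁻¹⁻¹) * D.φ⁻¹ = s
    group

theorem coxeterMatrix_permS (s t : D.S) :
    D.coxeterMatrix (D.permS s) (D.permS t) = D.coxeterMatrix s t := by
  change orderOf ((D.φ * s * D.φ⁻¹) * (D.φ * t * D.φ⁻¹)) = orderOf ((s : X ≃ₗ[ℝ] X) * t)
  have : (D.φ * s * D.φ⁻¹) * (D.φ * t * D.φ⁻¹) =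
      MulAut.conj D.φ ((s : X ≃ₗ[ℝ] X) * t) := by
    simp only [MulAut.conj_apply]
    group
  rw [this]
  exact MulEquiv.orderOf_eq (MulAut.conj D.φ) _

/-- The automorphism of the braid group `B` induced by `φ`. -/
def φB : MulAut D.BraidGroup := ArtinGroup.diagramAut D.permS D.coxeterMatrix_permS

/-- The semidirect product `B ⋊ ⟨φ⟩`, whose elements are the `b φ^i` with `b ∈ B`, `i ∈ ℤ`. -/
abbrev BSemi : Type _ := D.BraidGroup ⋊[zpowersHom (MulAut D.BraidGroup) D.φB] Multiplicative ℤ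

/-- The element `φ` of `B ⋊ ⟨φ⟩`. -/
def φSemi : D.BSemi := SemidirectProduct.inr (Multiplicative.ofAdd 1)

/-- The element `b φ` of `B ⋊ ⟨φ⟩`, for `b ∈ B⁺`. -/
def mulφ (b : D.BraidMonoid) : D.BSemi := SemidirectProduct.inl (D.toB b) * D.φSemi

/-- The lift of `I ⊆ S`, as a set of elements of `B ⊂ B ⋊ ⟨φ⟩`. -/
def boldSet (I : Set D.S) : Set D.BSemi :=
  (fun s => SemidirectProduct.inl (D.toB (D.gen s))) '' I

/-- The subset `I` of `S` is stable under `φ^d`. -/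
def IsStable (d : ℕ) (I : Set D.S) : Prop := (D.permS ^ d) '' I = I

/-- `(b φ)^d = φ^d · π / π_I` in `B ⋊ ⟨φ⟩`. -/
def IsRoot (d : ℕ) (b : D.BraidMonoid) (I : Set D.S) : Prop :=
  D.mulφ b ^ d = D.φSemi ^ d * SemidirectProduct.inl (D.piQuot I)

/-- `b` is maximal for `d` and `I`: there are no `φ^d`-stable `J ⊊ I` and `v ∈ B⁺_I` such that
`(v b φ)^d = φ^d · π / π_J`. -/
def IsMaximalRoot (d : ℕ) (b : D.BraidMonoid) (I : Set D.S) : Prop :=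
  ¬ ∃ J : Set D.S, J ⊂ I ∧ D.IsStable d J ∧ ∃ v ∈ D.parabolicMonoid I, D.IsRoot d (v * b) J

/-- The action of `g ∈ GL(X)` on the complexification `ℂ ⊗ X`. -/
def complexify (g : X ≃ₗ[ℝ] X) : Module.End ℂ (ℂ ⊗[ℝ] X) := (g : X →ₗ[ℝ] X).baseChange ℂ

theorem complexify_one : complexify (1 : X ≃ₗ[ℝ] X) = 1 := LinearMap.baseChange_id

theorem complexify_mul (g h : X ≃ₗ[ℝ] X) :
    complexify (g * h) = complexify g * complexify h :=
  LinearMap.baseChange_comp (h : X →ₗ[ℝ] X) (g : X →ₗ[ℝ] X)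

/-- The image `w φ ∈ Wφ ⊂ GL(X)` of `b φ`. -/
def imageφ (b : D.BraidMonoid) : X ≃ₗ[ℝ] X := D.toW (D.toB b) * D.φ

/-- The space of fixed points of `W_I` in `ℂ ⊗ X`. -/
def fixedSpace (I : Set D.S) : Submodule ℂ (ℂ ⊗[ℝ] X) :=
  ⨅ u ∈ D.parabolic I, LinearMap.ker (complexify u - 1)

/-- The subspace of `ℂ ⊗ X` spanned by the root lines of `W_I`; the root line of a reflection `s` is
the image of `s - 1`. -/
def rootSpan (I : Set D.S) : Submodule ℂ (ℂ ⊗[ℝ] X) :=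
  ⨆ s ∈ reflectionsOf (D.parabolic I), LinearMap.range (complexify s - 1)

/-- The pointwise stabilizer `C_W(U)` of a subspace `U` of `ℂ ⊗ X`. -/
def centralizer (U : Submodule ℂ (ℂ ⊗[ℝ] X)) : Subgroup (X ≃ₗ[ℝ] X) where
  carrier := {u | u ∈ D.W ∧ ∀ x ∈ U, complexify u x = x}
  one_mem' := ⟨one_mem _, fun x _ => by rw [complexify_one]; rfl⟩
  mul_mem' := by
    rintro u v ⟨hu, hu'⟩ ⟨hv, hv'⟩
    refine ⟨mul_mem hu hv, fun x hx => ?_⟩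
    rw [complexify_mul, Module.End.mul_apply, hv' x hx, hu' x hx]
  inv_mem' := by
    rintro u ⟨hu, hu'⟩
    refine ⟨inv_mem hu, fun x hx => ?_⟩
    conv_lhs => rw [← hu' x hx]
    rw [← Module.End.mul_apply, ← complexify_mul, inv_mul_cancel, complexify_one]
    rfl

/-- `ζ_d = exp(2iπ/d)`. -/
def zeta (d : ℕ) : ℂ := Complex.exp (2 * Real.pi * Complex.I / d)

end RealReflectionCoset

end

/-! ### Coxeter combinatorics derived from an inversion-set cocycle -/

noncomputable section

/-! Write T = wφ. The basic tool is the crossing number. The group B ⋊ ⟨φ⟩ maps to pairs made of an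
integer function on reflections and an element of GL(X). A positive braid crosses each hyperplane a
nonnegative number of times, and the parity says whether the chamber is separated from its image.
The braid π/π_I crosses twice every hyperplane outside W_I and never one of W_I. So the root
equation says that the crossings of w, summed over d successive T-conjugates of a hyperplane, give 2
or 0 (`IsRoot.sum_crM`). Hence w crosses no hyperplane of W_I, and T normalizes W_I and preserves
its chamber (`IsRoot.carries`).

Assertion (i) lifts this to the braid group. Some power of π_I commutes with wφ, because it is a
product of powers of wφ, φ and π (`IsRoot.exists_commute`). Peeling off the largest simple left
divisors of w one by one then carries each generator in I through w (`gen_conj`). This uses the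
Garside structure of B⁺: simple lifts, heads, left cancellation and the embedding in B. All of these
come from inversion sets in the finite group W, which in turn come from chamber geometry.

For (ii), suppose a reflection outside W_I fixes U = X^{W_I} ∩ V pointwise. Along the T-orbit of a
vector y with stabilizer W_I, its linear form has signs + - + over a period. A discrete Sturm
argument (`sum_sturm_ne_zero`) shows that such a sequence cannot be orthogonal both to constants and
to the first harmonics; orthogonality to the harmonics is forced by fixing U, so the form does not
vanish on the orbit sum m. Thus m selects a T-stable chamber for the reflections fixing U. Take a
wall β of it outside W_I and a vector v lying on all the other walls. Projecting v to V gives a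
vector of U. But only powers T^k that fix β contribute to the value of β there, these have d ∣ k
(`IsRoot.dvd_of_conj_eq`), and so the value is positive: a contradiction (`mem_parabolic_of_fixes`).
Since pointwise stabilizers are generated by reflections, (ii) follows.

For the equivalence, suppose first that vw is a root for a smaller J. If its eigenspace were fixed
by W_I, then (ii) for J would give W_I ⊂ W_J. So averaging over W_I produces an eigenvector in the
root span (`IsRoot.exists_eigenvector`). Conversely, an eigenvector x of some g = uT in the root
span can be moved so that its real part is dominant for W_I. Its stabilizer in W_I is then W_J with
J ⊊ I, and g may be taken to preserve the chamber of W_J (`exists_adapted`). As j grows, g^j x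
rotates by 2πj/d. The elements g^j T^{-j} therefore climb in the weak order during half a turn and
descend during the other half. Their lifts multiply to π_I/π_J, which makes a lift of u turn w into
a root for J (`IsRoot.not_isMaximalRoot`). -/

/-- A group with a family of involutive generators `s i` and an inversion-set cocycle `N`, taking
the value `{s i}` at `s i`, together with an element `w₀` whose inversion set contains all the
conjugates of the generators. -/
structure ReflectionCocycle (G ι : Type*) [Group G] where
  s : ι → G
  N : G → Set G
  s_injective : Function.Injective s
  s_mul_self : ∀ i, s i * s i = 1
  closure_range : Subgroup.closure (Set.range s) = ⊤
  mem_N_mul : ∀ t u v, t ∈ N (u * v) ↔ ¬ (t ∈ N u ↔ u⁻¹ * t * u ∈ N v)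
  mem_N_s : ∀ t i, t ∈ N (s i) ↔ t = s i
  w₀ : G
  conj_mem_N_w₀ : ∀ g i, g * s i * g⁻¹ ∈ N w₀

namespace ReflectionCocycle

variable {G ι : Type*} [Group G] (K : ReflectionCocycle G ι)

/-- The product in the group of a word in the generators. -/
def word (l : List ι) : G := (l.map K.s).prod

@[simp] theorem word_nil : K.word [] = 1 := rfl

@[simp] theorem word_cons (i : ι) (l : List ι) : K.word (i :: l) = K.s i * K.word l := by
  simp [word]

@[simp] theorem word_append (l m : List ι) : K.word (l ++ m) = K.word l * K.word m := by
  simp [word]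

/-- The number of inversions. -/
def len (w : G) : ℕ := (K.N w).ncard

@[simp] theorem s_inv (i : ι) : (K.s i)⁻¹ = K.s i := inv_eq_of_mul_eq_one_left (K.s_mul_self i)

@[simp] theorem s_mul_s_mul (i : ι) (w : G) : K.s i * (K.s i * w) = w := by
  rw [← mul_assoc, K.s_mul_self, one_mul]

theorem N_one : K.N 1 = ∅ := by
  ext t
  have := K.mem_N_mul t 1 1
  simp at this
  simpa using this

theorem mem_N_s_mul (t : G) (i : ι) (w : G) :
    t ∈ K.N (K.s i * w) ↔ ¬ (t = K.s i ↔ K.s i * t * K.s i ∈ K.N w) := by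
  rw [K.mem_N_mul, K.mem_N_s, K.s_inv]

theorem s_mem_N_s_mul (i : ι) (w : G) : K.s i ∈ K.N (K.s i * w) ↔ K.s i ∉ K.N w := by
  rw [K.mem_N_s_mul, K.s_mul_self, one_mul]
  simp

theorem mem_N_inv (t w : G) : t ∈ K.N w⁻¹ ↔ w * t * w⁻¹ ∈ K.N w := by
  have h := K.mem_N_mul (w * t * w⁻¹) w w⁻¹
  rw [mul_inv_cancel, K.N_one] at h
  have e : w⁻¹ * (w * t * w⁻¹) * w = t := by group
  rw [e] at h
  simp only [Set.mem_empty_iff_false, false_iff, not_not] at h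
  exact h.symm

theorem exists_word (w : G) : ∃ l, K.word l = w := by
  have hw : w ∈ Subgroup.closure (Set.range K.s) := by rw [K.closure_range]; trivial
  induction hw using Subgroup.closure_induction with
  | mem x hx =>
    obtain ⟨i, rfl⟩ := hx
    exact ⟨[i], by simp⟩
  | one => exact ⟨[], rfl⟩
  | mul x y _ _ hx hy =>
    obtain ⟨l, rfl⟩ := hx
    obtain ⟨m, rfl⟩ := hy
    exact ⟨l ++ m, by simp⟩
  | inv x _ hx =>
    obtain ⟨l, rfl⟩ := hx
    refine ⟨l.reverse, ?_⟩
    clear * -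
    induction l with
    | nil => simp
    | cons i l ih => simp [ih]

theorem N_s_mul_of_notMem {i : ι} {w : G} (h : K.s i ∉ K.N w) :
    K.N (K.s i * w) = insert (K.s i) ((fun t => K.s i * t * K.s i) '' K.N w) := by
  ext t
  rw [K.mem_N_s_mul, Set.mem_insert_iff]
  have h2 : t ∈ (fun t => K.s i * t * K.s i) '' K.N w ↔ K.s i * t * K.s i ∈ K.N w := by
    constructor
    · rintro ⟨u, hu, rfl⟩
      have : K.s i * (K.s i * u * K.s i) * K.s i = u := by
        simp [mul_assoc, K.s_mul_self]
      simpa only [this] using hu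
    · intro ht
      exact ⟨_, ht, by simp [mul_assoc, K.s_mul_self]⟩
  rw [h2]
  by_cases ht : t = K.s i
  · subst ht
    rw [K.s_mul_self, one_mul]
    simp [h]
  · simp [ht]

theorem N_finite (w : G) : (K.N w).Finite := by
  obtain ⟨l, rfl⟩ := K.exists_word w
  induction l with
  | nil => rw [word_nil, N_one]; exact Set.finite_empty
  | cons i l ih =>
    rw [word_cons]
    refine ((ih.image (fun t => K.s i * t * K.s i)).insert (K.s i)).subset ?_
    intro t ht
    rw [K.mem_N_s_mul] at ht
    by_cases h : t = K.s i
    · exact Or.inl h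
    · refine Or.inr ⟨K.s i * t * K.s i, ?_, by simp [mul_assoc, K.s_mul_self]⟩
      simpa [h] using ht

theorem len_s_mul_of_notMem {i : ι} {w : G} (h : K.s i ∉ K.N w) :
    K.len (K.s i * w) = K.len w + 1 := by
  rw [len, len, K.N_s_mul_of_notMem h, Set.ncard_insert_of_notMem _ ((K.N_finite w).image _),
    Set.ncard_image_of_injective]
  · intro a b hab
    simpa using hab
  · rintro ⟨u, hu, hu'⟩
    have : u = K.s i := by
      have h3 : K.s i * (K.s i * u * K.s i) * K.s i = u := by simp [mul_assoc, K.s_mul_self]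
      rw [← h3]
      simp only at hu'
      rw [hu', K.s_mul_self, one_mul]
    exact h (this ▸ hu)

theorem len_s_mul_of_mem {i : ι} {w : G} (h : K.s i ∈ K.N w) :
    K.len (K.s i * w) + 1 = K.len w := by
  have h1 : K.s i ∉ K.N (K.s i * w) := by rw [K.s_mem_N_s_mul]; simpa using h
  have := K.len_s_mul_of_notMem h1
  rw [K.s_mul_s_mul] at this
  exact this.symm

theorem len_word_le (l : List ι) : K.len (K.word l) ≤ l.length := by
  induction l with
  | nil => simp [len, N_one]
  | cons i l ih =>
    rw [word_cons, List.length_cons]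
    by_cases h : K.s i ∈ K.N (K.word l)
    · have := K.len_s_mul_of_mem h
      omega
    · rw [K.len_s_mul_of_notMem h]
      omega

/-- The exchange condition. An inversion of s_i w other than s_i is the s_i-conjugate of an
inversion of w, so induction reaches the letter to delete. The inclusion l' ⊆ l is kept so that
reduced words of elements of a parabolic subgroup stay inside it. -/
theorem exists_delete (l : List ι) : ∀ t ∈ K.N (K.word l), ∃ l' : List ι, l' ⊆ l ∧
    t * K.word l = K.word l' ∧ l'.length + 1 = l.length := by
  induction l with
  | nil => intro t ht; simp [N_one] at ht
  | cons i l ih =>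
    intro t ht
    rw [word_cons, K.mem_N_s_mul] at ht
    by_cases h : t = K.s i
    · exact ⟨l, List.subset_cons_self i l, by rw [h, word_cons, K.s_mul_s_mul], rfl⟩
    · obtain ⟨l', hl', e, hlen⟩ := ih (K.s i * t * K.s i) (by simpa [h] using ht)
      refine ⟨i :: l', List.cons_subset_cons i hl', ?_, by simp [hlen]⟩
      rw [word_cons, word_cons, ← e]
      simp only [mul_assoc, K.s_mul_s_mul]

theorem exists_reduced_subset (l : List ι) : ∃ l' : List ι, l' ⊆ l ∧ K.word l' = K.word l ∧
    l'.length = K.len (K.word l) := by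
  induction l with
  | nil => exact ⟨[], by simp, rfl, by simp [len, N_one]⟩
  | cons i l ih =>
    obtain ⟨l', hl', e, hlen⟩ := ih
    by_cases h : K.s i ∈ K.N (K.word l)
    · obtain ⟨l'', hl'', e', hlen'⟩ := K.exists_delete l' (K.s i) (by rwa [e])
      refine ⟨l'', fun x hx => List.mem_cons_of_mem _ (hl' (hl'' hx)), ?_, ?_⟩
      · rw [← e', e, word_cons]
      · have := K.len_s_mul_of_mem h
        rw [word_cons]
        omega
    · refine ⟨i :: l', List.cons_subset_cons i hl', by simp [e], ?_⟩
      rw [word_cons, K.len_s_mul_of_notMem h, List.length_cons, hlen]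

theorem exists_reduced (w : G) : ∃ l, K.word l = w ∧ l.length = K.len w := by
  obtain ⟨l, rfl⟩ := K.exists_word w
  obtain ⟨l', -, h, h'⟩ := K.exists_reduced_subset l
  exact ⟨l', h, h'⟩

theorem eq_one_of_len_eq_zero {w : G} (h : K.len w = 0) : w = 1 := by
  obtain ⟨l, rfl, hl⟩ := K.exists_reduced w
  rw [h, List.length_eq_zero_iff] at hl
  rw [hl, word_nil]

theorem len_one : K.len 1 = 0 := by simp [len, N_one]

theorem eq_one_of_N_eq_empty {w : G} (h : K.N w = ∅) : w = 1 :=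
  K.eq_one_of_len_eq_zero (by simp [len, h])

theorem s_mem_N_of_reduced {i : ι} {l : List ι} (h : K.len (K.word (i :: l)) = l.length + 1) :
    K.s i ∈ K.N (K.word (i :: l)) := by
  rw [word_cons] at h ⊢
  rw [K.s_mem_N_s_mul]
  intro h1
  have h2 := K.len_s_mul_of_mem h1
  have h3 := K.len_word_le l
  omega

theorem len_tail_of_reduced {i : ι} {l : List ι} (h : K.len (K.word (i :: l)) = l.length + 1) :
    K.len (K.word l) = l.length := by
  have h1 := K.s_mem_N_of_reduced h
  rw [word_cons] at h h1
  rw [K.s_mem_N_s_mul] at h1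
  have := K.len_s_mul_of_notMem h1
  omega

theorem exists_s_mem_N {w : G} (hw : w ≠ 1) : ∃ i, K.s i ∈ K.N w := by
  obtain ⟨l, rfl, hl⟩ := K.exists_reduced w
  cases l with
  | nil => exact absurd rfl hw
  | cons i l => exact ⟨i, K.s_mem_N_of_reduced hl.symm⟩

theorem len_mul_lt_of_mem_N {t w : G} (h : t ∈ K.N w) : K.len (t * w) < K.len w := by
  obtain ⟨l, rfl, hl⟩ := K.exists_reduced w
  obtain ⟨l', -, e, hlen⟩ := K.exists_delete l t h
  rw [e]
  have := K.len_word_le l'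
  omega

theorem N_injective : Function.Injective K.N := by
  intro u v h
  have h1 : K.N (u⁻¹ * v) = ∅ := by
    ext t
    have h2 := K.mem_N_mul (u * t * u⁻¹) u (u⁻¹ * v)
    have e : u⁻¹ * (u * t * u⁻¹) * u = t := by group
    rw [mul_inv_cancel_left, e, ← h] at h2
    simp only [Set.mem_empty_iff_false, iff_false]
    tauto
  have := K.eq_one_of_N_eq_empty h1
  rwa [inv_mul_eq_one] at this

/-! #### The weak order -/

theorem N_mul_subset_of_subset {x y z : G} (h : K.N x ⊆ K.N (x * z)) (hyz : K.N y ⊆ K.N z) :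
    K.N (x * y) ⊆ K.N (x * z) := by
  intro t ht
  by_cases h1 : t ∈ K.N x
  · exact h h1
  · rw [K.mem_N_mul] at ht ⊢
    have : x⁻¹ * t * x ∈ K.N z := hyz (by tauto)
    tauto

theorem subset_of_N_mul_subset {x y z : G} (h : K.N x ⊆ K.N (x * y))
    (hyz : K.N (x * y) ⊆ K.N (x * z)) : K.N y ⊆ K.N z := by
  intro t ht
  have e : x⁻¹ * (x * t * x⁻¹) * x = t := by group
  have h1 := K.mem_N_mul (x * t * x⁻¹) x y
  have h2 := K.mem_N_mul (x * t * x⁻¹) x z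
  rw [e] at h1 h2
  have h3 := @h (x * t * x⁻¹)
  have h4 := @hyz (x * t * x⁻¹)
  tauto

/-- The inclusion turns the symmetric difference of the cocycle rule into a disjoint union. It
therefore serves throughout as the definition of a reduced product; `len_mul_of_subset` and
`subset_of_len_mul` identify it with additivity of lengths. -/
theorem N_mul_eq_of_subset {u v : G} (h : K.N u ⊆ K.N (u * v)) :
    K.N (u * v) = K.N u ∪ (fun t => u * t * u⁻¹) '' K.N v ∧
      Disjoint (K.N u) ((fun t => u * t * u⁻¹) '' K.N v) := by
  have key : ∀ t, t ∈ (fun t => u * t * u⁻¹) '' K.N v ↔ u⁻¹ * t * u ∈ K.N v := by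
    intro t
    constructor
    · rintro ⟨r, hr, rfl⟩
      have : u⁻¹ * (u * r * u⁻¹) * u = r := by group
      simpa only [this] using hr
    · intro ht
      exact ⟨_, ht, by group⟩
  constructor
  · ext t
    have h1 := K.mem_N_mul t u v
    have h2 := @h t
    rw [Set.mem_union, key]
    tauto
  · rw [Set.disjoint_left]
    intro t ht ht'
    rw [key] at ht'
    have h1 := K.mem_N_mul t u v
    have h2 := h ht
    tauto

theorem len_mul_of_subset {u v : G} (h : K.N u ⊆ K.N (u * v)) :
    K.len (u * v) = K.len u + K.len v := by
  obtain ⟨h1, h2⟩ := K.N_mul_eq_of_subset h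
  rw [len, h1, Set.ncard_union_eq h2 (K.N_finite u) ((K.N_finite v).image _),
    Set.ncard_image_of_injective _ (fun a b hab => by simpa using hab), len, len]

theorem subset_of_len_mul {u v : G} (h : K.len (u * v) = K.len u + K.len v) :
    K.N u ⊆ K.N (u * v) := by
  intro t ht
  by_contra hn
  have h1 : u⁻¹ * t * u ∈ K.N v := by
    rw [K.mem_N_mul] at hn
    tauto
  have h2 : K.N (u * v) ⊆ (K.N u \ {t}) ∪ (fun t => u * t * u⁻¹) '' (K.N v \ {u⁻¹ * t * u}) := by
    intro r hr
    have hrt : r ≠ t := fun h => hn (h ▸ hr)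
    rw [K.mem_N_mul] at hr
    by_cases hru : r ∈ K.N u
    · exact Or.inl ⟨hru, hrt⟩
    · refine Or.inr ⟨u⁻¹ * r * u, ⟨by tauto, ?_⟩, by group⟩
      simpa using hrt
  have hf1 : (K.N u \ {t}).Finite := (K.N_finite u).subset Set.sdiff_subset
  have hf2 : (K.N v \ {u⁻¹ * t * u}).Finite := (K.N_finite v).subset Set.sdiff_subset
  have h3 := Set.ncard_le_ncard h2 (hf1.union (hf2.image _))
  have h4 := Set.ncard_union_le (K.N u \ {t})
    ((fun t => u * t * u⁻¹) '' (K.N v \ {u⁻¹ * t * u}))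
  have h5 := Set.ncard_image_le (f := fun t => u * t * u⁻¹) hf2
  have h6 := Set.ncard_sdiff_singleton_add_one ht (K.N_finite u)
  have h7 := Set.ncard_sdiff_singleton_add_one h1 (K.N_finite v)
  simp only [len] at h
  omega

theorem N_s_subset_iff {i : ι} {w : G} : K.N (K.s i) ⊆ K.N w ↔ K.s i ∈ K.N w := by
  constructor
  · intro h
    exact h ((K.mem_N_s _ _).2 rfl)
  · intro h t ht
    rw [(K.mem_N_s _ _).1 ht]
    exact h

theorem len_le_of_subset {u v : G} (h : K.N u ⊆ K.N v) : K.len u ≤ K.len v :=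
  Set.ncard_le_ncard h (K.N_finite v)

theorem eq_simple_of_len_eq_one {w : G} (h : K.len w = 1) : ∃ i, w = K.s i := by
  obtain ⟨l, rfl, hl⟩ := K.exists_reduced w
  rw [h] at hl
  obtain ⟨i, rfl⟩ := List.length_eq_one_iff.1 hl
  exact ⟨i, by simp⟩

theorem len_s (i : ι) : K.len (K.s i) = 1 := by
  have : K.N (K.s i) = {K.s i} := by ext t; exact K.mem_N_s t i
  rw [len, this, Set.ncard_singleton]

/-! #### Reflections and parabolic subgroups -/

/-- The conjugates of the generators. -/
def refl : Set G := {t | ∃ g i, t = g * K.s i * g⁻¹}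

theorem s_mem_refl (i : ι) : K.s i ∈ K.refl := ⟨1, i, by simp⟩

theorem conj_mem_refl {t : G} (ht : t ∈ K.refl) (g : G) : g * t * g⁻¹ ∈ K.refl := by
  obtain ⟨h, i, rfl⟩ := ht
  exact ⟨g * h, i, by group⟩

theorem N_subset_refl (w : G) : K.N w ⊆ K.refl := by
  obtain ⟨l, rfl⟩ := K.exists_word w
  induction l with
  | nil => simp [N_one]
  | cons i l ih =>
    intro t ht
    rw [word_cons, K.mem_N_s_mul] at ht
    by_cases h : t = K.s i
    · exact h ▸ K.s_mem_refl i
    · have h1 := K.conj_mem_refl (ih (show K.s i * t * K.s i ∈ _ by simpa [h] using ht)) (K.s i)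
      simpa [mul_assoc, K.s_mul_self] using h1

theorem N_w₀ : K.N K.w₀ = K.refl := by
  refine Set.Subset.antisymm (K.N_subset_refl _) ?_
  rintro _ ⟨g, i, rfl⟩
  exact K.conj_mem_N_w₀ g i

theorem mem_N_mul_w₀ {t : G} (ht : t ∈ K.refl) (u : G) : t ∈ K.N (u * K.w₀) ↔ t ∉ K.N u := by
  have : u⁻¹ * t * u ∈ K.N K.w₀ := by
    rw [N_w₀]
    simpa using K.conj_mem_refl ht u⁻¹
  rw [K.mem_N_mul]
  tauto

/-- The subgroup generated by the `s i`, `i ∈ I`. -/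
def par (I : Set ι) : Subgroup G := Subgroup.closure (K.s '' I)

theorem s_mem_par {I : Set ι} {i : ι} (hi : i ∈ I) : K.s i ∈ K.par I :=
  Subgroup.subset_closure ⟨i, hi, rfl⟩

theorem word_mem_par {I : Set ι} {l : List ι} (hl : ∀ i ∈ l, i ∈ I) : K.word l ∈ K.par I := by
  induction l with
  | nil => exact one_mem _
  | cons i l ih =>
    rw [word_cons]
    exact mul_mem (K.s_mem_par (hl i (by simp))) (ih fun j hj => hl j (by simp [hj]))

theorem exists_word_of_mem_par {I : Set ι} {w : G} (hw : w ∈ K.par I) :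
    ∃ l, (∀ i ∈ l, i ∈ I) ∧ K.word l = w := by
  induction hw using Subgroup.closure_induction with
  | mem x hx =>
    obtain ⟨i, hi, rfl⟩ := hx
    exact ⟨[i], by simpa using hi, by simp⟩
  | one => exact ⟨[], by simp, rfl⟩
  | mul x y _ _ hx hy =>
    obtain ⟨l, hl, rfl⟩ := hx
    obtain ⟨m, hm, rfl⟩ := hy
    refine ⟨l ++ m, fun i hi => ?_, by simp⟩
    rcases List.mem_append.1 hi with h | h
    exacts [hl i h, hm i h]
  | inv x _ hx =>
    obtain ⟨l, hl, rfl⟩ := hx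
    refine ⟨l.reverse, by simpa using hl, ?_⟩
    clear * -
    induction l with
    | nil => simp
    | cons i l ih => simp [ih]

theorem exists_reduced_of_mem_par {I : Set ι} {w : G} (hw : w ∈ K.par I) :
    ∃ l, (∀ i ∈ l, i ∈ I) ∧ K.word l = w ∧ l.length = K.len w := by
  obtain ⟨l, hl, rfl⟩ := K.exists_word_of_mem_par hw
  obtain ⟨l', hl', e, hlen⟩ := K.exists_reduced_subset l
  exact ⟨l', fun i hi => hl i (hl' hi), e, hlen⟩

theorem N_subset_par {I : Set ι} {w : G} (hw : w ∈ K.par I) : K.N w ⊆ K.par I := by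
  obtain ⟨l, hl, rfl⟩ := K.exists_word_of_mem_par hw
  clear hw
  induction l with
  | nil => simp [N_one]
  | cons i l ih =>
    intro t ht
    have hi := K.s_mem_par (hl i (by simp))
    rw [word_cons, K.mem_N_s_mul] at ht
    by_cases h : t = K.s i
    · exact h ▸ hi
    · have h1 : K.s i * t * K.s i ∈ K.par I :=
        ih (fun j hj => hl j (by simp [hj])) (by simpa [h] using ht)
      have := mul_mem (mul_mem hi h1) hi
      simpa [mul_assoc, K.s_mul_self] using this

theorem s_mem_par_iff {I : Set ι} {j : ι} : K.s j ∈ K.par I ↔ j ∈ I := by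
  refine ⟨fun h => ?_, K.s_mem_par⟩
  obtain ⟨l, hl, e, hlen⟩ := K.exists_reduced_of_mem_par h
  rw [K.len_s] at hlen
  obtain ⟨i, rfl⟩ := List.length_eq_one_iff.1 hlen
  have : i = j := K.s_injective (by simpa using e)
  exact this ▸ hl i (by simp)

theorem par_mono {I J : Set ι} (h : I ⊆ J) : K.par I ≤ K.par J :=
  Subgroup.closure_mono (Set.image_mono h)

theorem par_univ : K.par Set.univ = ⊤ := by rw [par, Set.image_univ, K.closure_range]

/-- Multiplying by an inversion that lies in the parabolic subgroup shortens g, so the process stops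
at a minimal coset representative. The last clause concerns all elements of the subgroup, not only
its generators. -/
theorem exists_par_decomp (I : Set ι) (g : G) :
    ∃ a ∈ K.par I, ∃ b, g = a * b ∧ ∀ t ∈ K.par I, t ∉ K.N b := by
  induction h : K.len g using Nat.strong_induction_on generalizing g with
  | _ n ih =>
    by_cases hg : ∃ t ∈ K.par I, t ∈ K.N g
    · obtain ⟨t, ht, htg⟩ := hg
      obtain ⟨a, ha, b, hab, hb⟩ := ih _ (h ▸ K.len_mul_lt_of_mem_N htg) (t * g) rfl
      exact ⟨t⁻¹ * a, mul_mem (inv_mem ht) ha, b, by rw [mul_assoc, ← hab]; group, hb⟩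
    · push Not at hg
      exact ⟨1, one_mem _, g, by simp, hg⟩

theorem mem_N_par_mul {I : Set ι} {a b t : G} (ha : a ∈ K.par I)
    (hb : ∀ t ∈ K.par I, t ∉ K.N b) (ht : t ∈ K.par I) : t ∈ K.N (a * b) ↔ t ∈ K.N a := by
  have := hb (a⁻¹ * t * a) (mul_mem (mul_mem (inv_mem ha) ht) ha)
  rw [K.mem_N_mul]
  tauto

/-- If no simple reflection of a parabolic subgroup is an inversion, then no element of it is. -/
theorem notMem_N_of_par {I : Set ι} {g : G} (h : ∀ i ∈ I, K.s i ∉ K.N g) {t : G}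
    (ht : t ∈ K.par I) : t ∉ K.N g := by
  obtain ⟨a, ha, b, rfl, hb⟩ := K.exists_par_decomp I g
  rw [K.mem_N_par_mul ha hb ht]
  by_cases ha1 : a = 1
  · simp [ha1, N_one]
  · obtain ⟨j, hj⟩ := K.exists_s_mem_N ha1
    have hj1 := K.N_subset_par ha hj
    have hj2 := K.s_mem_par_iff.1 hj1
    exact absurd ((K.mem_N_par_mul ha hb hj1).2 hj) (h j hj2)

/-- Right multiplication by `w₀` complements inversion sets within the reflections, which reduces
this to `notMem_N_of_par`. -/
theorem mem_N_of_par {I : Set ι} {g : G} (h : ∀ i ∈ I, K.s i ∈ K.N g) {t : G}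
    (ht : t ∈ K.par I) (htr : t ∈ K.refl) : t ∈ K.N g := by
  have := K.notMem_N_of_par (g := g * K.w₀) (I := I)
    (fun i hi => by rw [K.mem_N_mul_w₀ (K.s_mem_refl i)]; simpa using h i hi) ht
  rw [K.mem_N_mul_w₀ htr] at this
  simpa using this

/-- The longest element of a parabolic subgroup. -/
theorem exists_longest (I : Set ι) : ∃ w ∈ K.par I, K.N w = K.refl ∩ K.par I := by
  obtain ⟨a, ha, b, hab, hb⟩ := K.exists_par_decomp I K.w₀
  refine ⟨a, ha, ?_⟩
  ext t
  constructor
  · exact fun ht => ⟨K.N_subset_refl _ ht, K.N_subset_par ha ht⟩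
  · rintro ⟨ht, ht'⟩
    rw [← K.mem_N_par_mul ha hb ht', ← hab, N_w₀]
    exact ht

/-- The longest element of a parabolic subgroup. -/
def wI (I : Set ι) : G := (K.exists_longest I).choose

theorem wI_mem (I : Set ι) : K.wI I ∈ K.par I := (K.exists_longest I).choose_spec.1

theorem N_wI (I : Set ι) : K.N (K.wI I) = K.refl ∩ K.par I := (K.exists_longest I).choose_spec.2

theorem eq_wI {I : Set ι} {w : G} (hw : w ∈ K.par I) (h : ∀ i ∈ I, K.s i ∈ K.N w) :
    w = K.wI I := by
  apply K.N_injective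
  rw [N_wI]
  ext t
  exact ⟨fun ht => ⟨K.N_subset_refl _ ht, K.N_subset_par hw ht⟩,
    fun ht => K.mem_N_of_par h ht.2 ht.1⟩

theorem wI_mul_self (I : Set ι) : K.wI I * K.wI I = 1 := by
  apply K.eq_one_of_N_eq_empty
  ext t
  have h1 := K.wI_mem I
  have e : (K.wI I)⁻¹ * t * K.wI I ∈ K.refl ↔ t ∈ K.refl := by
    constructor
    · intro h
      have := K.conj_mem_refl h (K.wI I)
      have e : K.wI I * ((K.wI I)⁻¹ * t * K.wI I) * (K.wI I)⁻¹ = t := by group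
      rwa [e] at this
    · intro h
      simpa using K.conj_mem_refl h (K.wI I)⁻¹
  have e' : (K.wI I)⁻¹ * t * K.wI I ∈ K.par I ↔ t ∈ K.par I := by
    rw [Subgroup.mul_mem_cancel_right _ h1, Subgroup.mul_mem_cancel_left _ (inv_mem h1)]
  rw [K.mem_N_mul, N_wI, Set.mem_inter_iff, Set.mem_inter_iff, SetLike.mem_coe, SetLike.mem_coe,
    e, e']
  simp

theorem wI_univ : K.wI Set.univ = K.w₀ := by
  apply K.N_injective
  rw [N_wI, N_w₀, par_univ]
  simp

/-! #### Dihedral subgroups -/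

/-- The alternating word `i j i ⋯` with `n` letters. -/
def alt {ι : Type*} (i j : ι) : ℕ → List ι
  | 0 => []
  | n + 1 => i :: alt j i n

@[simp] theorem alt_length {ι : Type*} (i j : ι) (n : ℕ) : (alt i j n).length = n := by
  induction n generalizing i j with
  | zero => rfl
  | succ n ih => simp [alt, ih]

theorem word_alt_mul_inv (i j : ι) (n : ℕ) :
    K.word (alt i j n) * (K.word (alt j i n))⁻¹ = (K.s i * K.s j) ^ n := by
  induction n generalizing i j with
  | zero => simp [alt]
  | succ n ih =>
    have h := ih j i
    rw [alt, alt, word_cons, word_cons, mul_inv_rev, s_inv]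
    calc K.s i * K.word (alt j i n) * ((K.word (alt i j n))⁻¹ * K.s j)
        = K.s i * (K.word (alt j i n) * (K.word (alt i j n))⁻¹) * K.s j := by group
      _ = K.s i * (K.s j * K.s i) ^ n * K.s j := by rw [h]
      _ = (K.s i * K.s j) ^ (n + 1) := by
        clear * -
        induction n with
        | zero => simp
        | succ n ih => rw [pow_succ' _ (n + 1), ← ih, pow_succ']; simp only [mul_assoc]

/-- After stripping s_i, the remainder no longer has s_i as an inversion. If it is not trivial it
must then have s_j, so the letters alternate. -/
theorem eq_word_alt {i j : ι} {x : G} (hx : x ∈ K.par {i, j}) (h : K.s i ∈ K.N x) :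
    x = K.word (alt i j (K.len x)) := by
  induction hn : K.len x generalizing i j x with
  | zero =>
    rw [K.eq_one_of_len_eq_zero hn, N_one] at h
    exact absurd h (Set.notMem_empty _)
  | succ n ih =>
    have hl := K.len_s_mul_of_mem h
    have h1 : K.s i ∉ K.N (K.s i * x) := by rw [K.s_mem_N_s_mul]; simpa using h
    have hx1 : K.s i * x ∈ K.par {i, j} := mul_mem (K.s_mem_par (by simp)) hx
    have key : K.s i * x = K.word (alt j i n) := by
      by_cases hx2 : K.s i * x = 1
      · have : n = 0 := by rw [hx2, K.len_one] at hl; omega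
        rw [hx2, this]
        rfl
      · obtain ⟨k, hk⟩ := K.exists_s_mem_N hx2
        have hk1 : k ∈ ({i, j} : Set ι) := K.s_mem_par_iff.1 (K.N_subset_par hx1 hk)
        rcases hk1 with rfl | rfl
        · exact absurd hk h1
        · exact ih (by rwa [Set.pair_comm]) hk (by omega)
    rw [alt, word_cons, ← key, s_mul_s_mul]

theorem alt_descend {i j : ι} {n : ℕ} (h : K.len (K.word (alt i j n)) = n) {k : ℕ} (hk : k ≤ n) :
    K.len (K.word (alt i j k)) = k ∨ K.len (K.word (alt j i k)) = k := by
  induction n generalizing i j with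
  | zero =>
    obtain rfl : k = 0 := by omega
    exact Or.inl h
  | succ n ih =>
    rcases Nat.lt_or_ge n k with h1 | h1
    · obtain rfl : k = n + 1 := by omega
      exact Or.inl h
    · have h2 := K.len_tail_of_reduced (i := i) (l := alt j i n) (by rw [alt_length]; exact h)
      rw [alt_length] at h2
      exact (ih h2 h1).symm

theorem word_alt_eq_wI (i j : ι) :
    K.word (alt i j (orderOf (K.s i * K.s j))) = K.wI {i, j} ∧
      K.len (K.wI {i, j}) = orderOf (K.s i * K.s j) := by
  set x := K.wI {i, j} with hx
  have hi : K.s i ∈ K.N x := by rw [hx, N_wI]; exact ⟨K.s_mem_refl i, K.s_mem_par (by simp)⟩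
  have hj : K.s j ∈ K.N x := by rw [hx, N_wI]; exact ⟨K.s_mem_refl j, K.s_mem_par (by simp)⟩
  have h1 := K.eq_word_alt (K.wI_mem {i, j}) hi
  have h2 := K.eq_word_alt (i := j) (j := i) (by rw [Set.pair_comm]; exact K.wI_mem {i, j}) hj
  set n := K.len x
  set m := orderOf (K.s i * K.s j)
  have h3 : m ∣ n := by
    apply orderOf_dvd_of_pow_eq_one
    rw [← K.word_alt_mul_inv, ← h1, ← h2, mul_inv_cancel]
  have hn : n ≠ 0 := by
    intro h0
    rw [K.eq_one_of_len_eq_zero h0, N_one] at hi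
    exact hi
  have hm : m ≠ 0 := by
    rintro h0
    rw [h0, zero_dvd_iff] at h3
    exact hn h3
  -- If n > m, one of the alternating words with m + 1 letters is a tail of a reduced word, hence
  -- reduced. But the two alternating words with m letters are equal, so its first two letters
  -- cancel and m - 1 letters remain.
  have h4 : n ≤ m := by
    by_contra hlt
    have e : K.word (alt i j m) = K.word (alt j i m) := by
      have := K.word_alt_mul_inv i j m
      rw [pow_orderOf_eq_one, mul_inv_eq_one] at this
      exact this
    obtain ⟨p, hp⟩ := Nat.exists_eq_succ_of_ne_zero hm
    have hred := K.alt_descend (i := i) (j := j) (n := n) (by rw [← h1]) (k := m + 1) (by omega)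
    have e1 : K.word (alt i j (m + 1)) = K.word (alt j i p) := by
      rw [alt, word_cons, ← e, hp, alt, word_cons, s_mul_s_mul]
    have e2 : K.word (alt j i (m + 1)) = K.word (alt i j p) := by
      rw [alt, word_cons, e, hp, alt, word_cons, s_mul_s_mul]
    rw [e1, e2] at hred
    have b1 := K.len_word_le (alt j i p)
    have b2 := K.len_word_le (alt i j p)
    rw [alt_length] at b1 b2
    omega
  have h5 : n = m := le_antisymm h4 (Nat.le_of_dvd (Nat.pos_of_ne_zero hn) h3)
  exact ⟨by rw [← h5, ← h1], h5⟩

theorem wI_pair_subset {i j : ι} {w : G} (hi : K.s i ∈ K.N w) (hj : K.s j ∈ K.N w) :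
    K.N (K.wI {i, j}) ⊆ K.N w := by
  intro t ht
  rw [N_wI] at ht
  exact K.mem_N_of_par (by rintro k (rfl | rfl) <;> assumption) ht.2 ht.1

/-- Matsumoto's theorem. -/
theorem map_prod_eq_of_reduced {Q : Type*} [Monoid Q] (f : ι → Q)
    (hf : ∀ i j, ((alt i j (orderOf (K.s i * K.s j))).map f).prod =
      ((alt j i (orderOf (K.s i * K.s j))).map f).prod) {l l' : List ι}
    (hl : K.len (K.word l) = l.length) (hl' : K.len (K.word l') = l'.length)
    (h : K.word l = K.word l') : (l.map f).prod = (l'.map f).prod := by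
  induction hn : l.length generalizing l l' with
  | zero =>
    have : l'.length = 0 := by rw [← hl', ← h, hl, hn]
    rw [List.length_eq_zero_iff] at hn this
    rw [hn, this]
  | succ n ih =>
    have hn' : l'.length = n + 1 := by rw [← hl', ← h, hl, hn]
    obtain ⟨i, a, rfl⟩ := List.exists_cons_of_length_eq_add_one hn
    obtain ⟨j, b, rfl⟩ := List.exists_cons_of_length_eq_add_one hn'
    have ha := K.len_tail_of_reduced hl
    have hb := K.len_tail_of_reduced hl'
    simp only [List.length_cons, Nat.add_right_cancel_iff] at hn hn'
    rw [List.map_cons, List.map_cons, List.prod_cons, List.prod_cons]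
    by_cases hij : i = j
    · subst hij
      rw [word_cons, word_cons, mul_left_cancel_iff] at h
      rw [ih ha hb h hn]
    · have hi := K.s_mem_N_of_reduced hl
      have hj := K.s_mem_N_of_reduced hl'
      rw [← h] at hj
      obtain ⟨e1, hm⟩ := K.word_alt_eq_wI i j
      obtain ⟨e2, -⟩ := K.word_alt_eq_wI j i
      have horder : orderOf (K.s j * K.s i) = orderOf (K.s i * K.s j) := by
        rw [← orderOf_inv, mul_inv_rev, s_inv, s_inv]
      rw [Set.pair_comm, horder] at e2
      have hsub := K.wI_pair_subset hi hj
      set w := K.word (i :: a) with hw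
      -- Both first letters are inversions of w, so w factors as a reduced product of the dihedral
      -- longest element and c. Each given word shares its first letter with an alternating word
      -- followed by c, so induction compares them, and the hypothesis on f exchanges the two
      -- alternating words.
      obtain ⟨c, hc, hclen⟩ := K.exists_reduced ((K.wI {i, j})⁻¹ * w)
      have hlen := K.len_mul_of_subset (u := K.wI {i, j}) (v := (K.wI {i, j})⁻¹ * w)
        (by rwa [mul_inv_cancel_left])
      rw [mul_inv_cancel_left] at hlen
      set m := orderOf (K.s i * K.s j) with hmdef
      have hm0 : m ≠ 0 := by
        intro h0
        rw [h0] at hm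
        have h1 := K.N_wI {i, j}
        rw [K.eq_one_of_len_eq_zero hm, N_one] at h1
        have : K.s i ∈ (∅ : Set G) := by
          rw [h1]; exact ⟨K.s_mem_refl i, K.s_mem_par (by simp)⟩
        exact this
      obtain ⟨p, hp⟩ := Nat.exists_eq_succ_of_ne_zero hm0
      have key : ∀ (i j : ι) (a : List ι), K.len (K.word a) = a.length → a.length = n →
          K.word (i :: a) = w → K.word (alt i j m) * K.word c = w →
          f i * (a.map f).prod = ((alt i j m).map f).prod * (c.map f).prod := by
        intro i j a ha hna hw1 hw2
        have e : K.word a = K.word (alt j i p ++ c) := by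
          rw [← hw2, hp, alt, word_cons, word_cons, mul_assoc, mul_left_cancel_iff] at hw1
          rw [hw1, word_append]
        have hlc : (alt j i p ++ c).length = n := by
          have h0 : K.len w = n + 1 := by rw [hl, List.length_cons, hn]
          rw [List.length_append, alt_length]
          omega
        rw [ih ha (by rw [← e, ha, hna, hlc]) e hna, hp, alt, List.map_cons, List.prod_cons,
          List.map_append, List.prod_append, mul_assoc]
      rw [key i j a ha hn rfl (by rw [e1, hc, mul_inv_cancel_left]),
        key j i b hb hn' h.symm (by rw [e2, hc, mul_inv_cancel_left]), hf i j]

/-- Two elements have a meet in the weak order. -/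
theorem exists_meet_above (u v : G) (n : ℕ) (x : G) (hn : K.len u ≤ K.len x + n)
    (hu : K.N x ⊆ K.N u) (hv : K.N x ⊆ K.N v) :
    ∃ m, K.N x ⊆ K.N m ∧ K.N m ⊆ K.N u ∧ K.N m ⊆ K.N v ∧
      ∀ z, K.N x ⊆ K.N z → K.N z ⊆ K.N u → K.N z ⊆ K.N v → K.N z ⊆ K.N m := by
  -- The number n bounds how far x can still rise before reaching u.
  induction n using Nat.strong_induction_on generalizing x with
  | _ n ih =>
    -- an element strictly above `x` lies above some `x * s i` covering `x`
    have step : ∀ z, K.N x ⊆ K.N z → z ≠ x → ∃ i, K.N x ⊆ K.N (x * K.s i) ∧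
        K.N (x * K.s i) ⊆ K.N z ∧ K.s i ∈ K.N (x⁻¹ * z) := by
      intro z hz hzx
      obtain ⟨i, hi⟩ := K.exists_s_mem_N (w := x⁻¹ * z) (fun h => hzx (inv_mul_eq_one.1 h).symm)
      have hz' : K.N x ⊆ K.N (x * (x⁻¹ * z)) := by rwa [mul_inv_cancel_left]
      have h1 := K.N_mul_subset_of_subset hz' (K.N_s_subset_iff.2 hi)
      rw [mul_inv_cancel_left] at h1
      refine ⟨i, ?_, h1, hi⟩
      intro t ht
      rw [K.mem_N_mul]
      have h2 := (K.N_mul_eq_of_subset hz').2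
      rw [Set.disjoint_left] at h2
      intro h3
      exact h2 ht ⟨x⁻¹ * t * x, (K.N_s_subset_iff.2 hi) (h3.1 ht), by group⟩
    by_cases hx : ∃ z, K.N x ⊆ K.N z ∧ K.N z ⊆ K.N u ∧ K.N z ⊆ K.N v ∧ z ≠ x
    · obtain ⟨z₀, h0, h0u, h0v, h0x⟩ := hx
      obtain ⟨i, hi1, hi2, hi3⟩ := step z₀ h0 h0x
      have hlen : ∀ j, K.N x ⊆ K.N (x * K.s j) → K.len (x * K.s j) = K.len x + 1 := by
        intro j hj
        rw [K.len_mul_of_subset hj, K.len_s]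
      have hn0 : n ≠ 0 := by
        rintro rfl
        have h1 := K.len_le_of_subset (hi2.trans h0u)
        have h2 := hlen i hi1
        omega
      have IH := fun j (hj : K.N x ⊆ K.N (x * K.s j)) => ih (n - 1) (by omega) (x * K.s j)
        (by rw [hlen j hj]; omega)
      obtain ⟨m, hm1, hm2, hm3, hm4⟩ := IH i hi1 (hi2.trans h0u) (hi2.trans h0v)
      refine ⟨m, hi1.trans hm1, hm2, hm3, ?_⟩
      intro z hz hzu hzv
      by_cases hzx : z = x
      · rw [hzx]; exact hi1.trans hm1
      obtain ⟨j, hj1, hj2, hj3⟩ := step z hz hzx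
      by_cases hij : i = j
      · subst hij
        exact hm4 z hj2 hzu hzv
      obtain ⟨m', hm1', hm2', hm3', hm4'⟩ := IH j hj1 (hj2.trans hzu) (hj2.trans hzv)
      -- `y` is the join of `x * s i` and `x * s j`
      have hpair : ∀ w, K.N x ⊆ K.N w → K.N (x * K.s i) ⊆ K.N w → K.N (x * K.s j) ⊆ K.N w →
          K.N (x * K.wI {i, j}) ⊆ K.N w := by
        intro w hxw hiw hjw
        have e : K.N w = K.N (x * (x⁻¹ * w)) := by rw [mul_inv_cancel_left]
        rw [e] at hxw hiw hjw ⊢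
        exact K.N_mul_subset_of_subset hxw (K.wI_pair_subset
          (K.N_s_subset_iff.1 (K.subset_of_N_mul_subset hi1 hiw))
          (K.N_s_subset_iff.1 (K.subset_of_N_mul_subset hj1 hjw)))
      have hyu := hpair u hu (hi2.trans h0u) (hj2.trans hzu)
      have hyv := hpair v hv (hi2.trans h0v) (hj2.trans hzv)
      have hsub : ∀ k, k ∈ ({i, j} : Set ι) → K.N (K.s k) ⊆ K.N (K.wI {i, j}) := by
        intro k hk
        rw [K.N_s_subset_iff, N_wI]
        exact ⟨K.s_mem_refl k, K.s_mem_par hk⟩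
      have hxy : K.N x ⊆ K.N (x * K.wI {i, j}) := by
        intro t ht
        by_contra hn
        rw [K.mem_N_mul, not_not] at hn
        have h2 := hn.1 ht
        have e : K.N u = K.N (x * (x⁻¹ * u)) := by rw [mul_inv_cancel_left]
        have hxu := hu
        rw [e] at hxu
        have h3 := (K.N_mul_eq_of_subset hxu).2
        rw [Set.disjoint_left] at h3
        refine h3 ht ⟨_, K.wI_pair_subset (w := x⁻¹ * u) ?_ ?_ h2, by group⟩
        · have := hi2.trans h0u
          rw [e] at this
          exact K.N_s_subset_iff.1 (K.subset_of_N_mul_subset hi1 this)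
        · have := hj2.trans hzu
          rw [e] at this
          exact K.N_s_subset_iff.1 (K.subset_of_N_mul_subset hj1 this)
      have hiy := K.N_mul_subset_of_subset hxy (hsub i (by simp))
      have hjy := K.N_mul_subset_of_subset hxy (hsub j (by simp))
      obtain ⟨m'', hm1'', hm2'', hm3'', hm4''⟩ := ih (n - 1) (by omega) (x * K.wI {i, j})
        (by have := K.len_le_of_subset hiy; rw [hlen i hi1] at this; omega) hyu hyv
      -- The maxima m and m' above the two covers of x are compared through the maximum m'' above
      -- their join: m' lies above the join, so m' ≤ m'', and m'' lies above x * s i, so m'' ≤ m.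
      have h1 : K.N m' ⊆ K.N m'' := hm4'' m' (hm4' _ hjy hyu hyv) hm2' hm3'
      have h2 : K.N m'' ⊆ K.N m := hm4 m'' (hiy.trans hm1'') hm2'' hm3''
      exact (hm4' z hj2 hzu hzv).trans (h1.trans h2)
    · push Not at hx
      exact ⟨x, subset_rfl, hu, hv, fun z h1 h2 h3 => by rw [hx z h1 h2 h3]⟩

theorem exists_meet (u v : G) : ∃ m, K.N m ⊆ K.N u ∧ K.N m ⊆ K.N v ∧
    ∀ z, K.N z ⊆ K.N u → K.N z ⊆ K.N v → K.N z ⊆ K.N m := by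
  obtain ⟨m, -, h1, h2, h3⟩ := K.exists_meet_above u v (K.len u) 1 (by omega)
    (by simp [N_one]) (by simp [N_one])
  exact ⟨m, h1, h2, fun z => h3 z (by simp [N_one])⟩

/-- The meet of two elements in the weak order. -/
def meet (u v : G) : G := (K.exists_meet u v).choose

theorem meet_left (u v : G) : K.N (K.meet u v) ⊆ K.N u := (K.exists_meet u v).choose_spec.1

theorem meet_right (u v : G) : K.N (K.meet u v) ⊆ K.N v := (K.exists_meet u v).choose_spec.2.1

theorem subset_meet {u v z : G} (h : K.N z ⊆ K.N u) (h' : K.N z ⊆ K.N v) :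
    K.N z ⊆ K.N (K.meet u v) := (K.exists_meet u v).choose_spec.2.2 z h h'

end ReflectionCocycle

/-! ### Simple lifts, heads and cancellation in the Artin–Tits monoid -/

namespace ReflectionCocycle

variable {G ι : Type*} [Group G] (K : ReflectionCocycle G ι)

theorem alternatingWord_eq_alt {ι : Type*} (i j : ι) (n : ℕ) :
    CoxeterSystem.alternatingWord i j n = if Even n then alt i j n else alt j i n := by
  induction n with
  | zero => simp [CoxeterSystem.alternatingWord, alt]
  | succ n ih =>
    rw [CoxeterSystem.alternatingWord_succ', ih]
    by_cases h : Even n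
    · have : ¬ Even (n + 1) := by simpa [Nat.even_add_one] using h
      simp [h, this, alt]
    · have : Even (n + 1) := by simpa [Nat.even_add_one] using h
      simp [h, this, alt]

/-- Braid relations are equalities of alternating products. -/
theorem lift_eq_of_alt {M : CoxeterMatrix ι} {Q : Type*} [Monoid Q] {f : ι → Q}
    (hf : ∀ i j, ((alt i j (M i j)).map f).prod = ((alt j i (M i j)).map f).prod)
    (a b : FreeMonoid ι) (hab : braidRel M a b) : FreeMonoid.lift f a = FreeMonoid.lift f b := by
  obtain ⟨i, j, rfl, rfl⟩ := hab
  have e : ∀ l : List ι, FreeMonoid.lift f (FreeMonoid.ofList l) = (l.map f).prod := by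
    intro l
    rw [FreeMonoid.lift_apply]
    rfl
  rw [e, e, alternatingWord_eq_alt, alternatingWord_eq_alt]
  split_ifs
  · exact hf i j
  · exact (hf i j).symm

/-- The generator of the Artin–Tits monoid. -/
abbrev gen (M : CoxeterMatrix ι) (i : ι) : ArtinMonoid M := PresentedMonoid.of (braidRel M) i

theorem mk_ofList (M : CoxeterMatrix ι) (l : List ι) :
    PresentedMonoid.mk (braidRel M) (FreeMonoid.ofList l) = (l.map (gen M)).prod := by
  induction l with
  | nil => exact map_one _
  | cons i l ih =>
    rw [FreeMonoid.ofList_cons, map_mul, ih, List.map_cons, List.prod_cons]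
    rfl

theorem artin_induction {M : CoxeterMatrix ι} {p : ArtinMonoid M → Prop} (one : p 1)
    (gen_mul : ∀ i a, p a → p (gen M i * a)) (a : ArtinMonoid M) : p a := by
  obtain ⟨w, rfl⟩ := PresentedMonoid.surjective_mk a
  change p (PresentedMonoid.mk _ (FreeMonoid.ofList w.toList))
  induction w.toList with
  | nil => exact one
  | cons i l ih => exact gen_mul i _ ih

theorem alt_gen (M : CoxeterMatrix ι) (i j : ι) :
    ((alt i j (M i j)).map (gen M)).prod = ((alt j i (M i j)).map (gen M)).prod := by
  have h : braidRel M (FreeMonoid.ofList (CoxeterSystem.alternatingWord i j (M i j)))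
    (FreeMonoid.ofList (CoxeterSystem.alternatingWord j i (M i j))) := ⟨i, j, rfl, rfl⟩
  have := PresentedMonoid.mk_eq_mk_of_rel h
  rw [mk_ofList, mk_ofList, alternatingWord_eq_alt, alternatingWord_eq_alt] at this
  split_ifs at this
  · exact this
  · exact this.symm

variable {M : CoxeterMatrix ι} (hM : ∀ i j, M i j = orderOf (K.s i * K.s j))

variable (M) in
/-- The canonical lift of an element of the group to the Artin–Tits monoid. -/
def L (w : G) : ArtinMonoid M := ((K.exists_reduced w).choose.map (gen M)).prod

include hM in
theorem L_word {l : List ι} (h : K.len (K.word l) = l.length) :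
    K.L M (K.word l) = (l.map (gen M)).prod := by
  obtain ⟨h1, h2⟩ := (K.exists_reduced (K.word l)).choose_spec
  refine K.map_prod_eq_of_reduced (gen M) (fun i j => ?_) ?_ h h1
  · rw [← hM]
    exact alt_gen M i j
  · rw [h1, h2]

include hM in
theorem L_one : K.L M 1 = 1 := by
  have := K.L_word hM (l := []) (by simp [K.len_one])
  simpa using this

include hM in
theorem L_s (i : ι) : K.L M (K.s i) = gen M i := by
  have := K.L_word hM (l := [i]) (by simp [K.len_s])
  simpa using this

include hM in
theorem L_mul {u v : G} (h : K.N u ⊆ K.N (u * v)) : K.L M (u * v) = K.L M u * K.L M v := by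
  obtain ⟨l, rfl, hl⟩ := K.exists_reduced u
  obtain ⟨m, rfl, hm⟩ := K.exists_reduced v
  have := K.len_mul_of_subset h
  rw [← K.word_append] at this ⊢
  rw [K.L_word hM (by rw [this, List.length_append, hl, hm]), K.L_word hM hl.symm,
    K.L_word hM hm.symm, List.map_append, List.prod_append]

/-- Reducedness of y * z means that no inversion of z is an inversion of y⁻¹, and multiplication by
`w₀` complements inversions. Reducedness thus becomes a bound on z, and a largest admissible z below
v exists as a meet. -/
theorem subset_inv_mul_w₀_iff {y z : G} : K.N z ⊆ K.N (y⁻¹ * K.w₀) ↔ K.N y ⊆ K.N (y * z) := by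
  constructor
  · intro h t ht
    rw [K.mem_N_mul]
    intro h1
    have h2 := h1.1 ht
    have h3 := h h2
    rw [K.mem_N_mul_w₀ (K.N_subset_refl _ h2), K.mem_N_inv] at h3
    apply h3
    have : y * (y⁻¹ * t * y) * y⁻¹ = t := by group
    rwa [this]
  · intro h t ht
    rw [K.mem_N_mul_w₀ (K.N_subset_refl _ ht), K.mem_N_inv]
    intro h1
    have h2 := h h1
    rw [K.mem_N_mul] at h2
    have : y⁻¹ * (y * t * y⁻¹) * y = t := by group
    rw [this] at h2
    tauto

/-- The largest `z ≤ v` such that `x * z` is a reduced product. -/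
def pre (x v : G) : G := K.meet v (x⁻¹ * K.w₀)

theorem pre_subset (x v : G) : K.N (K.pre x v) ⊆ K.N v := K.meet_left _ _

theorem pre_red (x v : G) : K.N x ⊆ K.N (x * K.pre x v) :=
  K.subset_inv_mul_w₀_iff.1 (K.meet_right _ _)

theorem subset_pre {x v z : G} (h : K.N z ⊆ K.N v) (h' : K.N x ⊆ K.N (x * z)) :
    K.N z ⊆ K.N (K.pre x v) := K.subset_meet h (K.subset_inv_mul_w₀_iff.2 h')

theorem pre_eq {x v z : G} (h : K.N z ⊆ K.N v) (h' : K.N x ⊆ K.N (x * z))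
    (h'' : ∀ z', K.N z' ⊆ K.N v → K.N x ⊆ K.N (x * z') → K.N z' ⊆ K.N z) : K.pre x v = z :=
  K.N_injective (Set.Subset.antisymm (h'' _ (K.pre_subset x v) (K.pre_red x v))
    (K.subset_pre h h'))

/-- Any admissible z lies below the largest one, which lies above y because x * y is reduced.
Removing y from that largest one leaves an element below v whose product with x * y is reduced. -/
theorem pre_mul {x y : G} (hxy : K.N x ⊆ K.N (x * y)) (v : G) :
    K.pre x (y * K.pre y v) = y * K.pre (x * y) v := by
  have hu := K.pre_red (x * y) v
  have hxu : K.N x ⊆ K.N (x * (y * K.pre (x * y) v)) := by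
    rw [← mul_assoc]; exact hxy.trans hu
  have hyu : K.N y ⊆ K.N (y * K.pre (x * y) v) := by
    refine K.subset_of_N_mul_subset hxy ?_
    rwa [← mul_assoc]
  refine K.pre_eq ?_ hxu ?_
  · exact K.N_mul_subset_of_subset (K.pre_red y v) (K.subset_pre (K.pre_subset _ _) hyu)
  · intro z h1 h2
    have h3 : K.N y ⊆ K.N (K.pre x (y * K.pre y v)) := K.subset_pre (K.pre_red y v) hxy
    set z₁ := K.pre x (y * K.pre y v) with hz₁
    have h4 : K.N z ⊆ K.N z₁ := K.subset_pre h1 h2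
    have h3' : K.N y ⊆ K.N (y * (y⁻¹ * z₁)) := by rwa [mul_inv_cancel_left]
    have h5 : K.N (y⁻¹ * z₁) ⊆ K.N (K.pre y v) := by
      refine K.subset_of_N_mul_subset h3' ?_
      rw [mul_inv_cancel_left]
      exact K.pre_subset _ _
    have h6 : K.N (x * y) ⊆ K.N (x * y * (y⁻¹ * z₁)) := by
      have := K.N_mul_subset_of_subset (K.pre_red x (y * K.pre y v)) h3
      rw [mul_assoc, mul_inv_cancel_left]
      exact this
    have h7 := K.N_mul_subset_of_subset hyu (K.subset_pre (h5.trans (K.pre_subset _ _)) h6)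
    rw [mul_inv_cancel_left] at h7
    exact h4.trans h7

variable (M) in
/-- Left multiplication by the lift of `x` on pairs (head, tail). -/
def headTail (x : G) (p : G × ArtinMonoid M) : G × ArtinMonoid M :=
  (x * K.pre x p.1, K.L M ((K.pre x p.1)⁻¹ * p.1) * p.2)

-- The operators `headTail` compose along reduced products. Hence the two alternating words of a
-- dihedral longest element act in the same way, which gives the action `act` of the whole monoid.
include hM in
theorem headTail_mul {x y : G} (hxy : K.N x ⊆ K.N (x * y)) (p : G × ArtinMonoid M) :
    K.headTail M x (K.headTail M y p) = K.headTail M (x * y) p := by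
  obtain ⟨v, m⟩ := p
  simp only [headTail, K.pre_mul hxy]
  refine Prod.ext (by simp [mul_assoc]) ?_
  change _ = K.L M ((K.pre (x * y) v)⁻¹ * v) * m
  have hyu : K.N y ⊆ K.N (y * K.pre (x * y) v) := by
    refine K.subset_of_N_mul_subset hxy ?_
    rw [← mul_assoc]
    exact K.pre_red (x * y) v
  have h1 : K.N (K.pre (x * y) v) ⊆ K.N (K.pre y v) := K.subset_pre (K.pre_subset _ _) hyu
  have e1 : (y * K.pre (x * y) v)⁻¹ * (y * K.pre y v) = (K.pre (x * y) v)⁻¹ * K.pre y v := by group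
  have e2 : (K.pre (x * y) v)⁻¹ * v =
      ((K.pre (x * y) v)⁻¹ * K.pre y v) * ((K.pre y v)⁻¹ * v) := by group
  have e3 : K.L M ((K.pre (x * y) v)⁻¹ * v) =
      K.L M ((K.pre (x * y) v)⁻¹ * K.pre y v) * K.L M ((K.pre y v)⁻¹ * v) := by
    rw [← K.L_mul hM, ← e2]
    rw [← e2]
    refine K.subset_of_N_mul_subset (x := K.pre (x * y) v) ?_ ?_
    · rwa [mul_inv_cancel_left]
    · rw [mul_inv_cancel_left, mul_inv_cancel_left]
      exact K.pre_subset _ _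
  rw [e1, e3, mul_assoc]

include hM in
theorem headTail_one (p : G × ArtinMonoid M) : K.headTail M 1 p = p := by
  have : K.pre 1 p.1 = p.1 := K.pre_eq subset_rfl (by simp [K.N_one]) (fun z h _ => h)
  simp [headTail, this, K.L_one hM]

variable (M) in
/-- `headTail` as an element of the monoid of self-maps. -/
def headTailEnd (x : G) : Function.End (G × ArtinMonoid M) := K.headTail M x

include hM in
theorem headTail_word {l : List ι} (h : K.len (K.word l) = l.length) (p : G × ArtinMonoid M) :
    (l.map fun i => K.headTailEnd M (K.s i)).prod p =
      K.headTail M (K.word l) p := by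
  induction l with
  | nil => exact (K.headTail_one hM p).symm
  | cons i l ih =>
    rw [List.map_cons, List.prod_cons, word_cons, ← K.headTail_mul hM,
      ← ih (K.len_tail_of_reduced h)]
    · rfl
    · rw [K.N_s_subset_iff, ← K.word_cons]
      exact K.s_mem_N_of_reduced h

/-- The action of the Artin–Tits monoid on pairs (head, tail). -/
def act : ArtinMonoid M →* Function.End (G × ArtinMonoid M) :=
  PresentedMonoid.lift (fun i => K.headTailEnd M (K.s i)) (lift_eq_of_alt (by
    intro i j
    obtain ⟨h1, h2⟩ := K.word_alt_eq_wI i j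
    obtain ⟨h3, h4⟩ := K.word_alt_eq_wI j i
    have h5 : orderOf (K.s j * K.s i) = orderOf (K.s i * K.s j) := by
      rw [← orderOf_inv, mul_inv_rev, s_inv, s_inv]
    rw [Set.pair_comm, h5] at h3
    rw [← hM] at h1 h2 h3
    funext p
    rw [K.headTail_word hM, K.headTail_word hM, h1, h3]
    · rw [h3, alt_length, h2]
    · rw [h1, alt_length, h2]))

theorem act_gen (i : ι) (p : G × ArtinMonoid M) :
    K.act hM (gen M i) p = K.headTail M (K.s i) p := rfl

theorem act_mul (a b : ArtinMonoid M) (p : G × ArtinMonoid M) :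
    K.act hM (a * b) p = K.act hM a (K.act hM b p) := by
  rw [map_mul]; rfl

theorem act_L (w : G) (p : G × ArtinMonoid M) :
    K.act hM (K.L M w) p = K.headTail M w p := by
  obtain ⟨l, rfl, hl⟩ := K.exists_reduced w
  rw [K.L_word hM hl.symm, map_list_prod, List.map_map, ← K.headTail_word hM hl.symm]
  rfl

include hM in
theorem L_mul_headTail (x : G) (p : G × ArtinMonoid M) :
    K.L M (K.headTail M x p).1 * (K.headTail M x p).2 = K.L M x * (K.L M p.1 * p.2) := by
  have h : K.L M p.1 = K.L M (K.pre x p.1) * K.L M ((K.pre x p.1)⁻¹ * p.1) := by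
    rw [← K.L_mul hM, mul_inv_cancel_left]
    rw [mul_inv_cancel_left]
    exact K.pre_subset _ _
  rw [h, headTail, K.L_mul hM (K.pre_red _ _)]
  simp only [mul_assoc]

theorem L_mul_act (a : ArtinMonoid M) (p : G × ArtinMonoid M) :
    K.L M (K.act hM a p).1 * (K.act hM a p).2 = a * (K.L M p.1 * p.2) := by
  induction a using artin_induction with
  | one => rw [map_one, one_mul]; rfl
  | gen_mul i a ih => rw [act_mul, act_gen, K.L_mul_headTail hM, ih, K.L_s hM, mul_assoc]

/-- The new head does not see the tail. This is the source of `head_mul`: the head of a * b depends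
only on a and on the head of b. -/
theorem act_fst (a : ArtinMonoid M) {p q : G × ArtinMonoid M} (h : p.1 = q.1) :
    (K.act hM a p).1 = (K.act hM a q).1 := by
  induction a using artin_induction with
  | one => rw [map_one]; exact h
  | gen_mul i a ih => rw [act_mul, act_mul, act_gen, act_gen, headTail, headTail, ih]

/-- The largest simple left divisor of an element of the Artin–Tits monoid. -/
def head (a : ArtinMonoid M) : G := (K.act hM a (1, 1)).1

theorem L_head_dvd (a : ArtinMonoid M) : ∃ c, a = K.L M (K.head hM a) * c := by
  refine ⟨(K.act hM a (1, 1)).2, ?_⟩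
  rw [head, L_mul_act]
  simp [K.L_one hM]

theorem head_L (w : G) : K.head hM (K.L M w) = w := by
  rw [head, act_L, headTail]
  have : K.pre w 1 = 1 := K.pre_eq subset_rfl (by simp) (fun z h _ => h)
  simp [this]

theorem head_mul (a b : ArtinMonoid M) :
    K.head hM (a * b) = K.head hM (a * K.L M (K.head hM b)) := by
  rw [head, head, act_mul, act_mul]
  refine K.act_fst hM a ?_
  change K.head hM b = K.head hM (K.L M (K.head hM b))
  rw [head_L]

theorem subset_head_L_mul (x : G) (c : ArtinMonoid M) : K.N x ⊆ K.N (K.head hM (K.L M x * c)) := by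
  rw [head, act_mul, act_L, headTail]
  exact K.pre_red _ _

include hM in
theorem dvd_of_subset {x y : G} (h : K.N x ⊆ K.N y) : ∃ c, K.L M y = K.L M x * c := by
  refine ⟨K.L M (x⁻¹ * y), ?_⟩
  rw [← K.L_mul hM, mul_inv_cancel_left]
  rwa [mul_inv_cancel_left]

-- The action of a generator loses no information. Its first component determines the part absorbed
-- into the head, its second component is the rest, and the product of their lifts is the original
-- element.
include K hM in
theorem gen_mul_left_cancel {i : ι} {a b : ArtinMonoid M} (h : gen M i * a = gen M i * b) :
    a = b := by
  have ha := K.L_mul_act hM a (1, 1)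
  have hb := K.L_mul_act hM b (1, 1)
  have h1 : K.act hM (gen M i * a) (1, 1) = K.act hM (gen M i * b) (1, 1) := by rw [h]
  rw [act_mul, act_mul, act_gen, act_gen] at h1
  generalize K.act hM a (1, 1) = p at ha h1
  generalize K.act hM b (1, 1) = q at hb h1
  simp only [headTail, Prod.mk.injEq, mul_left_cancel_iff] at h1
  have hp : ∀ p : G × ArtinMonoid M, K.L M p.1 * p.2 = K.L M (K.pre (K.s i) p.1) *
      (K.L M ((K.pre (K.s i) p.1)⁻¹ * p.1) * p.2) := by
    intro p
    rw [← mul_assoc, ← K.L_mul hM, mul_inv_cancel_left]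
    rw [mul_inv_cancel_left]
    exact K.pre_subset _ _
  rw [hp p, h1.2, h1.1] at ha
  rw [hp q] at hb
  have := ha.symm.trans hb
  simpa [K.L_one hM] using this

include K hM in
theorem artin_mul_left_cancel (c : ArtinMonoid M) {a b : ArtinMonoid M} (h : c * a = c * b) :
    a = b := by
  induction c using artin_induction with
  | one => simpa using h
  | gen_mul i c ih =>
    rw [mul_assoc, mul_assoc] at h
    exact ih (K.gen_mul_left_cancel hM h)

/-! #### The squares of the longest elements -/

theorem mem_refl_conj {t : G} (g : G) : g⁻¹ * t * g ∈ K.refl ↔ t ∈ K.refl := by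
  constructor
  · intro h
    have := K.conj_mem_refl h g
    have e : g * (g⁻¹ * t * g) * g⁻¹ = t := by group
    rwa [e] at this
  · intro h
    simpa using K.conj_mem_refl h g⁻¹

/-- Conjugation by `wI I` preserves the set of reflections of the parabolic subgroup, so in the
inversion set of wI * s i * wI everything cancels except one reflection. Such an element has length
one. -/
theorem exists_wI_conj {I : Set ι} {i : ι} (hi : i ∈ I) :
    ∃ j ∈ I, K.s i * K.wI I = K.wI I * K.s j := by
  have hw := K.wI_mem I
  have hinv : (K.wI I)⁻¹ = K.wI I := inv_eq_of_mul_eq_one_left (K.wI_mul_self I)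
  have h1 : K.len (K.wI I * (K.s i * K.wI I)) = 1 := by
    have : K.N (K.wI I * (K.s i * K.wI I)) = {K.wI I * K.s i * (K.wI I)⁻¹} := by
      ext t
      have e1 := K.mem_refl_conj (t := t) (K.wI I)
      have e2 : (K.wI I)⁻¹ * t * K.wI I ∈ K.par I ↔ t ∈ K.par I := by
        rw [Subgroup.mul_mem_cancel_right _ hw, Subgroup.mul_mem_cancel_left _ (inv_mem hw)]
      rw [K.mem_N_mul, K.mem_N_s_mul, N_wI]
      have e3 := K.mem_refl_conj (t := (K.wI I)⁻¹ * t * K.wI I) (K.s i)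
      have e4 : K.s i * ((K.wI I)⁻¹ * t * K.wI I) * K.s i ∈ K.par I ↔
          (K.wI I)⁻¹ * t * K.wI I ∈ K.par I := by
        rw [Subgroup.mul_mem_cancel_right _ (K.s_mem_par hi),
          Subgroup.mul_mem_cancel_left _ (K.s_mem_par hi)]
      rw [s_inv] at e3
      have e5 : (K.wI I)⁻¹ * t * K.wI I = K.s i ↔ t = K.wI I * K.s i * (K.wI I)⁻¹ := by
        constructor
        · intro h; rw [← h]; group
        · intro h; rw [h]; group
      simp only [Set.mem_inter_iff, SetLike.mem_coe, Set.mem_singleton_iff, e1, e2, e3, e4, e5]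
      constructor
      · intro h
        by_contra h'
        exact h (by tauto)
      · rintro rfl h
        have h7 : K.wI I * K.s i * (K.wI I)⁻¹ ∈ K.refl := K.conj_mem_refl (K.s_mem_refl i) _
        have h8 : K.wI I * K.s i * (K.wI I)⁻¹ ∈ K.par I :=
          mul_mem (mul_mem hw (K.s_mem_par hi)) (inv_mem hw)
        tauto
    rw [len, this, Set.ncard_singleton]
  obtain ⟨j, hj⟩ := K.eq_simple_of_len_eq_one h1
  refine ⟨j, ?_, ?_⟩
  · rw [← K.s_mem_par_iff, ← hj]
    exact mul_mem hw (mul_mem (K.s_mem_par hi) hw)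
  · rw [← hj, ← mul_assoc, K.wI_mul_self, one_mul]

include hM in
theorem gen_mul_L_wI {I : Set ι} {i j : ι} (hi : i ∈ I)
    (h : K.s i * K.wI I = K.wI I * K.s j) : gen M i * K.L M (K.wI I) = K.L M (K.wI I) * gen M j := by
  have h1 : K.s i ∈ K.N (K.wI I) := by rw [N_wI]; exact ⟨K.s_mem_refl i, K.s_mem_par hi⟩
  have h2 : K.L M (K.wI I) = gen M i * K.L M (K.s i * K.wI I) := by
    rw [← K.L_s hM, ← K.L_mul hM, s_mul_s_mul]
    rwa [s_mul_s_mul, N_s_subset_iff]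
  have h3 : K.L M (K.wI I) = K.L M (K.wI I * K.s j) * gen M j := by
    have e : K.wI I * K.s j * K.s j = K.wI I := by rw [mul_assoc, K.s_mul_self, mul_one]
    rw [← K.L_s hM, ← K.L_mul hM, e]
    rw [e, ← h]
    have h4 : K.N (K.wI I * K.s j) ⊆ K.N (K.wI I * K.s j * K.s j) := by
      apply K.subset_of_len_mul
      have := K.len_s_mul_of_mem h1
      rw [K.len_s, e, ← h]
      omega
    rwa [e, ← h] at h4
  conv_lhs => rw [h3, ← mul_assoc, ← h, ← h2]

include hM in
theorem gen_mul_L_wI_sq {I : Set ι} {i : ι} (hi : i ∈ I) :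
    gen M i * (K.L M (K.wI I)) ^ 2 = (K.L M (K.wI I)) ^ 2 * gen M i := by
  obtain ⟨j, hj, h⟩ := K.exists_wI_conj hi
  obtain ⟨k, hk, h'⟩ := K.exists_wI_conj hj
  have hki : k = i := by
    apply K.s_injective
    have h2 : K.s i = K.wI I * K.wI I * K.s k := by
      rw [mul_assoc, ← h', ← mul_assoc, ← h, mul_assoc, K.wI_mul_self, mul_one]
    rw [h2, K.wI_mul_self, one_mul]
  subst hki
  rw [sq, ← mul_assoc, K.gen_mul_L_wI hM hi h, mul_assoc, K.gen_mul_L_wI hM hj h', mul_assoc]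

include hM in
theorem commute_pi (a : ArtinMonoid M) : Commute a ((K.L M K.w₀) ^ 2) := by
  induction a using artin_induction with
  | one => exact Commute.one_left _
  | gen_mul i a ih =>
    refine Commute.mul_left ?_ ih
    have := K.gen_mul_L_wI_sq hM (Set.mem_univ i)
    rwa [wI_univ] at this

/-! #### The embedding of the monoid in the group -/

/-- The powers of a central element form an Ore set. -/
abbrev oreSetOfCentral {R : Type*} [Monoid R] {z : R} (hz : ∀ a, Commute a z) :
    OreLocalization.OreSet (Submonoid.powers z) where
  ore_right_cancel r₁ r₂ s h := by
    obtain ⟨_, n, rfl⟩ := s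
    refine ⟨⟨z ^ n, n, rfl⟩, ?_⟩
    have h1 := ((hz r₁).pow_right n).eq
    have h2 := ((hz r₂).pow_right n).eq
    simp only at h ⊢
    rw [← h1, ← h2, h]
  oreNum r _ := r
  oreDenom _ s := s
  ore_eq r s := by
    obtain ⟨_, n, rfl⟩ := s
    exact ((hz r).pow_right n).eq.symm

-- Every generator divides the central element π, so inverting π in the cancellative monoid makes
-- all generators units. The localization map is injective, and it factors through the group.
include K hM in
theorem toGroup_injective : Function.Injective (ArtinMonoid.toGroup M) := by
  set z := (K.L M K.w₀) ^ 2 with hz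
  let _ := oreSetOfCentral (K.commute_pi hM)
  let ν : ArtinMonoid M →* OreLocalization (Submonoid.powers z) (ArtinMonoid M) :=
    OreLocalization.numeratorHom
  have hν : Function.Injective ν := by
    intro a b h
    obtain ⟨u, v, h1, h2⟩ := OreLocalization.oreDiv_eq_iff.1 h
    simp only [OneMemClass.coe_one, mul_one] at h2
    rw [Submonoid.smul_def, h2, smul_eq_mul, smul_eq_mul] at h1
    exact (K.artin_mul_left_cancel hM _ h1).symm
  have hunit : ∀ i, IsUnit (ν (gen M i)) := by
    intro i
    have hzu : IsUnit (ν z) := OreLocalization.numerator_isUnit ⟨z, Submonoid.mem_powers z⟩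
    have hs : K.N (K.s i) ⊆ K.N K.w₀ := by
      rw [N_s_subset_iff, N_w₀]; exact K.s_mem_refl i
    obtain ⟨c, hc⟩ := K.dvd_of_subset hM hs
    rw [K.L_s hM] at hc
    have hcz : z = gen M i * (c * K.L M K.w₀) := by rw [hz, sq, ← mul_assoc, ← hc]
    set c' := c * K.L M K.w₀
    -- A right cofactor of the central element is also a left cofactor, by left cancellation.
    have hcz' : z = c' * gen M i := by
      apply K.gen_mul_left_cancel hM (i := i)
      rw [← mul_assoc, ← hcz]
      exact (K.commute_pi hM (gen M i)).eq
    obtain ⟨y, hy⟩ := hzu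
    have h1 : ν (gen M i) * (ν c' * ↑y⁻¹) = 1 := by
      rw [← mul_assoc, ← map_mul, ← hcz, ← hy, Units.mul_inv]
    have h2 : (↑y⁻¹ * ν c') * ν (gen M i) = 1 := by
      rw [mul_assoc, ← map_mul, ← hcz', ← hy, Units.inv_mul]
    have h3 : ν c' * ↑y⁻¹ = ↑y⁻¹ * ν c' := (left_inv_eq_right_inv h2 h1).symm
    exact ⟨⟨_, _, h1, by rw [h3, h2]⟩, rfl⟩
  choose f hf using hunit
  have hrel : ∀ a b, braidRel M a b → FreeMonoid.lift f a = FreeMonoid.lift f b := by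
    have key : ∀ l : List ι, (((l.map f).prod : (OreLocalization (Submonoid.powers z)
        (ArtinMonoid M))ˣ) : OreLocalization (Submonoid.powers z) (ArtinMonoid M)) =
        ν ((l.map (gen M)).prod) := by
      intro l
      induction l with
      | nil => simp
      | cons i l ih => rw [List.map_cons, List.prod_cons, Units.val_mul, ih, hf, List.map_cons,
          List.prod_cons, map_mul]
    refine lift_eq_of_alt fun i j => ?_
    apply Units.ext
    rw [key, key, alt_gen]
  have hcomp : ∀ a, ((ArtinGroup.lift f hrel (ArtinMonoid.toGroup M a) :
      (OreLocalization (Submonoid.powers z) (ArtinMonoid M))ˣ) :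
      OreLocalization (Submonoid.powers z) (ArtinMonoid M)) = ν a := by
    intro a
    induction a using artin_induction with
    | one => simp
    | gen_mul i a ih =>
      rw [map_mul, map_mul, Units.val_mul, ih, map_mul]
      congr 1
      rw [← hf]
      congr 1
      exact ArtinGroup.lift_of f hrel i
  intro a b hab
  apply hν
  rw [← hcomp, ← hcomp, hab]

end ReflectionCocycle

/-! ### Hyperplane arrangements in a real vector space -/

section Arrangement

variable {X : Type*} [AddCommGroup X] [Module ℝ X]

/-- Finitely many strict sign conditions are open. This is used to push a point off hyperplanes
without changing the signs that are already determined. -/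
theorem exists_pos_perturbation {κ : Type*} [Finite κ] (a b : κ → ℝ) :
    ∃ ε : ℝ, 0 < ε ∧ ∀ i, (0 < a i → 0 < a i + ε * b i) ∧ (a i < 0 → a i + ε * b i < 0) := by
  have key : ∀ i, ∀ᶠ ε in nhdsWithin (0 : ℝ) (Set.Ioi 0),
      (0 < a i → 0 < a i + ε * b i) ∧ (a i < 0 → a i + ε * b i < 0) := by
    intro i
    have hc : Filter.Tendsto (fun ε : ℝ => a i + ε * b i) (nhdsWithin (0 : ℝ) (Set.Ioi 0))
        (nhds (a i)) := by
      have : Continuous fun ε : ℝ => a i + ε * b i := by fun_prop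
      have h := this.tendsto 0
      simp only [zero_mul, add_zero] at h
      exact h.mono_left nhdsWithin_le_nhds
    refine Filter.Eventually.and ?_ ?_
    · by_cases h : 0 < a i
      · filter_upwards [hc.eventually (lt_mem_nhds h)] with ε hε _ using hε
      · exact Filter.Eventually.of_forall fun _ h' => absurd h' h
    · by_cases h : a i < 0
      · filter_upwards [hc.eventually (gt_mem_nhds h)] with ε hε _ using hε
      · exact Filter.Eventually.of_forall fun _ h' => absurd h' h
  obtain ⟨ε, h1, h2⟩ := ((Filter.eventually_all.2 key).and self_mem_nhdsWithin).exists
  exact ⟨ε, h2, h1⟩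

/-- Hyperplane `i` is a wall of the region where all `F j` are positive. -/
def IsWall {κ : Type*} (F : κ → Module.Dual ℝ X) (i : κ) : Prop :=
  ∃ z, F i z = 0 ∧ ∀ j, j ≠ i → 0 < F j z

/-- A point outside the closed region is on the negative side of some wall. -/
theorem exists_isWall_neg {κ : Type*} [Finite κ] (F : κ → Module.Dual ℝ X)
    (hF : ∀ i j, i ≠ j → ∀ c : ℝ, F i ≠ c • F j) {x : X} (hx : ∀ i, 0 < F i x) {y : X}
    {i₀ : κ} (hy : F i₀ y < 0) : ∃ i, F i y < 0 ∧ IsWall F i := by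
  classical
  have := Fintype.ofFinite κ
  let P := {p : κ × κ // p.1 ≠ p.2 ∧ F p.1 y < 0}
  -- At a point x, this form vanishes exactly when hyperplane p.2 passes through the point where the
  -- line from x to y meets hyperplane p.1. A generic base point avoids these coincidences.
  let Df : P → Module.Dual ℝ X := fun p => F p.1.1 y • F p.1.2 - F p.1.2 y • F p.1.1
  have hD : ∀ p, ∃ u, Df p u ≠ 0 := by
    intro p
    by_contra hcon
    push Not at hcon
    have hp := p.2.2
    refine hF p.1.2 p.1.1 p.2.1.symm (F p.1.2 y / F p.1.1 y) ?_
    ext u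
    have := hcon u
    simp only [Df, LinearMap.sub_apply, LinearMap.smul_apply, smul_eq_mul] at this ⊢
    field_simp [hp.ne]
    linarith
  obtain ⟨u, hu⟩ := Module.Dual.exists_forall_ne_zero_of_forall_exists Df hD
  obtain ⟨ε, hε, hpert⟩ := exists_pos_perturbation
    (Sum.elim (fun i => F i x) (fun p => Df p x)) (Sum.elim (fun i => F i u) (fun p => Df p u))
  set x₁ := x + ε • u with hx₁
  have h1 : ∀ i, 0 < F i x₁ := by
    intro i
    have := (hpert (Sum.inl i)).1 (hx i)
    simpa [hx₁] using this
  have h2 : ∀ p, Df p x₁ ≠ 0 := by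
    intro p
    have e : Df p x₁ = Df p x + ε * Df p u := by simp [hx₁]
    rw [e]
    rcases lt_trichotomy (Df p x) 0 with h | h | h
    · exact ((hpert (Sum.inr p)).2 h).ne
    · rw [h, zero_add]
      exact mul_ne_zero hε.ne' (hu p)
    · exact ((hpert (Sum.inr p)).1 h).ne'
  -- The smallest ratio selects the first hyperplane crossed on the way from x₁ to y. The witness
  -- below is a positive multiple of the crossing point.
  obtain ⟨i, hi, hmin⟩ := Finset.exists_min_image (Finset.univ.filter fun i => F i y < 0)
    (fun i => F i x₁ / (-F i y)) ⟨i₀, by simp [hy]⟩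
  simp only [Finset.mem_filter, Finset.mem_univ, true_and] at hi hmin
  refine ⟨i, hi, (-F i y) • x₁ + F i x₁ • y, ?_, ?_⟩
  · simp; ring
  · intro j hj
    simp only [map_add, map_smul, smul_eq_mul]
    by_cases hjy : F j y < 0
    · have h3 := hmin j hjy
      rw [div_le_div_iff₀ (by linarith) (by linarith)] at h3
      have h4 := h2 ⟨(i, j), hj.symm, hi⟩
      simp only [Df, LinearMap.sub_apply, LinearMap.smul_apply, smul_eq_mul] at h4
      rcases h3.lt_or_eq with h5 | h5
      · linarith
      · exact absurd (by linarith) h4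
    · push Not at hjy
      have h5 := mul_pos (neg_pos.2 hi) (h1 j)
      have h6 := mul_nonneg (h1 i).le hjy
      linarith

/-- If pairwise obtuse vectors are on one side of a hyperplane, then there is a vector orthogonal to
all of them but one. -/
theorem exists_dual_of_obtuse {κ : Type*} [Finite κ] (B : LinearMap.BilinForm ℝ X)
    (hpos : ∀ x, x ≠ 0 → 0 < B x x) (α : κ → X)
    (hα : ∀ i j, i ≠ j → B (α i) (α j) ≤ 0) {x : X} (hx : ∀ i, 0 < B (α i) x) (i : κ) :
    ∃ y, 0 < B (α i) y ∧ ∀ j, j ≠ i → B (α j) y = 0 := by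
  classical
  by_contra hcon
  push Not at hcon
  -- If no such y exists, B (α i) vanishes wherever all the other forms do, hence is a combination
  -- of them.
  have hspan : B (α i) ∈ Submodule.span ℝ (Set.range fun j : {j // j ≠ i} => B (α j)) := by
    apply mem_span_of_iInf_ker_le_ker
    intro y hy
    simp only [Submodule.mem_iInf, LinearMap.mem_ker] at hy ⊢
    rcases lt_trichotomy (B (α i) y) 0 with h | h | h
    · obtain ⟨j, hj, hj'⟩ := hcon (-y) (by simpa using h)
      exact absurd (by simpa using hy ⟨j, hj⟩) hj'
    · exact h
    · obtain ⟨j, hj, hj'⟩ := hcon y h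
      exact absurd (hy ⟨j, hj⟩) hj'
  have := Fintype.ofFinite κ
  obtain ⟨c, hc⟩ := (Submodule.mem_span_range_iff_exists_fun ℝ).1 hspan
  -- Positive and negative coefficients are separated, so v and v' are nonnegative combinations with
  -- no common α j. Obtuseness gives B v v' ≤ 0, so v = v' = 0; yet v' is strictly positive on x.
  set v := ∑ j : {j // j ≠ i}, max (c j) 0 • α j with hv
  set v' := α i + ∑ j : {j // j ≠ i}, max (-c j) 0 • α j with hv'
  have hvv : v = v' := by
    have h0 : v - v' = -(α i - ∑ j : {j // j ≠ i}, c j • α j) := by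
      have : ∀ j : {j // j ≠ i}, c j • α j = max (c j) 0 • α j - max (-c j) 0 • α j := by
        intro j
        rw [← sub_smul]
        congr 1
        rcases le_total 0 (c j) with h | h
        · rw [max_eq_left h, max_eq_right (by linarith)]; ring
        · rw [max_eq_right h, max_eq_left (by linarith)]; ring
      rw [Finset.sum_congr rfl fun j _ => this j, Finset.sum_sub_distrib, hv, hv']
      abel
    have h1 : B (α i - ∑ j : {j // j ≠ i}, c j • α j) = 0 := by
      rw [map_sub, map_sum, ← hc]
      simp
    rw [← sub_eq_zero, h0, neg_eq_zero]
    by_contra hne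
    have := hpos _ hne
    rw [h1] at this
    simp at this
  have hle : B v v ≤ 0 := by
    have h3 : B v v = ∑ j : {j // j ≠ i}, max (c j) 0 * B (α j) v' := by
      conv_lhs => rw [show B v v = B v v' by rw [← hvv]]
      simp only [hv, map_sum, map_smul, LinearMap.sum_apply, LinearMap.smul_apply, smul_eq_mul]
    rw [h3]
    refine Finset.sum_nonpos fun k _ => ?_
    simp only [hv', map_add, map_sum, map_smul, smul_eq_mul, mul_add, Finset.mul_sum]
    refine add_nonpos (mul_nonpos_of_nonneg_of_nonpos (le_max_right _ _) (hα k i k.2))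
      (Finset.sum_nonpos fun j _ => ?_)
    rw [← mul_assoc]
    by_cases hkj : k = j
    · subst hkj
      rcases le_total 0 (c k) with h | h
      · rw [max_eq_right (a := -c k) (by linarith)]; simp
      · rw [max_eq_right h]; simp
    · exact mul_nonpos_of_nonneg_of_nonpos (mul_nonneg (le_max_right _ _) (le_max_right _ _))
        (hα k j fun h => hkj (Subtype.ext h))
  have hv0 : v = 0 := by
    by_contra hne
    exact absurd (hpos v hne) (not_lt.2 hle)
  have h5 : B v' x = 0 := by rw [← hvv, hv0]; simp
  have h6 : 0 < B v' x := by
    rw [hv']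
    simp only [map_sum, map_smul, LinearMap.sum_apply, LinearMap.smul_apply, map_add,
      LinearMap.add_apply, smul_eq_mul]
    have := Finset.sum_nonneg fun (j : {j // j ≠ i}) (_ : j ∈ Finset.univ) =>
      mul_nonneg (le_max_right (-c j) 0) (hx j).le
    linarith [hx i]
  exact h6.ne' h5

/-- A finite group of automorphisms of a finite-dimensional real vector space preserves a scalar
product. -/
theorem exists_invariant_form [FiniteDimensional ℝ X] (W : Subgroup (X ≃ₗ[ℝ] X)) [Finite W] :
    ∃ B : LinearMap.BilinForm ℝ X, (∀ x, x ≠ 0 → 0 < B x x) ∧ (∀ x y, B x y = B y x) ∧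
      ∀ w ∈ W, ∀ x y, B (w x) (w y) = B x y := by
  classical
  have := Fintype.ofFinite W
  let b := Module.finBasis ℝ X
  let f : W → Fin (Module.finrank ℝ X) → Module.Dual ℝ X := fun w i =>
    b.coord i ∘ₗ ((w : X ≃ₗ[ℝ] X) : X →ₗ[ℝ] X)
  let B : LinearMap.BilinForm ℝ X := ∑ w : W, ∑ i, LinearMap.BilinForm.linMulLin (f w i) (f w i)
  have hB : ∀ x y, B x y = ∑ w : W, ∑ i, b.coord i ((w : X ≃ₗ[ℝ] X) x) *
      b.coord i ((w : X ≃ₗ[ℝ] X) y) := by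
    intro x y
    simp [B, f, LinearMap.sum_apply]
  refine ⟨B, ?_, ?_, ?_⟩
  · intro x hx
    rw [hB]
    refine Finset.sum_pos (fun w _ => ?_) ⟨1, Finset.mem_univ _⟩
    have hwx : (w : X ≃ₗ[ℝ] X) x ≠ 0 := by simpa using hx
    obtain ⟨i, hi⟩ : ∃ i, b.coord i ((w : X ≃ₗ[ℝ] X) x) ≠ 0 := by
      by_contra hcon
      push Not at hcon
      exact hwx (b.ext_elem fun i => by simpa using hcon i)
    exact Finset.sum_pos' (fun i _ => mul_self_nonneg _)
      ⟨i, Finset.mem_univ _, lt_of_le_of_ne (mul_self_nonneg _) (mul_self_ne_zero.2 hi).symm⟩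
  · intro x y
    rw [hB, hB]
    exact Finset.sum_congr rfl fun w _ => Finset.sum_congr rfl fun i _ => mul_comm _ _
  · intro w hw x y
    rw [hB, hB]
    exact Fintype.sum_equiv (Equiv.mulRight (⟨w, hw⟩ : W)) _ _ fun v => rfl

end Arrangement

/-! ### Chambers, walls and roots of a reflection arrangement -/

/-- A finite set of reflections stable under conjugation by its elements, preserving a scalar
product, with a base point outside all the reflecting hyperplanes. -/
structure ReflectionArrangement (X : Type*) [AddCommGroup X] [Module ℝ X] where
  R : Set (X ≃ₗ[ℝ] X)
  finite : R.Finite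
  isReflection : ∀ t ∈ R, IsRealReflection t
  conj : ∀ s ∈ R, ∀ t ∈ R, s * t * s⁻¹ ∈ R
  B : LinearMap.BilinForm ℝ X
  pos : ∀ x, x ≠ 0 → 0 < B x x
  symm : ∀ x y, B x y = B y x
  invariant : ∀ t ∈ R, ∀ x y, B (t x) (t y) = B x y
  x₀ : X
  regular : ∀ t ∈ R, t x₀ ≠ x₀

namespace ReflectionArrangement

variable {X : Type*} [AddCommGroup X] [Module ℝ X] (A : ReflectionArrangement X)

/-- Invariance of the form forces the functional of the reflection to be proportional to B α.
Scaling fixes the length, and the base point fixes the sign. -/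
theorem exists_root {t : X ≃ₗ[ℝ] X} (ht : t ∈ A.R) : ∃ α, A.B α α = 2 ∧
    (∀ y, t y = y - A.B α y • α) ∧ 0 < A.B α A.x₀ := by
  obtain ⟨α, f, h, hα⟩ := A.isReflection t ht
  have hα0 : α ≠ 0 := by rintro rfl; simp at h
  have hαα := A.pos α hα0
  have htα : ∀ y, t y = y - f y • α := fun y => by rw [hα, Module.reflection_apply]
  have hf : ∀ y, f y * A.B α α = 2 * A.B α y := by
    intro y
    have h1 := A.invariant t ht α y
    rw [htα α, htα y, h] at h1
    simp only [map_sub, map_smul, LinearMap.sub_apply, LinearMap.smul_apply, smul_eq_mul] at h1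
    linarith
  set r := Real.sqrt (2 / A.B α α) with hr
  have hr2 : r * r = 2 / A.B α α := Real.mul_self_sqrt (by positivity)
  have hrefl : ∀ c : ℝ, c * c = 2 / A.B α α → A.B (c • α) (c • α) = 2 ∧
      ∀ y, t y = y - A.B (c • α) y • c • α := by
    intro c hc
    constructor
    · simp only [map_smul, LinearMap.smul_apply, smul_eq_mul]
      rw [← mul_assoc, hc]
      field_simp
    · intro y
      rw [htα, map_smul, LinearMap.smul_apply, smul_smul, smul_eq_mul]
      congr 2
      have : c * A.B α y * c = c * c * A.B α y := by ring
      rw [this, hc, div_mul_eq_mul_div, eq_div_iff hαα.ne']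
      exact hf y
  have hne : A.B (r • α) A.x₀ ≠ 0 := by
    intro h0
    apply A.regular t ht
    rw [(hrefl r hr2).2, h0]
    simp
  rcases hne.lt_or_gt with h1 | h1
  · refine ⟨(-r) • α, (hrefl (-r) (by rw [neg_mul_neg, hr2])).1,
      (hrefl (-r) (by rw [neg_mul_neg, hr2])).2, ?_⟩
    simpa using h1
  · exact ⟨r • α, (hrefl r hr2).1, (hrefl r hr2).2, h1⟩

open Classical in
/-- The root, of square length `2`, of a reflection, positive on the base point. -/
def root (t : X ≃ₗ[ℝ] X) : X := if ht : t ∈ A.R then (A.exists_root ht).choose else 0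

/-- The linear form defining the hyperplane of a reflection, positive on the base point. -/
def F (t : X ≃ₗ[ℝ] X) : Module.Dual ℝ X := A.B (A.root t)

variable {A} {s t : X ≃ₗ[ℝ] X}

theorem F_root (ht : t ∈ A.R) : A.F t (A.root t) = 2 := by
  rw [F, root, dif_pos ht]
  exact (A.exists_root ht).choose_spec.1

theorem reflection_apply (ht : t ∈ A.R) (y : X) : t y = y - A.F t y • A.root t := by
  rw [F, root, dif_pos ht]
  exact (A.exists_root ht).choose_spec.2.1 y

theorem F_pos (ht : t ∈ A.R) : 0 < A.F t A.x₀ := by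
  rw [F, root, dif_pos ht]
  exact (A.exists_root ht).choose_spec.2.2

theorem root_ne_zero (ht : t ∈ A.R) : A.root t ≠ 0 := by
  intro h
  have := F_root ht
  rw [h, map_zero] at this
  norm_num at this

theorem apply_eq_iff (ht : t ∈ A.R) (y : X) : t y = y ↔ A.F t y = 0 := by
  rw [reflection_apply ht, sub_eq_self, smul_eq_zero, or_iff_left (root_ne_zero ht)]

theorem F_self_apply (ht : t ∈ A.R) (y : X) : A.F t (t y) = -A.F t y := by
  rw [reflection_apply ht, map_sub, map_smul, F_root ht, smul_eq_mul]
  ring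

theorem mul_self (ht : t ∈ A.R) : t * t = 1 := (A.isReflection t ht).mul_self

theorem inv_eq (ht : t ∈ A.R) : t⁻¹ = t := inv_eq_of_mul_eq_one_left (mul_self ht)

theorem F_ne_smul (hs : s ∈ A.R) (ht : t ∈ A.R) (hst : s ≠ t) (c : ℝ) : A.F s ≠ c • A.F t := by
  intro h
  apply hst
  have h1 : A.root s = c • A.root t := by
    rw [← sub_eq_zero]
    by_contra hne
    have h2 := A.pos _ hne
    have h3 : A.B (A.root s - c • A.root t) = 0 := by
      rw [map_sub, map_smul]
      exact sub_eq_zero.2 h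
    rw [h3] at h2
    simp at h2
  have hc : c * c = 1 := by
    have h2 := F_root hs
    rw [h, h1, LinearMap.smul_apply, map_smul, F_root ht, smul_eq_mul, smul_eq_mul] at h2
    linarith
  ext y
  rw [reflection_apply hs, reflection_apply ht, h, h1, LinearMap.smul_apply, smul_smul, smul_eq_mul,
    show c * A.F t y * c = c * c * A.F t y by ring, hc, one_mul]

/-- Only the conjugation relation between the two reflections is used, so g need not preserve the
scalar product. The sign of c records whether g exchanges the positive sides. -/
theorem exists_F_comp (ht : t ∈ A.R) {g : X ≃ₗ[ℝ] X} (hg : g⁻¹ * t * g ∈ A.R) :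
    ∃ c : ℝ, c ≠ 0 ∧ ∀ y, A.F t (g y) = c * A.F (g⁻¹ * t * g) y := by
  set t' := g⁻¹ * t * g with ht'
  have key : ∀ y, 2 * A.F t (g y) = A.F t (g (A.root t')) * A.F t' y := by
    intro y
    have h1 : g (t' y) = t (g y) := by
      have : g * t' = t * g := by rw [ht']; group
      exact DFunLike.congr_fun this y
    rw [reflection_apply hg, reflection_apply ht, map_sub, map_smul, sub_right_inj] at h1
    have h2 := congrArg (A.F t) h1
    rw [map_smul, map_smul, F_root ht, smul_eq_mul, smul_eq_mul] at h2
    linarith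
  refine ⟨A.F t (g (A.root t')) / 2, ?_, fun y => by linarith [key y]⟩
  intro h0
  have h1 := key (g⁻¹ (A.root t))
  have h2 : g (g⁻¹ (A.root t)) = A.root t := g.apply_symm_apply _
  rw [h2, F_root ht] at h1
  have : A.F t (g (A.root t')) = 0 := by linarith
  rw [this] at h1
  norm_num at h1

/-- Signs of roots at `g y` are, up to a global sign, signs of roots at `y`. -/
theorem F_neg_iff (ht : t ∈ A.R) {g : X ≃ₗ[ℝ] X} (hg : g⁻¹ * t * g ∈ A.R) {y y' : X}
    (h : 0 < A.F (g⁻¹ * t * g) y) (h' : 0 < A.F (g⁻¹ * t * g) y') :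
    A.F t (g y) < 0 ↔ A.F t (g y') < 0 := by
  obtain ⟨c, hc, hF⟩ := exists_F_comp ht hg
  rw [hF, hF]
  rcases hc.lt_or_gt with hc | hc
  · exact iff_of_true (mul_neg_of_neg_of_pos hc h) (mul_neg_of_neg_of_pos hc h')
  · exact iff_of_false (mul_pos hc h).not_gt (mul_pos hc h').not_gt

variable (A) in
/-- The reflections in the walls of the chamber of the base point. -/
def walls : Set (X ≃ₗ[ℝ] X) :=
  {s | s ∈ A.R ∧ ∃ z, A.F s z = 0 ∧ ∀ t ∈ A.R, t ≠ s → 0 < A.F t z}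

theorem exists_wall_neg {y : X} (ht : t ∈ A.R) (hy : A.F t y < 0) : ∃ s ∈ A.walls, A.F s y < 0 := by
  have := A.finite.to_subtype
  obtain ⟨i, hi, z, hz, hz'⟩ := exists_isWall_neg (fun t : A.R => A.F t)
    (fun i j hij c => F_ne_smul i.2 j.2 (fun h => hij (Subtype.ext h)) c)
    (x := A.x₀) (fun i => F_pos i.2) (y := y) (i₀ := ⟨t, ht⟩) hy
  exact ⟨i, ⟨i.2, z, hz, fun t ht h => hz' ⟨t, ht⟩ fun h' => h (congrArg Subtype.val h')⟩, hi⟩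

theorem conj' (hs : s ∈ A.R) (ht : t ∈ A.R) : s⁻¹ * t * s ∈ A.R := by
  have := A.conj s hs t ht
  rwa [inv_eq hs] at this ⊢

theorem _root_.conj_ne_of_ne {G : Type*} [Group G] {s t : G} (h : t ≠ s) : s⁻¹ * t * s ≠ s := by
  intro h'
  apply h
  have : s * (s⁻¹ * t * s) * s⁻¹ = t := by group
  rw [h'] at this
  rw [← this]
  group

/-- A point of the wall of s off all other hyperplanes is fixed by s and positive for both t and its
conjugate, so the constant is positive: a wall reflection changes the sign of only one root. -/
theorem exists_F_comp_wall (hs : s ∈ A.walls) (ht : t ∈ A.R) (hts : t ≠ s) :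
    ∃ c : ℝ, 0 < c ∧ ∀ y, A.F t (s y) = c * A.F (s⁻¹ * t * s) y := by
  obtain ⟨hsR, z, hz, hpos⟩ := hs
  obtain ⟨c, -, hc⟩ := exists_F_comp ht (conj' hsR ht)
  refine ⟨c, ?_, hc⟩
  have h1 := hpos t ht hts
  have h2 := hpos _ (conj' hsR ht) (conj_ne_of_ne hts)
  have h3 := hc z
  rw [(apply_eq_iff hsR z).2 hz] at h3
  rw [h3] at h1
  exact pos_of_mul_pos_left h1 h2.le

theorem F_wall_apply_pos (hs : s ∈ A.walls) (ht : t ∈ A.R) (hts : t ≠ s) :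
    0 < A.F t (s A.x₀) := by
  obtain ⟨c, hc, h⟩ := exists_F_comp_wall hs ht hts
  rw [h]
  exact mul_pos hc (F_pos (conj' hs.1 ht))

/-- The group generated by the reflections in the walls acts transitively on the chambers. -/
theorem exists_mem_closure_walls (y : X) (hy : ∀ t ∈ A.R, A.F t y ≠ 0) :
    ∃ g ∈ Subgroup.closure A.walls, ∀ t ∈ A.R, 0 < A.F t (g y) := by
  induction hn : {t | t ∈ A.R ∧ A.F t y < 0}.ncard using Nat.strong_induction_on
    generalizing y with
  | _ n ih =>
    by_cases h : ∃ t ∈ A.R, A.F t y < 0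
    · obtain ⟨t, ht, hty⟩ := h
      obtain ⟨s, hs, hsy⟩ := exists_wall_neg ht hty
      have hreg : ∀ t ∈ A.R, A.F t (s y) ≠ 0 := by
        intro t ht
        obtain ⟨c, hc, hF⟩ := exists_F_comp ht (conj' hs.1 ht)
        rw [hF]
        exact mul_ne_zero hc (hy _ (conj' hs.1 ht))
      have hfin : {t | t ∈ A.R ∧ A.F t y < 0}.Finite := A.finite.subset fun t ht => ht.1
      -- Reflecting in a negative wall makes that wall positive and only conjugates the other
      -- negative forms, so their number drops.
      have hsub : {t | t ∈ A.R ∧ A.F t (s y) < 0} ⊆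
          (fun t => s * t * s⁻¹) '' ({t | t ∈ A.R ∧ A.F t y < 0} \ {s}) := by
        rintro t ⟨ht, hty⟩
        have hts : t ≠ s := by
          rintro rfl
          rw [F_self_apply hs.1] at hty
          linarith
        obtain ⟨c, hc, hF⟩ := exists_F_comp_wall hs ht hts
        rw [hF] at hty
        refine ⟨s⁻¹ * t * s, ⟨⟨conj' hs.1 ht, ?_⟩, conj_ne_of_ne hts⟩, by group⟩
        exact neg_of_mul_neg_right hty hc.le
      have h1 := (Set.ncard_le_ncard hsub ((hfin.subset Set.sdiff_subset).image _)).trans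
        (Set.ncard_image_le (hfin.subset Set.sdiff_subset))
      have h2 := Set.ncard_sdiff_singleton_add_one (show s ∈ {t | t ∈ A.R ∧ A.F t y < 0} from
        ⟨hs.1, hsy⟩) hfin
      obtain ⟨g, hg, hg'⟩ := ih _ (by omega) (s y) hreg rfl
      exact ⟨g * s, mul_mem hg (Subgroup.subset_closure hs), hg'⟩
    · push Not at h
      exact ⟨1, one_mem _, fun t ht => lt_of_le_of_ne (h t ht) (hy t ht).symm⟩

theorem conj_mem_R_of_closure {g : X ≃ₗ[ℝ] X} (hg : g ∈ Subgroup.closure A.R) :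
    ∀ t, t ∈ A.R → g * t * g⁻¹ ∈ A.R := by
  induction hg using Subgroup.closure_induction'' with
  | mem s hs => exact A.conj s hs
  | inv_mem s hs =>
    intro t ht
    rw [inv_eq hs]
    exact A.conj s hs t ht
  | one => intro t ht; simpa using ht
  | mul g h _ _ ihg ihh =>
    intro t ht
    have := ihg _ (ihh t ht)
    have e : g * (h * t * h⁻¹) * g⁻¹ = g * h * t * (g * h)⁻¹ := by group
    rwa [e] at this

/-- The reflections in the walls generate. -/
theorem mem_closure_walls (ht : t ∈ A.R) : t ∈ Subgroup.closure A.walls := by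
  have := A.finite.to_subtype
  -- The projection z of a generic u is a point of the hyperplane of t on no other hyperplane.
  -- Moving a chamber adjacent to z onto the base chamber turns t into a wall reflection, so t is
  -- conjugate to one within the group generated by walls.
  obtain ⟨u, hu⟩ := Module.Dual.exists_forall_ne_zero_of_forall_exists
    (fun r : {r : A.R // (r : X ≃ₗ[ℝ] X) ≠ t} =>
      (A.F r.1 - (A.F r.1 (A.root t) / 2) • A.F t)) (by
    intro r
    by_contra hcon
    push Not at hcon
    refine F_ne_smul r.1.2 ht r.2 (A.F r.1 (A.root t) / 2) ?_
    ext y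
    have := hcon y
    rwa [LinearMap.sub_apply, sub_eq_zero] at this)
  set z := u - (A.F t u / 2) • A.root t with hz
  have hz0 : A.F t z = 0 := by
    rw [hz, map_sub, map_smul, F_root ht, smul_eq_mul]; ring
  have hz1 : ∀ r ∈ A.R, r ≠ t → A.F r z ≠ 0 := by
    intro r hr hrt h
    apply hu ⟨⟨r, hr⟩, hrt⟩
    rw [hz, map_sub, map_smul, smul_eq_mul] at h
    simp only [LinearMap.sub_apply, LinearMap.smul_apply, smul_eq_mul]
    linarith
  obtain ⟨ε, hε, hpert⟩ := exists_pos_perturbation (fun r : A.R => A.F r z)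
    (fun r : A.R => A.F r (A.root t))
  set y := z + ε • A.root t with hy
  have hyreg : ∀ r ∈ A.R, A.F r y ≠ 0 := by
    intro r hr
    have e : A.F r y = A.F r z + ε * A.F r (A.root t) := by simp [hy]
    by_cases hrt : r = t
    · subst hrt
      rw [e, hz0, F_root hr]
      positivity
    · rw [e]
      rcases (hz1 r hr hrt).lt_or_gt with h | h
      · exact ((hpert ⟨r, hr⟩).2 h).ne
      · exact ((hpert ⟨r, hr⟩).1 h).ne'
  obtain ⟨g, hg, hgpos⟩ := A.exists_mem_closure_walls y hyreg
  have hgR : ∀ r ∈ A.R, g⁻¹ * r * g ∈ A.R := by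
    intro r hr
    have hg' : g⁻¹ ∈ Subgroup.closure A.R :=
      inv_mem (Subgroup.closure_mono (fun s hs => hs.1) hg)
    simpa using conj_mem_R_of_closure hg' r hr
  have hwall : g * t * g⁻¹ ∈ A.walls := by
    have htR : g * t * g⁻¹ ∈ A.R :=
      conj_mem_R_of_closure (Subgroup.closure_mono (fun s hs => hs.1) hg) t ht
    refine ⟨htR, g z, ?_, ?_⟩
    · rw [← apply_eq_iff htR]
      change g (t (g⁻¹ (g z))) = g z
      have : g⁻¹ (g z) = z := g.symm_apply_apply z
      rw [this, (apply_eq_iff ht z).2 hz0]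
    · intro r hr hrt
      obtain ⟨c, hc, hF⟩ := exists_F_comp hr (hgR r hr)
      have hr' : g⁻¹ * r * g ≠ t := by
        rintro rfl
        apply hrt
        group
      have h1 := hgpos r hr
      rw [hF] at h1 ⊢
      have e : A.F (g⁻¹ * r * g) y = A.F (g⁻¹ * r * g) z + ε * A.F (g⁻¹ * r * g) (A.root t) := by
        simp [hy]
      have hp := hpert ⟨_, hgR r hr⟩
      simp only [← e] at hp
      rcases (hz1 _ (hgR r hr) hr').lt_or_gt with h | h
      · have h2 := hp.2 h
        exact mul_pos_of_neg_of_neg (neg_of_mul_pos_left h1 h2.le) h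
      · have h2 := hp.1 h
        exact mul_pos (pos_of_mul_pos_left h1 h2.le) h
  have := mul_mem (mul_mem (inv_mem hg) (Subgroup.subset_closure hwall)) hg
  have e : g⁻¹ * (g * t * g⁻¹) * g = t := by group
  rwa [e] at this

/-- Otherwise the form of s t s⁻¹ would be, up to a nonzero factor, F t minus a positive multiple of
F s. A point on the wall of s alone excludes a negative factor, and a point on the wall of t alone
excludes a positive one. -/
theorem walls_obtuse (hs : s ∈ A.walls) (ht : t ∈ A.walls) (hst : s ≠ t) :
    A.F s (A.root t) ≤ 0 := by
  by_contra hcon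
  push Not at hcon
  have hs' := hs.1
  have ht' := ht.1
  have htr := A.conj s hs' t ht'
  have hne : s * t * s⁻¹ ≠ s := by
    intro h
    apply hst
    have : s⁻¹ * (s * t * s⁻¹) * s = t := by group
    rw [h] at this
    rw [← this]
    group
  -- the root of `s t s⁻¹` is `± s (root t)`
  have key : ∀ y, A.F (s * t * s⁻¹) y • A.root (s * t * s⁻¹) = A.F t (s y) • s (A.root t) := by
    intro y
    have h1 := reflection_apply htr y
    have h2 : (s * t * s⁻¹) y = s (t (s y)) := by rw [inv_eq hs']; rfl
    have h3 : s (s y) = y := DFunLike.congr_fun (mul_self hs') y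
    rw [h2, reflection_apply ht', map_sub, map_smul, h3, sub_right_inj] at h1
    exact h1.symm
  have hF : ∀ y, A.F t (s y) = A.F t y - A.F s (A.root t) * A.F s y := by
    intro y
    have : A.F t (A.root s) = A.F s (A.root t) := A.symm _ _
    rw [reflection_apply hs', map_sub, map_smul, smul_eq_mul, this]
    ring
  obtain ⟨c, hc0, hc⟩ := exists_F_comp ht' (g := s) (by
    have := conj' hs' ht'
    exact this)
  have e : s⁻¹ * t * s = s * t * s⁻¹ := by rw [inv_eq hs']
  rw [e] at hc
  rcases hc0.lt_or_gt with h | h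
  · obtain ⟨-, z, hz, hz'⟩ := hs
    have h1 := hz' t ht' hst.symm
    have h2 := hz' _ htr hne
    have h3 := hc z
    rw [hF, hz] at h3
    nlinarith
  · obtain ⟨-, z, hz, hz'⟩ := ht
    have h1 := hz' s hs' hst
    have h2 : 0 ≤ A.F (s * t * s⁻¹) z := by
      by_cases h' : s * t * s⁻¹ = t
      · rw [h', hz]
      · exact (hz' _ htr h').le
    have h3 := hc z
    rw [hF, hz] at h3
    nlinarith

/-- A vector on all the walls but one. -/
theorem exists_vertex (hs : s ∈ A.walls) :
    ∃ y, 0 < A.F s y ∧ ∀ t ∈ A.walls, t ≠ s → A.F t y = 0 := by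
  have : Finite A.walls := (A.finite.subset fun t ht => ht.1).to_subtype
  obtain ⟨y, hy, hy'⟩ := exists_dual_of_obtuse A.B A.pos (fun t : A.walls => A.root t)
    (fun i j hij => walls_obtuse i.2 j.2 fun h => hij (Subtype.ext h)) (x := A.x₀)
    (fun i => F_pos i.2.1) ⟨s, hs⟩
  exact ⟨y, hy, fun t ht h => hy' ⟨t, ht⟩ fun h' => h (congrArg Subtype.val h')⟩

end ReflectionArrangement

/-- The two forms of one reflection are proportional; the base point of A shows that the factor is
positive. This compares a subarrangement with the full one. -/
theorem ReflectionArrangement.F_pos_iff {X : Type*} [AddCommGroup X] [Module ℝ X]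
    {A A' : ReflectionArrangement X} {t : X ≃ₗ[ℝ] X} (ht : t ∈ A.R) (ht' : t ∈ A'.R)
    (h : 0 < A'.F t A.x₀) (y : X) : 0 < A.F t y ↔ 0 < A'.F t y := by
  have key : ∀ y, 2 * A.F t y = A'.F t y * A.F t (A'.root t) := by
    intro y
    have h1 := reflection_apply ht y
    rw [reflection_apply ht' y, sub_right_inj] at h1
    have h2 := congrArg (A.F t) h1
    rw [map_smul, map_smul, F_root ht, smul_eq_mul, smul_eq_mul] at h2
    linarith
  have h1 := key A.x₀
  have h2 := F_pos ht
  have h3 : 0 < A.F t (A'.root t) := by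
    by_contra hcon
    have := mul_nonpos_of_nonneg_of_nonpos h.le (not_lt.1 hcon)
    linarith
  have h4 := key y
  constructor
  · intro h5
    by_contra hcon
    have := mul_nonpos_of_nonpos_of_nonneg (not_lt.1 hcon) h3.le
    linarith
  · intro h5
    have := mul_pos h5 h3
    linarith

/-! ### The arrangement of W and its inversion cocycle -/

namespace RealReflectionCoset

variable {X : Type*} [AddCommGroup X] [Module ℝ X] (D : RealReflectionCoset X)

/-- The arrangement of `W`, with a base point in the chamber fixed by `φ`. -/
theorem exists_arrangement [FiniteDimensional ℝ X] : ∃ A : ReflectionArrangement X,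
    A.R = reflectionsOf D.W ∧ D.φ A.x₀ = A.x₀ ∧ ∀ y, y ∈ D.C ↔ ∀ t ∈ A.R, 0 < A.F t y := by
  have := D.finite
  obtain ⟨B, hpos, hsymm, hinv⟩ := exists_invariant_form D.W
  obtain ⟨c, hc, hC⟩ := D.isChamber
  let A' : ReflectionArrangement X :=
    { R := reflectionsOf D.W
      finite := (Set.finite_coe_iff.1 D.finite).subset fun t ht => ht.1
      isReflection := fun t ht => ht.2
      conj := fun s hs t ht => conj_mem_reflectionsOf (Subgroup.le_normalizer hs.1) ht
      B := B
      pos := hpos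
      symm := hsymm
      invariant := fun t ht => hinv t ht.1
      x₀ := c
      regular := hc }
  have hA'C : ∀ y, y ∈ D.C ↔ ∀ t ∈ A'.R, 0 < A'.F t y := by
    intro y
    rw [hC]
    constructor
    · intro hy t ht
      by_contra hcon
      push Not at hcon
      have h1 := ReflectionArrangement.F_pos ht
      change 0 < A'.F t c at h1
      set p := A'.F t c
      set q := A'.F t y
      have hpq : 0 < p - q := by linarith
      refine hy t ht ((-q / (p - q)) • c + (p / (p - q)) • y) ⟨-q / (p - q), p / (p - q),
        div_nonneg (by linarith) hpq.le, div_nonneg h1.le hpq.le, ?_, rfl⟩ ?_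
      · rw [← add_div, div_eq_one_iff_eq hpq.ne']; ring
      · rw [ReflectionArrangement.apply_eq_iff ht, map_add, map_smul, map_smul, smul_eq_mul,
          smul_eq_mul]
        change -q / (p - q) * p + p / (p - q) * q = 0
        ring
    · rintro hy t ht z ⟨a, b, ha, hb, hab, rfl⟩
      rw [Ne, ReflectionArrangement.apply_eq_iff (A := A') ht, map_add, map_smul, map_smul,
        smul_eq_mul, smul_eq_mul]
      have h1 := ReflectionArrangement.F_pos (A := A') ht
      have h2 := hy t ht
      change 0 < A'.F t c at h1
      rcases ha.lt_or_eq with h | h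
      · have h3 := mul_pos h h1
        have h4 := mul_nonneg hb h2.le
        linarith
      · rw [← h] at hab ⊢
        have : b = 1 := by linarith
        rw [this]
        linarith
  have hcC : ∀ k : ℕ, (D.φ ^ k) c ∈ D.C := by
    intro k
    induction k with
    | zero =>
      rw [hA'C]
      exact fun t ht => ReflectionArrangement.F_pos ht
    | succ k ih =>
      rw [pow_succ', ← D.map_chamber]
      exact ⟨_, ih, rfl⟩
  obtain ⟨n, hn, hφn⟩ := isOfFinOrder_iff_pow_eq_one.1 D.finOrder
  -- The sum of a φ-orbit in the chamber is fixed by φ and stays in the chamber. With such a base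
  -- point φ creates no inversion.
  set x₀ := ∑ k ∈ Finset.range n, (D.φ ^ k) c with hx₀
  have hφx : D.φ x₀ = x₀ := by
    have h1 : D.φ x₀ = ∑ k ∈ Finset.range n, (D.φ ^ (k + 1)) c := by
      rw [hx₀, map_sum]
      refine Finset.sum_congr rfl fun k _ => ?_
      rw [pow_succ']; rfl
    have h2 := Finset.sum_range_succ (fun k => (D.φ ^ k) c) n
    have h3 := Finset.sum_range_succ' (fun k => (D.φ ^ k) c) n
    rw [h2, hφn, pow_zero] at h3
    rw [h1]
    exact (add_right_cancel h3).symm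
  have hx₀pos : ∀ t ∈ A'.R, 0 < A'.F t x₀ := by
    intro t ht
    rw [hx₀, map_sum]
    exact Finset.sum_pos (fun k _ => (hA'C _).1 (hcC k) t ht)
      ⟨0, Finset.mem_range.2 hn⟩
  let A : ReflectionArrangement X :=
    { A' with
      x₀ := x₀
      regular := fun t ht h => by
        have h1 := hx₀pos t ht
        rw [(ReflectionArrangement.apply_eq_iff ht x₀).1 h] at h1
        exact lt_irrefl _ h1 }
  refine ⟨A, rfl, hφx, fun y => ?_⟩
  rw [hA'C]
  exact forall₂_congr fun t ht =>
    (ReflectionArrangement.F_pos_iff (A := A) (A' := A') ht ht (hx₀pos t ht) y).symm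

theorem mem_normalizer {g : X ≃ₗ[ℝ] X} (hg : g ∈ D.W) :
    g ∈ Subgroup.normalizer (D.W : Set (X ≃ₗ[ℝ] X)) := Subgroup.le_normalizer hg

variable [FiniteDimensional ℝ X]

/-- The arrangement of `W`, with a base point in the chamber fixed by `φ`. -/
def arr : ReflectionArrangement X := D.exists_arrangement.choose

theorem arr_R : D.arr.R = reflectionsOf D.W := D.exists_arrangement.choose_spec.1

theorem φ_x₀ : D.φ D.arr.x₀ = D.arr.x₀ := D.exists_arrangement.choose_spec.2.1

theorem mem_C_iff (y : X) : y ∈ D.C ↔ ∀ t ∈ D.arr.R, 0 < D.arr.F t y :=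
  D.exists_arrangement.choose_spec.2.2 y

/-- A wall point z in the arrangement sense is reached from the base point inside the chamber.
Conversely, if z were on the negative side of another hyperplane, the open segment to z would leave
the chamber. -/
theorem walls_eq : D.arr.walls = D.S := by
  ext s
  constructor
  · rintro ⟨hs, z, hz, hz'⟩
    have hs' := hs
    rw [arr_R] at hs'
    refine ⟨hs', z, (ReflectionArrangement.apply_eq_iff hs z).2 hz, ?_, D.arr.x₀, ?_, ?_⟩
    · intro t ht htz
      rw [← arr_R] at ht
      by_contra hts
      have := hz' t ht hts
      rw [(ReflectionArrangement.apply_eq_iff ht z).1 htz] at this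
      exact lt_irrefl _ this
    · rw [mem_C_iff]
      exact fun t ht => ReflectionArrangement.F_pos ht
    · rintro _ ⟨a, b, ha, hb, -, rfl⟩
      rw [mem_C_iff]
      intro t ht
      rw [map_add, map_smul, map_smul, smul_eq_mul, smul_eq_mul]
      have h1 := mul_pos ha (ReflectionArrangement.F_pos ht)
      by_cases hts : t = s
      · subst hts
        rw [hz]
        linarith
      · have h2 := mul_pos hb (hz' t ht hts)
        linarith
  · rintro ⟨hs, z, hz, huniq, x, hx, hseg⟩
    rw [← arr_R] at hs
    refine ⟨hs, z, (ReflectionArrangement.apply_eq_iff hs z).1 hz, ?_⟩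
    intro t ht hts
    have h0 : D.arr.F t z ≠ 0 := by
      intro h
      exact hts (huniq t (D.arr_R ▸ ht) ((ReflectionArrangement.apply_eq_iff ht z).2 h))
    by_contra hcon
    have hlt : D.arr.F t z < 0 := lt_of_le_of_ne (not_lt.1 hcon) h0
    have h1 := (D.mem_C_iff x).1 hx t ht
    set p := D.arr.F t x
    set q := D.arr.F t z
    have hpq : 0 < p - q := by linarith
    have h2 : (-q / (p - q)) • x + (p / (p - q)) • z ∈ D.C := by
      refine hseg ⟨-q / (p - q), p / (p - q), div_pos (by linarith) hpq, div_pos h1 hpq, ?_, rfl⟩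
      rw [← add_div, div_eq_one_iff_eq hpq.ne']; ring
    have h3 := (D.mem_C_iff _).1 h2 t ht
    rw [map_add, map_smul, map_smul, smul_eq_mul, smul_eq_mul] at h3
    have h4 : -q / (p - q) * p + p / (p - q) * q = 0 := by ring
    change 0 < -q / (p - q) * p + p / (p - q) * q at h3
    linarith

theorem closure_S : Subgroup.closure D.S = D.W := by
  apply le_antisymm
  · rw [Subgroup.closure_le]
    exact fun s hs => hs.1.1
  · conv_lhs => rw [← D.generated]
    rw [Subgroup.closure_le, ← arr_R, ← walls_eq]
    exact fun t ht => ReflectionArrangement.mem_closure_walls ht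

theorem conj_mem_arr_R {g t : X ≃ₗ[ℝ] X} (hg : g ∈ Subgroup.normalizer (D.W : Set (X ≃ₗ[ℝ] X))) :
    g⁻¹ * t * g ∈ D.arr.R ↔ t ∈ D.arr.R := by
  rw [arr_R]
  constructor
  · intro h
    have := conj_mem_reflectionsOf hg h
    have e : g * (g⁻¹ * t * g) * g⁻¹ = t := by group
    rwa [e] at this
  · intro h
    simpa using conj_mem_reflectionsOf (inv_mem hg) h

/-- Transitivity of `W` on chambers. -/
theorem exists_mem_W_pos (y : X) (hy : ∀ t ∈ D.arr.R, D.arr.F t y ≠ 0) :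
    ∃ g ∈ D.W, ∀ t ∈ D.arr.R, 0 < D.arr.F t (g y) := by
  obtain ⟨g, hg, h⟩ := D.arr.exists_mem_closure_walls y hy
  rw [walls_eq, closure_S] at hg
  exact ⟨g, hg, h⟩

theorem exists_opposite : ∃ g : D.W, ∀ t ∈ D.arr.R, D.arr.F t ((g : X ≃ₗ[ℝ] X) D.arr.x₀) < 0 := by
  obtain ⟨g, hg, h⟩ := D.exists_mem_W_pos (-D.arr.x₀) (fun t ht => by
    rw [map_neg, neg_ne_zero]
    exact (ReflectionArrangement.F_pos ht).ne')
  refine ⟨⟨g, hg⟩, fun t ht => ?_⟩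
  have := h t ht
  rw [map_neg, map_neg] at this
  exact neg_pos.1 this

theorem F_ne_zero {g t : X ≃ₗ[ℝ] X} (hg : g ∈ Subgroup.normalizer (D.W : Set (X ≃ₗ[ℝ] X)))
    (ht : t ∈ D.arr.R) : D.arr.F t (g D.arr.x₀) ≠ 0 := by
  have hg' := (D.conj_mem_arr_R hg).2 ht
  obtain ⟨c, hc, h⟩ := ReflectionArrangement.exists_F_comp ht hg'
  rw [h]
  exact mul_ne_zero hc (ReflectionArrangement.F_pos hg').ne'

/-- The reflections whose hyperplane separates the chamber from its image under `g`. -/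
def inv (g : X ≃ₗ[ℝ] X) : Set (X ≃ₗ[ℝ] X) :=
  {t | t ∈ D.arr.R ∧ D.arr.F t (g D.arr.x₀) < 0}

/-- The cocycle rule is proved on the normalizer rather than on W, because it is also applied to wφ
and its powers. -/
theorem mem_inv_mul {g h : X ≃ₗ[ℝ] X} (hg : g ∈ Subgroup.normalizer (D.W : Set (X ≃ₗ[ℝ] X)))
    (hh : h ∈ Subgroup.normalizer (D.W : Set (X ≃ₗ[ℝ] X))) (t : X ≃ₗ[ℝ] X) :
    t ∈ D.inv (g * h) ↔ ¬ (t ∈ D.inv g ↔ g⁻¹ * t * g ∈ D.inv h) := by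
  by_cases ht : t ∈ D.arr.R
  · have ht' := (D.conj_mem_arr_R hg).2 ht
    obtain ⟨c, hc, hF⟩ := ReflectionArrangement.exists_F_comp ht ht'
    have h1 := D.F_ne_zero hh ht'
    have h2 := ReflectionArrangement.F_pos ht'
    have e : D.arr.F t ((g * h) D.arr.x₀) = c * D.arr.F (g⁻¹ * t * g) (h D.arr.x₀) := hF _
    simp only [inv, Set.mem_ofPred_eq, ht, ht', true_and, e, hF]
    rcases hc.lt_or_gt with hc | hc
    · rcases h1.lt_or_gt with h1 | h1
      · have h3 := mul_pos_of_neg_of_neg hc h1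
        have h4 := mul_neg_of_neg_of_pos hc h2
        have := h3.not_gt
        tauto
      · have h3 := mul_neg_of_neg_of_pos hc h1
        have h4 := mul_neg_of_neg_of_pos hc h2
        have := h1.not_gt
        tauto
    · have h4 := mul_pos hc h2
      rcases h1.lt_or_gt with h1 | h1
      · have h3 := mul_neg_of_pos_of_neg hc h1
        have := h4.not_gt
        tauto
      · have h3 := mul_pos hc h1
        have := h1.not_gt
        have := h3.not_gt
        have := h4.not_gt
        tauto
  · have ht' := mt (D.conj_mem_arr_R hg).1 ht
    have h1 : t ∉ D.inv (g * h) := fun h => ht h.1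
    have h2 : t ∉ D.inv g := fun h => ht h.1
    have h3 : g⁻¹ * t * g ∉ D.inv h := fun h => ht' h.1
    tauto

/-- The reflection cocycle of `(W, S)`. -/
def cocycle : ReflectionCocycle D.W D.S where
  s i := ⟨i, i.2.1.1⟩
  N w := {t | (t : X ≃ₗ[ℝ] X) ∈ D.inv w}
  s_injective i j h := Subtype.ext (congrArg (fun w : D.W => (w : X ≃ₗ[ℝ] X)) h)
  s_mul_self i := Subtype.ext (D.S_mul_self i)
  closure_range := by
    apply Subgroup.map_injective D.W.subtype_injective
    rw [MonoidHom.map_closure, ← Set.range_comp]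
    have : Set.range (D.W.subtype ∘ fun i : D.S => (⟨i, i.2.1.1⟩ : D.W)) = D.S :=
      Subtype.range_coe
    rw [this, closure_S, ← MonoidHom.range_eq_map, Subgroup.range_subtype]
  mem_N_mul t u v := D.mem_inv_mul (D.mem_normalizer u.2) (D.mem_normalizer v.2) t
  mem_N_s t i := by
    have hi : (i : X ≃ₗ[ℝ] X) ∈ D.arr.walls := by rw [walls_eq]; exact i.2
    constructor
    · rintro ⟨ht, ht'⟩
      by_contra hne
      have := ReflectionArrangement.F_wall_apply_pos hi ht fun h => hne (Subtype.ext h)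
      exact absurd ht' this.not_gt
    · rintro rfl
      refine ⟨hi.1, ?_⟩
      change D.arr.F (i : X ≃ₗ[ℝ] X) ((i : X ≃ₗ[ℝ] X) D.arr.x₀) < 0
      rw [ReflectionArrangement.F_self_apply hi.1]
      linarith [ReflectionArrangement.F_pos hi.1]
  w₀ := D.exists_opposite.choose
  conj_mem_N_w₀ g i := by
    have hi : (i : X ≃ₗ[ℝ] X) ∈ D.arr.R := by rw [arr_R]; exact i.2.1
    have h : (g : X ≃ₗ[ℝ] X) * i * (g : X ≃ₗ[ℝ] X)⁻¹ ∈ D.arr.R := by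
      rw [arr_R]
      exact conj_mem_reflectionsOf (D.mem_normalizer g.2) i.2.1
    exact ⟨h, D.exists_opposite.choose_spec _ h⟩

theorem mem_N_iff (t w : D.W) : t ∈ D.cocycle.N w ↔ (t : X ≃ₗ[ℝ] X) ∈ D.inv w := Iff.rfl

theorem coe_s (i : D.S) : (D.cocycle.s i : X ≃ₗ[ℝ] X) = i := rfl

theorem mem_refl_iff (t : D.W) : t ∈ D.cocycle.refl ↔ (t : X ≃ₗ[ℝ] X) ∈ D.arr.R := by
  rw [← ReflectionCocycle.N_w₀]
  exact ⟨fun h => h.1, fun h => ⟨h, D.exists_opposite.choose_spec _ h⟩⟩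

theorem coxeterMatrix_eq (i j : D.S) :
    D.coxeterMatrix i j = orderOf (D.cocycle.s i * D.cocycle.s j) :=
  (Subgroup.orderOf_coe (D.cocycle.s i * D.cocycle.s j)).symm ▸ rfl

theorem coe_word (l : List D.S) : ((D.cocycle.word l : D.W) : X ≃ₗ[ℝ] X) = D.wordValue l := by
  induction l with
  | nil => rfl
  | cons i l ih =>
    rw [ReflectionCocycle.word_cons, Subgroup.coe_mul, ih]
    simp only [wordValue, List.map_cons, List.prod_cons]
    rfl

theorem mem_parabolic_iff (I : Set D.S) (w : D.W) :
    (w : X ≃ₗ[ℝ] X) ∈ D.parabolic I ↔ w ∈ D.cocycle.par I := by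
  have : D.parabolic I = (D.cocycle.par I).map D.W.subtype := by
    rw [ReflectionCocycle.par, MonoidHom.map_closure, ← Set.image_comp]
    rfl
  rw [this]
  constructor
  · rintro ⟨v, hv, h⟩
    rwa [← Subtype.ext h]
  · exact fun h => ⟨w, h, rfl⟩

theorem length_coe (w : D.W) : D.length w = D.cocycle.len w := by
  obtain ⟨l, hl, hlen⟩ := D.cocycle.exists_reduced w
  apply le_antisymm
  · exact Nat.sInf_le ⟨l, by rw [← coe_word, hl], hlen⟩
  · have hne : {n | ∃ l : List D.S, D.wordValue l = w ∧ l.length = n}.Nonempty :=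
      ⟨_, l, by rw [← coe_word, hl], rfl⟩
    obtain ⟨m, hm, hmlen⟩ := Nat.sInf_mem hne
    have : D.cocycle.word m = w := Subtype.ext (by rw [coe_word, hm])
    rw [length, ← hmlen, ← this]
    exact D.cocycle.len_word_le m

/-- An element of maximal length in W_I has every generator in I as an inversion, since otherwise it
could be lengthened; `eq_wI` then identifies it. -/
theorem longestLift_eq (I : Set D.S) :
    D.longestLift I = D.cocycle.L D.coxeterMatrix (D.cocycle.wI I) := by
  obtain ⟨h1, h2, h3⟩ := (D.exists_longestWord I).choose_spec
  change D.wordValue (D.longestWord I) ∈ _ at h1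
  change (D.longestWord I).length = D.length (D.wordValue (D.longestWord I)) at h2
  change ∀ u ∈ _, D.length u ≤ D.length (D.wordValue (D.longestWord I)) at h3
  set l := D.longestWord I with hl
  rw [← coe_word] at h1 h2 h3
  rw [mem_parabolic_iff] at h1
  rw [length_coe] at h2 h3
  have h4 : D.cocycle.word l = D.cocycle.wI I := by
    refine D.cocycle.eq_wI h1 fun i hi => ?_
    by_contra hn
    have h5 := D.cocycle.len_s_mul_of_notMem hn
    have h6 := h3 (D.cocycle.s i * D.cocycle.word l : D.W)
      ((D.mem_parabolic_iff I _).2 (mul_mem (D.cocycle.s_mem_par hi) h1))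
    rw [length_coe] at h6
    omega
  rw [longestLift, ReflectionCocycle.mk_ofList, ← h4, D.cocycle.L_word D.coxeterMatrix_eq h2.symm]

theorem toB_injective : Function.Injective D.toB :=
  D.cocycle.toGroup_injective D.coxeterMatrix_eq

end RealReflectionCoset

/-! ### Crossing numbers -/

/-- Conjugation acting on integer-valued functions on a group. -/
def conjFun (G : Type*) [Group G] : G →* MulAut (G → Multiplicative ℤ) where
  toFun g :=
    { toFun := fun f t => f (g⁻¹ * t * g)
      invFun := fun f t => f (g * t * g⁻¹)
      left_inv := fun f => by
        funext t
        group
      right_inv := fun f => by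
        funext t
        group
      map_mul' := fun f f' => rfl }
  map_one' := by
    refine MulEquiv.ext fun f => funext fun t => ?_
    change f (1⁻¹ * t * 1) = f t
    simp
  map_mul' g h := by
    refine MulEquiv.ext fun f => funext fun t => ?_
    change f ((g * h)⁻¹ * t * (g * h)) = f (h⁻¹ * (g⁻¹ * t * g) * h)
    congr 1
    group

/-- Pairs of an integer-valued function on `G` and an element of `G`. -/
abbrev CrossGroup (G : Type*) [Group G] : Type _ := (G → Multiplicative ℤ) ⋊[conjFun G] G

namespace RealReflectionCoset

variable {X : Type*} [AddCommGroup X] [Module ℝ X] (D : RealReflectionCoset X)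

theorem Φ_mul_inl (k : ℕ) (b : D.BraidGroup) :
    D.φSemi ^ k * SemidirectProduct.inl b = SemidirectProduct.inl ((D.φB ^ k) b) * D.φSemi ^ k := by
  have h : D.φSemi ^ k = SemidirectProduct.inr (Multiplicative.ofAdd (k : ℤ)) := by
    rw [φSemi, ← map_pow, ← ofAdd_nsmul]
    simp
  have h2 : (D.φB ^ k) b = (zpowersHom (MulAut D.BraidGroup) D.φB (Multiplicative.ofAdd (k : ℤ))) b := by
    simp
  rw [h, h2, SemidirectProduct.inl_aut]
  simp

theorem φB_gen (s : D.S) : D.φB (D.toB (D.gen s)) = D.toB (D.gen (D.permS s)) :=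
  ArtinGroup.diagramAut_of D.permS D.coxeterMatrix_permS s

theorem permS_pow (k : ℕ) (s : D.S) :
    ((D.permS ^ k) s : X ≃ₗ[ℝ] X) = D.φ ^ k * s * (D.φ ^ k)⁻¹ := by
  induction k with
  | zero => simp
  | succ k ih =>
    rw [pow_succ', Equiv.Perm.mul_apply]
    change D.φ * ((D.permS ^ k) s : X ≃ₗ[ℝ] X) * D.φ⁻¹ = _
    rw [ih, pow_succ']
    group

theorem exists_toB_φB (z : D.BraidMonoid) : ∃ c, D.φB (D.toB z) = D.toB c := by
  induction z using ReflectionCocycle.artin_induction with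
  | one => exact ⟨1, by simp⟩
  | gen_mul i a ih =>
    obtain ⟨c, hc⟩ := ih
    exact ⟨D.gen (D.permS i) * c, by
      rw [map_mul, map_mul, hc, map_mul, ← D.φB_gen i]; rfl⟩

theorem braidGroup_induction {p : D.BraidGroup → Prop} (one : p 1)
    (mul : ∀ a b, p a → p b → p (a * b)) (inv : ∀ a, p a → p a⁻¹)
    (gen : ∀ s, p (D.toB (D.gen s))) (b : D.BraidGroup) : p b := by
  have hb : b ∈ Subgroup.closure (Set.range (PresentedGroup.of (rels := braidRelators D.coxeterMatrix))) := by
    rw [PresentedGroup.closure_range_of]; trivial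
  induction hb using Subgroup.closure_induction with
  | mem x hx =>
    obtain ⟨i, rfl⟩ := hx
    exact gen i
  | one => exact one
  | mul x y _ _ hx hy => exact mul x y hx hy
  | inv x _ hx => exact inv x hx

variable [FiniteDimensional ℝ X]

open Classical in
/-- The element of the crossing group attached to an element of `GL(X)`. -/
def crossElt (g : X ≃ₗ[ℝ] X) : CrossGroup (X ≃ₗ[ℝ] X) :=
  ⟨fun t => if t ∈ D.inv g then Multiplicative.ofAdd 1 else 1, g⟩

/-- In a reduced product the inversion sets are disjoint, so their indicator functions add without
cancellation. Hence the braid relations hold in the crossing group. -/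
theorem crossElt_mul {u v : D.W} (h : D.cocycle.N u ⊆ D.cocycle.N (u * v)) :
    D.crossElt (u * v : D.W) = D.crossElt u * D.crossElt v := by
  classical
  refine SemidirectProduct.ext ?_ rfl
  funext t
  change (if t ∈ D.inv (u * v : D.W) then Multiplicative.ofAdd (1 : ℤ) else 1) =
    (if t ∈ D.inv u then Multiplicative.ofAdd (1 : ℤ) else 1) *
      (if (u : X ≃ₗ[ℝ] X)⁻¹ * t * u ∈ D.inv v then Multiplicative.ofAdd (1 : ℤ) else 1)
  have h1 := D.mem_inv_mul (D.mem_normalizer u.2) (D.mem_normalizer v.2) t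
  have h2 : t ∈ D.inv u → t ∈ D.inv (u * v : D.W) := by
    intro ht
    have htW : t ∈ D.W := by have := ht.1; rw [arr_R] at this; exact this.1
    exact @h ⟨t, htW⟩ ht
  rw [Subgroup.coe_mul] at h2 ⊢
  by_cases hu : t ∈ D.inv u
  · have h3 := h2 hu
    have h4 : (u : X ≃ₗ[ℝ] X)⁻¹ * t * u ∉ D.inv v := by tauto
    simp [hu, h3, h4]
  · by_cases hv : (u : X ≃ₗ[ℝ] X)⁻¹ * t * u ∈ D.inv v
    · have h3 : t ∈ D.inv ((u : X ≃ₗ[ℝ] X) * v) := by tauto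
      simp [hu, hv, h3]
    · have h3 : t ∉ D.inv ((u : X ≃ₗ[ℝ] X) * v) := by tauto
      simp [hu, hv, h3]

theorem crossElt_one : D.crossElt 1 = 1 := by
  refine SemidirectProduct.ext ?_ rfl
  funext t
  have : t ∉ D.inv 1 := fun h => absurd h.2 (ReflectionArrangement.F_pos h.1).not_gt
  simp [crossElt, this]

theorem crossElt_word {l : List D.S} (h : D.cocycle.len (D.cocycle.word l) = l.length) :
    (l.map fun s : D.S => D.crossElt (s : X ≃ₗ[ℝ] X)).prod = D.crossElt (D.cocycle.word l) := by
  induction l with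
  | nil => exact D.crossElt_one.symm
  | cons i l ih =>
    rw [List.map_cons, List.prod_cons, ih (D.cocycle.len_tail_of_reduced h),
      ReflectionCocycle.word_cons, D.crossElt_mul, coe_s]
    rw [ReflectionCocycle.N_s_subset_iff, ← ReflectionCocycle.word_cons]
    exact D.cocycle.s_mem_N_of_reduced h

/-- The homomorphism from the braid group recording crossing numbers of hyperplanes. -/
def crossB : D.BraidGroup →* CrossGroup (X ≃ₗ[ℝ] X) :=
  ArtinGroup.lift (fun s : D.S => D.crossElt (s : X ≃ₗ[ℝ] X)) (ReflectionCocycle.lift_eq_of_alt (by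
    intro i j
    obtain ⟨h1, h2⟩ := D.cocycle.word_alt_eq_wI i j
    obtain ⟨h3, h4⟩ := D.cocycle.word_alt_eq_wI j i
    rw [← coxeterMatrix_eq] at h1 h2 h3
    rw [D.coxeterMatrix.symmetric, Set.pair_comm] at h3
    rw [D.crossElt_word, D.crossElt_word, h1, h3]
    · rw [h3, ReflectionCocycle.alt_length, h2]
    · rw [h1, ReflectionCocycle.alt_length, h2]))

theorem crossB_gen (s : D.S) : D.crossB (D.toB (D.gen s)) = D.crossElt (s : X ≃ₗ[ℝ] X) :=
  ArtinGroup.lift_of _ _ s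

theorem crossB_L (w : D.W) :
    D.crossB (D.toB (D.cocycle.L D.coxeterMatrix w)) = D.crossElt w := by
  obtain ⟨l, rfl, hl⟩ := D.cocycle.exists_reduced w
  rw [D.cocycle.L_word D.coxeterMatrix_eq hl.symm, map_list_prod, map_list_prod, List.map_map,
    List.map_map, ← D.crossElt_word hl.symm]
  congr 1
  exact List.map_congr_left fun s _ => D.crossB_gen s

/-- Since φ fixes the base point, it preserves positive sides, and conjugation by φ merely relabels
hyperplanes. -/
theorem mem_inv_φ_conj (g t : X ≃ₗ[ℝ] X) :
    t ∈ D.inv (D.φ * g * D.φ⁻¹) ↔ D.φ⁻¹ * t * D.φ ∈ D.inv g := by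
  have hx : D.φ⁻¹ D.arr.x₀ = D.arr.x₀ := by
    conv_lhs => rw [← D.φ_x₀]
    exact D.φ.symm_apply_apply _
  have hC : ∀ y, (∀ t ∈ D.arr.R, 0 < D.arr.F t y) ↔ ∀ t ∈ D.arr.R, 0 < D.arr.F t (D.φ y) := by
    intro y
    rw [← mem_C_iff, ← mem_C_iff]
    conv_rhs => rw [← D.map_chamber]
    exact (Function.Injective.mem_set_image D.φ.injective).symm
  have hinvφ : ∀ r, r ∉ D.inv D.φ := by
    rintro r ⟨h1, h2⟩
    rw [φ_x₀] at h2
    exact h2.not_gt (ReflectionArrangement.F_pos h1)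
  have hinvφ' : ∀ r, r ∉ D.inv D.φ⁻¹ := by
    rintro r ⟨h1, h2⟩
    rw [hx] at h2
    exact h2.not_gt (ReflectionArrangement.F_pos h1)
  have e : (D.φ * g * D.φ⁻¹) D.arr.x₀ = D.φ (g D.arr.x₀) := by
    change D.φ (g (D.φ⁻¹ D.arr.x₀)) = _
    rw [hx]
  by_cases ht : t ∈ D.arr.R
  · have ht' := (D.conj_mem_arr_R D.normalizes).2 ht
    obtain ⟨c, hc, hF⟩ := ReflectionArrangement.exists_F_comp ht ht'
    have h1 := hF D.arr.x₀
    rw [φ_x₀] at h1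
    have h2 := ReflectionArrangement.F_pos ht
    rw [h1] at h2
    have h3 : 0 < c := pos_of_mul_pos_left h2 (ReflectionArrangement.F_pos ht').le
    simp only [inv, Set.mem_ofPred_eq, ht, ht', true_and, e, hF]
    constructor
    · intro h
      exact neg_of_mul_neg_right h h3.le
    · intro h
      exact mul_neg_of_pos_of_neg h3 h
  · have ht' := mt (D.conj_mem_arr_R D.normalizes).1 ht
    exact iff_of_false (fun h => ht h.1) (fun h => ht' h.1)

theorem crossElt_φ_conj (g : X ≃ₗ[ℝ] X) : D.crossElt (D.φ * g * D.φ⁻¹) =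
    SemidirectProduct.inr D.φ * D.crossElt g * (SemidirectProduct.inr D.φ)⁻¹ := by
  classical
  rw [← map_inv]
  refine SemidirectProduct.ext ?_ rfl
  funext t
  have h := D.mem_inv_φ_conj g t
  change (if t ∈ D.inv (D.φ * g * D.φ⁻¹) then Multiplicative.ofAdd (1 : ℤ) else 1) =
    1 * (if D.φ⁻¹ * t * D.φ ∈ D.inv g then Multiplicative.ofAdd (1 : ℤ) else 1) * 1
  simp [h]

theorem crossB_φB (b : D.BraidGroup) : D.crossB (D.φB b) =
    SemidirectProduct.inr D.φ * D.crossB b * (SemidirectProduct.inr D.φ)⁻¹ := by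
  induction b using D.braidGroup_induction with
  | one => simp
  | mul a b ha hb => rw [map_mul, map_mul, ha, hb, map_mul]; group
  | inv a ha => rw [map_inv, map_inv, ha, map_inv]; group
  | gen s => rw [φB_gen, crossB_gen, crossB_gen, ← crossElt_φ_conj]; rfl

/-- The homomorphism from `B ⋊ ⟨φ⟩` recording crossing numbers of hyperplanes. -/
def cross : D.BSemi →* CrossGroup (X ≃ₗ[ℝ] X) :=
  SemidirectProduct.lift D.crossB (zpowersHom _ (SemidirectProduct.inr D.φ)) (by
    intro g
    refine MonoidHom.ext fun b => ?_
    change D.crossB (zpowersHom (MulAut D.BraidGroup) D.φB g b) =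
      zpowersHom _ (SemidirectProduct.inr D.φ) g * D.crossB b *
        (zpowersHom _ (SemidirectProduct.inr D.φ) g)⁻¹
    rw [zpowersHom_apply, zpowersHom_apply]
    generalize Multiplicative.toAdd g = n
    have hinv : ∀ b, D.crossB (D.φB⁻¹ b) = (SemidirectProduct.inr D.φ)⁻¹ * D.crossB b *
        SemidirectProduct.inr D.φ := by
      intro b
      have := D.crossB_φB (D.φB⁻¹ b)
      rw [MulAut.apply_inv_self] at this
      rw [this]
      group
    induction n using Int.induction_on generalizing b with
    | zero => simp
    | succ n ih =>
      rw [zpow_add_one, MulAut.mul_apply, ih, crossB_φB, zpow_add_one]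
      group
    | pred n ih =>
      rw [zpow_sub_one, MulAut.mul_apply, ih, hinv, zpow_sub_one]
      group)

theorem cross_inl (b : D.BraidGroup) : D.cross (SemidirectProduct.inl b) = D.crossB b :=
  SemidirectProduct.lift_inl _ _ _ _

theorem cross_φSemi : D.cross D.φSemi = SemidirectProduct.inr D.φ := by
  rw [cross, φSemi, SemidirectProduct.lift_inr]
  simp

/-- The signed number of times an element of `B ⋊ ⟨φ⟩` crosses the hyperplane of `t`. -/
def cr (b : D.BSemi) (t : X ≃ₗ[ℝ] X) : ℤ := Multiplicative.toAdd ((D.cross b).left t)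

/-- The image in `GL(X)` of an element of `B ⋊ ⟨φ⟩`. -/
def im (b : D.BSemi) : X ≃ₗ[ℝ] X := (D.cross b).right

theorem im_mul (a b : D.BSemi) : D.im (a * b) = D.im a * D.im b := by
  rw [im, map_mul]; rfl

theorem im_one : D.im 1 = 1 := by rw [im, map_one]; rfl

theorem im_pow (a : D.BSemi) (k : ℕ) : D.im (a ^ k) = D.im a ^ k := by
  induction k with
  | zero => simp [im_one]
  | succ k ih => rw [pow_succ, pow_succ, im_mul, ih]

theorem cr_mul (a b : D.BSemi) (t : X ≃ₗ[ℝ] X) :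
    D.cr (a * b) t = D.cr a t + D.cr b ((D.im a)⁻¹ * t * D.im a) := by
  rw [cr, map_mul]; rfl

theorem cr_one (t : X ≃ₗ[ℝ] X) : D.cr 1 t = 0 := by rw [cr, map_one]; rfl

theorem cr_pow (a : D.BSemi) (k : ℕ) (t : X ≃ₗ[ℝ] X) :
    D.cr (a ^ k) t = ∑ j ∈ Finset.range k, D.cr a ((D.im a ^ j)⁻¹ * t * D.im a ^ j) := by
  induction k with
  | zero => simp [cr_one]
  | succ k ih => rw [pow_succ, cr_mul, ih, im_pow, Finset.sum_range_succ]

theorem im_φSemi : D.im D.φSemi = D.φ := by rw [im, cross_φSemi]; rfl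

theorem cr_φSemi (t : X ≃ₗ[ℝ] X) : D.cr D.φSemi t = 0 := by rw [cr, cross_φSemi]; rfl

theorem cr_φSemi_pow (k : ℕ) (t : X ≃ₗ[ℝ] X) : D.cr (D.φSemi ^ k) t = 0 := by
  rw [cr_pow]
  exact Finset.sum_eq_zero fun j _ => D.cr_φSemi _

open Classical in
theorem cr_L (w : D.W) (t : X ≃ₗ[ℝ] X) :
    D.cr (SemidirectProduct.inl (D.toB (D.cocycle.L D.coxeterMatrix w))) t =
      if t ∈ D.inv w then 1 else 0 := by
  rw [cr, cross_inl, crossB_L, crossElt]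
  split_ifs <;> simp_all

theorem im_L (w : D.W) :
    D.im (SemidirectProduct.inl (D.toB (D.cocycle.L D.coxeterMatrix w))) = w := by
  rw [im, cross_inl, crossB_L]; rfl

theorem im_gen (s : D.S) : D.im (SemidirectProduct.inl (D.toB (D.gen s))) = s := by
  rw [im, cross_inl, crossB_gen]; rfl

theorem im_inl (b : D.BraidGroup) : D.im (SemidirectProduct.inl b) = D.toW b := by
  induction b using D.braidGroup_induction with
  | one => simp [im_one]
  | mul a b ha hb => rw [map_mul, im_mul, ha, hb, map_mul]
  | inv a ha =>
    rw [im, map_inv, map_inv, map_inv, ← ha]; rfl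
  | gen s => rw [im_gen]; exact (ArtinGroup.lift_of _ _ s).symm

theorem im_mulφ (b : D.BraidMonoid) : D.im (D.mulφ b) = D.imageφ b := by
  rw [mulφ, im_mul, im_inl, im_φSemi]; rfl

theorem toW_mem (b : D.BraidGroup) : D.toW b ∈ D.W := by
  induction b using D.braidGroup_induction with
  | one => rw [map_one]; exact one_mem _
  | mul a b ha hb => rw [map_mul]; exact mul_mem ha hb
  | inv a ha => rw [map_inv]; exact inv_mem ha
  | gen s => rw [← im_inl, im_gen]; exact s.2.1.1

theorem cr_mulφ (b : D.BraidMonoid) (t : X ≃ₗ[ℝ] X) :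
    D.cr (D.mulφ b) t = D.cr (SemidirectProduct.inl (D.toB b)) t := by
  rw [mulφ, cr_mul, cr_φSemi, add_zero]

/-- Crossing numbers of positive braids. -/
def crM (b : D.BraidMonoid) (t : X ≃ₗ[ℝ] X) : ℤ := D.cr (SemidirectProduct.inl (D.toB b)) t

/-- The image of a positive braid in `GL(X)`. -/
def imM (b : D.BraidMonoid) : X ≃ₗ[ℝ] X := D.toW (D.toB b)

theorem imM_mul (a b : D.BraidMonoid) : D.imM (a * b) = D.imM a * D.imM b := by
  rw [imM, map_mul, map_mul]; rfl

theorem imM_mem (b : D.BraidMonoid) : D.imM b ∈ D.W := D.toW_mem _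

theorem imM_gen (s : D.S) : D.imM (D.gen s) = s := by rw [imM, ← im_inl, im_gen]

theorem imM_L (w : D.W) : D.imM (D.cocycle.L D.coxeterMatrix w) = w := by
  rw [imM, ← im_inl, im_L]

theorem crM_mul (a b : D.BraidMonoid) (t : X ≃ₗ[ℝ] X) :
    D.crM (a * b) t = D.crM a t + D.crM b ((D.imM a)⁻¹ * t * D.imM a) := by
  rw [crM, map_mul, map_mul, cr_mul, im_inl]; rfl

theorem crM_one (t : X ≃ₗ[ℝ] X) : D.crM 1 t = 0 := by
  rw [crM, map_one, map_one, cr_one]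

open Classical in
theorem crM_gen (s : D.S) (t : X ≃ₗ[ℝ] X) : D.crM (D.gen s) t = if t = s then 1 else 0 := by
  have h1 := D.cr_L (D.cocycle.s s) t
  rw [D.cocycle.L_s D.coxeterMatrix_eq] at h1
  change D.crM (D.gen s) t = _ at h1
  rw [h1]
  congr 1
  apply propext
  constructor
  · intro h
    have htW : t ∈ D.W := by have := h.1; rw [arr_R] at this; exact this.1
    exact congrArg Subtype.val ((D.cocycle.mem_N_s ⟨t, htW⟩ s).1 h)
  · rintro rfl
    exact (D.cocycle.mem_N_s (D.cocycle.s s) s).2 rfl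

open Classical in
theorem crM_L (w : D.W) (t : X ≃ₗ[ℝ] X) :
    D.crM (D.cocycle.L D.coxeterMatrix w) t = if t ∈ D.inv w then 1 else 0 := D.cr_L w t

theorem crM_nonneg (b : D.BraidMonoid) (t : X ≃ₗ[ℝ] X) : 0 ≤ D.crM b t := by
  induction b using ReflectionCocycle.artin_induction generalizing t with
  | one => rw [crM_one]
  | gen_mul i a ih =>
    rw [crM_mul]
    refine add_nonneg ?_ (ih _)
    change 0 ≤ D.crM (D.gen i) t
    rw [crM_gen]
    split_ifs <;> norm_num

theorem mem_R_of_crM_ne_zero {b : D.BraidMonoid} {t : X ≃ₗ[ℝ] X} (h : D.crM b t ≠ 0) :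
    t ∈ D.arr.R := by
  induction b using ReflectionCocycle.artin_induction generalizing t with
  | one => exact absurd (D.crM_one t) h
  | gen_mul i a ih =>
    rw [crM_mul] at h
    change D.crM (D.gen i) t + D.crM a ((D.imM (D.gen i))⁻¹ * t * D.imM (D.gen i)) ≠ 0 at h
    rw [crM_gen, imM_gen] at h
    by_cases hti : t = i
    · rw [hti, arr_R]; exact i.2.1
    · rw [if_neg hti, zero_add] at h
      exact (D.conj_mem_arr_R (D.mem_normalizer i.2.1.1)).1 (ih h)

/-- A hyperplane separates the chamber from its image iff it is crossed an odd number of times. -/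
theorem mem_inv_imM_iff (b : D.BraidMonoid) (t : X ≃ₗ[ℝ] X) :
    t ∈ D.inv (D.imM b) ↔ Odd (D.crM b t) := by
  induction b using ReflectionCocycle.artin_induction generalizing t with
  | one =>
    have h1 : D.imM 1 = 1 := by rw [imM, map_one, map_one]
    rw [crM_one, h1]
    refine iff_of_false (fun h => ?_) (by simp)
    exact absurd h.2 (ReflectionArrangement.F_pos h.1).not_gt
  | gen_mul i a ih =>
    change t ∈ D.inv (D.imM (D.gen i * a)) ↔ Odd (D.crM (D.gen i * a) t)
    rw [crM_mul, imM_mul, D.mem_inv_mul (D.mem_normalizer (D.imM_mem _))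
      (D.mem_normalizer (D.imM_mem _)), ih, Int.odd_add]
    have : t ∈ D.inv (D.imM (D.gen i)) ↔ Odd (D.crM (D.gen i) t) := by
      have h1 := D.crM_L (D.cocycle.s i) t
      rw [D.cocycle.L_s D.coxeterMatrix_eq] at h1
      change D.crM (D.gen i) t = _ at h1
      rw [h1, imM_gen, ← coe_s]
      split_ifs with h <;> simp [h]
    rw [this, ← Int.not_odd_iff_even]
    tauto

end RealReflectionCoset

namespace RealReflectionCoset

variable {X : Type*} [AddCommGroup X] [Module ℝ X] (D : RealReflectionCoset X)
  [FiniteDimensional ℝ X]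

/-! ### Elements mapping a standard chamber of a parabolic subgroup to another one -/

theorem notMem_inv_one (t : X ≃ₗ[ℝ] X) : t ∉ D.inv 1 := fun h =>
  absurd h.2 (ReflectionArrangement.F_pos h.1).not_gt

theorem mem_W_of_mem_R {t : X ≃ₗ[ℝ] X} (ht : t ∈ D.arr.R) : t ∈ D.W := by
  rw [arr_R] at ht; exact ht.1

theorem coe_mem_R (s : D.S) : (s : X ≃ₗ[ℝ] X) ∈ D.arr.R := by rw [arr_R]; exact s.2.1

theorem coe_mem_parabolic {I : Set D.S} {s : D.S} (hs : s ∈ I) :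
    (s : X ≃ₗ[ℝ] X) ∈ D.parabolic I := Subgroup.subset_closure ⟨s, hs, rfl⟩

theorem coe_mem_parabolic_iff {I : Set D.S} {s : D.S} :
    (s : X ≃ₗ[ℝ] X) ∈ D.parabolic I ↔ s ∈ I := by
  rw [← coe_s, mem_parabolic_iff, ReflectionCocycle.s_mem_par_iff]

theorem inv_subset_parabolic {I : Set D.S} {k : X ≃ₗ[ℝ] X} (hk : k ∈ D.parabolic I)
    {t : X ≃ₗ[ℝ] X} (ht : t ∈ D.inv k) : t ∈ D.parabolic I := by
  have hkW := D.parabolic_le I hk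
  have htW := D.mem_W_of_mem_R ht.1
  exact (D.mem_parabolic_iff I ⟨t, htW⟩).2
    (D.cocycle.N_subset_par ((D.mem_parabolic_iff I ⟨k, hkW⟩).1 hk) ht)

theorem mem_inv_coe (s : D.S) (t : X ≃ₗ[ℝ] X) : t ∈ D.inv s ↔ t = s := by
  constructor
  · intro h
    exact congrArg Subtype.val ((D.cocycle.mem_N_s ⟨t, D.mem_W_of_mem_R h.1⟩ s).1 h)
  · rintro rfl
    exact (D.cocycle.mem_N_s (D.cocycle.s s) s).2 rfl

theorem mem_inv_wI (I : Set D.S) (t : X ≃ₗ[ℝ] X) :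
    t ∈ D.inv (D.cocycle.wI I : D.W) ↔ t ∈ D.arr.R ∧ t ∈ D.parabolic I := by
  constructor
  · intro h
    exact ⟨h.1, D.inv_subset_parabolic ((D.mem_parabolic_iff I _).2 (D.cocycle.wI_mem I)) h⟩
  · rintro ⟨h1, h2⟩
    have h3 : (⟨t, D.mem_W_of_mem_R h1⟩ : D.W) ∈ D.cocycle.N (D.cocycle.wI I) := by
      rw [ReflectionCocycle.N_wI]
      exact ⟨(D.mem_refl_iff _).2 h1, (D.mem_parabolic_iff I _).1 h2⟩
    exact h3

theorem eq_of_inv_eq {g h : X ≃ₗ[ℝ] X} (hg : g ∈ D.W) (hh : h ∈ D.W)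
    (H : ∀ t, t ∈ D.inv g ↔ t ∈ D.inv h) : g = h := by
  have : (⟨g, hg⟩ : D.W) = ⟨h, hh⟩ := D.cocycle.N_injective (by
    ext t
    exact H t)
  exact congrArg Subtype.val this

theorem parabolic_univ : D.parabolic Set.univ = D.W := by
  rw [parabolic, Set.image_univ, Subtype.range_coe, closure_S]

/-- `g` conjugates `W_J` to `W_I`, and maps the fundamental chamber of `W_J` to that of `W_I`. -/
structure Carries (g : X ≃ₗ[ℝ] X) (J I : Set D.S) : Prop where
  normalizes : g ∈ Subgroup.normalizer (D.W : Set (X ≃ₗ[ℝ] X))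
  conj_mem : ∀ h, g⁻¹ * h * g ∈ D.parabolic J ↔ h ∈ D.parabolic I
  notMem_inv : ∀ t ∈ D.parabolic I, t ∉ D.inv g

variable {D} {g : X ≃ₗ[ℝ] X} {I J : Set D.S}

namespace Carries

theorem conj_mem' (hg : D.Carries g J I) {h : X ≃ₗ[ℝ] X} (hh : h ∈ D.parabolic J) :
    g * h * g⁻¹ ∈ D.parabolic I := by
  rw [← hg.conj_mem]
  convert hh using 1
  group

theorem symm (hg : D.Carries g J I) : D.Carries g⁻¹ I J where
  normalizes := inv_mem hg.normalizes
  conj_mem h := by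
    rw [← hg.conj_mem]
    apply iff_of_eq
    congr 1
    group
  notMem_inv t ht h := by
    have h1 := D.mem_inv_mul hg.normalizes (inv_mem hg.normalizes) (g * t * g⁻¹)
    rw [mul_inv_cancel] at h1
    have e : g⁻¹ * (g * t * g⁻¹) * g = t := by group
    rw [e] at h1
    have h2 := D.notMem_inv_one (g * t * g⁻¹)
    have h3 := hg.notMem_inv _ (hg.conj_mem' ht)
    tauto

theorem inv_conj (hg : D.Carries g J I) {k : X ≃ₗ[ℝ] X} (hk : k ∈ D.parabolic J)
    (t : X ≃ₗ[ℝ] X) : t ∈ D.inv (g * k * g⁻¹) ↔ g⁻¹ * t * g ∈ D.inv k := by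
  by_cases ht : t ∈ D.parabolic I
  · have hkN := D.mem_normalizer (D.parabolic_le J hk)
    have ht' := (hg.conj_mem t).2 ht
    have h1 := D.mem_inv_mul (mul_mem hg.normalizes hkN) (inv_mem hg.normalizes) t
    have h2 := D.mem_inv_mul hg.normalizes hkN t
    have h3 := hg.notMem_inv t ht
    have h4 := hg.symm.notMem_inv (k⁻¹ * (g⁻¹ * t * g) * k) (mul_mem (mul_mem (inv_mem hk) ht') hk)
    have e : (g * k)⁻¹ * t * (g * k) = k⁻¹ * (g⁻¹ * t * g) * k := by group
    rw [e] at h1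
    tauto
  · refine iff_of_false (fun h => ht ?_) (fun h => ht ?_)
    · exact D.inv_subset_parabolic (hg.conj_mem' hk) h
    · exact (hg.conj_mem t).1 (D.inv_subset_parabolic hk h)

/-- Because g matches the two chambers, the conjugate of s has a single inversion, and an element of
length one is simple. -/
theorem exists_eq (hg : D.Carries g J I) {s : D.S} (hs : s ∈ J) :
    ∃ t ∈ I, g * s * g⁻¹ = (t : D.S) := by
  have hsJ := D.coe_mem_parabolic hs
  have hW := D.parabolic_le I (hg.conj_mem' hsJ)
  have hN : D.cocycle.N ⟨g * s * g⁻¹, hW⟩ = {⟨g * s * g⁻¹, hW⟩} := by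
    ext t
    change (t : X ≃ₗ[ℝ] X) ∈ D.inv (g * s * g⁻¹) ↔ t = _
    rw [hg.inv_conj hsJ, mem_inv_coe, Subtype.ext_iff]
    change _ ↔ (t : X ≃ₗ[ℝ] X) = g * s * g⁻¹
    rw [eq_mul_inv_iff_mul_eq, mul_assoc, inv_mul_eq_iff_eq_mul]
  obtain ⟨t, ht⟩ := D.cocycle.eq_simple_of_len_eq_one
    (w := ⟨g * s * g⁻¹, hW⟩) (by rw [ReflectionCocycle.len, hN, Set.ncard_singleton])
  have ht' : g * s * g⁻¹ = (t : X ≃ₗ[ℝ] X) := congrArg Subtype.val ht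
  refine ⟨t, ?_, ht'⟩
  rw [← coe_mem_parabolic_iff, ← ht']
  exact hg.conj_mem' hsJ

theorem conj_wI (hg : D.Carries g J I) :
    g * (D.cocycle.wI J : D.W) * g⁻¹ = (D.cocycle.wI I : D.W) := by
  have hJ := (D.mem_parabolic_iff J _).2 (D.cocycle.wI_mem J)
  refine D.eq_of_inv_eq (D.parabolic_le I (hg.conj_mem' hJ)) (Subtype.coe_prop _) fun t => ?_
  rw [hg.inv_conj hJ, mem_inv_wI, mem_inv_wI, hg.conj_mem, D.conj_mem_arr_R hg.normalizes]

/-- Conjugation by an element permuting the generators carries lifts to lifts. -/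
theorem conj_L {Ψ : D.BSemi} (hg : D.Carries (D.im Ψ) J I)
    (hΨ : ∀ s ∈ J, ∃ t, Ψ * SemidirectProduct.inl (D.toB (D.gen s)) * Ψ⁻¹ =
      SemidirectProduct.inl (D.toB (D.gen t)))
    {u v : D.W} (hu : (u : X ≃ₗ[ℝ] X) ∈ D.parabolic J)
    (hv : (v : X ≃ₗ[ℝ] X) = D.im Ψ * u * (D.im Ψ)⁻¹) :
    Ψ * SemidirectProduct.inl (D.toB (D.cocycle.L D.coxeterMatrix u)) * Ψ⁻¹ =
      SemidirectProduct.inl (D.toB (D.cocycle.L D.coxeterMatrix v)) := by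
  have himinv : D.im Ψ⁻¹ = (D.im Ψ)⁻¹ := by
    rw [im, map_inv, SemidirectProduct.inv_right]; rfl
  obtain ⟨l, hlJ, rfl, hl⟩ :=
    D.cocycle.exists_reduced_of_mem_par ((D.mem_parabolic_iff J u).1 hu)
  induction l generalizing v with
  | nil =>
    have hv1 : v = 1 := Subtype.ext (by rw [hv]; simp)
    rw [hv1, ReflectionCocycle.word_nil, D.cocycle.L_one D.coxeterMatrix_eq]
    simp
  | cons i l ih =>
    have hlJ' : ∀ j ∈ l, j ∈ J := fun j hj => hlJ j (List.mem_cons_of_mem _ hj)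
    have hi : i ∈ J := hlJ i List.mem_cons_self
    have hword := (D.mem_parabolic_iff J _).2 (D.cocycle.word_mem_par hlJ')
    have hsub : D.cocycle.N (D.cocycle.s i) ⊆ D.cocycle.N (D.cocycle.s i * D.cocycle.word l) := by
      rw [ReflectionCocycle.N_s_subset_iff, ← ReflectionCocycle.word_cons]
      exact D.cocycle.s_mem_N_of_reduced hl.symm
    set v' : D.W := ⟨D.im Ψ * (D.cocycle.word l : D.W) * (D.im Ψ)⁻¹,
      D.parabolic_le I (hg.conj_mem' hword)⟩ with hv'
    have h1 := ih (v := v') hlJ' hword rfl (D.cocycle.len_tail_of_reduced hl.symm).symm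
    obtain ⟨j, hj⟩ := hΨ i hi
    have hj' : D.im Ψ * i * (D.im Ψ)⁻¹ = (j : X ≃ₗ[ℝ] X) := by
      have := congrArg D.im hj
      rwa [im_mul, im_mul, im_gen, im_gen, himinv] at this
    have hvj : v = D.cocycle.s j * v' := by
      apply Subtype.ext
      rw [hv, Subgroup.coe_mul, coe_s, ← hj', hv', ReflectionCocycle.word_cons, Subgroup.coe_mul,
        coe_s]
      group
    have hsub' : D.cocycle.N (D.cocycle.s j) ⊆ D.cocycle.N (D.cocycle.s j * v') := by
      rw [ReflectionCocycle.N_s_subset_iff, ← hvj]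
      change (j : X ≃ₗ[ℝ] X) ∈ D.inv v
      rw [hv, hg.inv_conj hu, ← hj']
      have e : (D.im Ψ)⁻¹ * (D.im Ψ * i * (D.im Ψ)⁻¹) * D.im Ψ = (i : X ≃ₗ[ℝ] X) := by group
      rw [e]
      exact D.cocycle.s_mem_N_of_reduced hl.symm
    rw [hvj, ReflectionCocycle.word_cons, D.cocycle.L_mul D.coxeterMatrix_eq hsub,
      D.cocycle.L_mul D.coxeterMatrix_eq hsub', D.cocycle.L_s D.coxeterMatrix_eq,
      D.cocycle.L_s D.coxeterMatrix_eq, map_mul, map_mul, map_mul, map_mul, ← h1]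
    change _ = SemidirectProduct.inl (D.toB (D.gen j)) * _
    rw [← hj]
    change Ψ * (SemidirectProduct.inl (D.toB (D.gen i)) * _) * _ = _
    group

end Carries

end RealReflectionCoset

namespace RealReflectionCoset

variable {X : Type*} [AddCommGroup X] [Module ℝ X] (D : RealReflectionCoset X)
  [FiniteDimensional ℝ X]

/-! ### Crossing numbers of roots of `π / π_I` -/

theorem im_inv (a : D.BSemi) : D.im a⁻¹ = (D.im a)⁻¹ := by
  rw [im, map_inv, SemidirectProduct.inv_right]; rfl

theorem piElt_eq (I : Set D.S) :
    D.piElt I = D.toB (D.cocycle.L D.coxeterMatrix (D.cocycle.wI I) ^ 2) := by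
  rw [piElt, longestLift_eq, map_pow]

theorem im_piElt (I : Set D.S) : D.im (SemidirectProduct.inl (D.piElt I)) = 1 := by
  rw [piElt, longestLift_eq, map_pow, im_pow, im_L, sq, ← Subgroup.coe_mul,
    ReflectionCocycle.wI_mul_self]
  rfl

theorem conj_mem_parabolic {I : Set D.S} {u : X ≃ₗ[ℝ] X} (hu : u ∈ D.parabolic I)
    (t : X ≃ₗ[ℝ] X) : u⁻¹ * t * u ∈ D.parabolic I ↔ t ∈ D.parabolic I := by
  rw [Subgroup.mul_mem_cancel_right _ hu, Subgroup.mul_mem_cancel_left _ (inv_mem hu)]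

open Classical in
theorem cr_piElt (I : Set D.S) (t : X ≃ₗ[ℝ] X) :
    D.cr (SemidirectProduct.inl (D.piElt I)) t =
      if t ∈ D.arr.R ∧ t ∈ D.parabolic I then 2 else 0 := by
  have hw := (D.mem_parabolic_iff I _).2 (D.cocycle.wI_mem I)
  rw [piElt, longestLift_eq, sq, map_mul, cr_mul, cr_L, cr_L, im_L, mem_inv_wI, mem_inv_wI,
    D.conj_mem_parabolic hw, D.conj_mem_arr_R (D.mem_normalizer (Subtype.coe_prop _))]
  split_ifs <;> norm_num

theorem im_piQuot (I : Set D.S) : D.im (SemidirectProduct.inl (D.piQuot I)) = 1 := by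
  rw [piQuot, map_mul, im_mul, im_piElt, map_inv, im_inv, im_piElt, inv_one, mul_one]

open Classical in
theorem cr_piQuot (I : Set D.S) (t : X ≃ₗ[ℝ] X) :
    D.cr (SemidirectProduct.inl (D.piQuot I)) t =
      if t ∈ D.arr.R ∧ t ∉ D.parabolic I then 2 else 0 := by
  have h : D.piQuot I * D.piElt I = D.piElt Set.univ := by rw [piQuot]; group
  have h1 := D.cr_piElt Set.univ t
  rw [← h, map_mul, cr_mul, im_piQuot, cr_piElt, parabolic_univ] at h1
  have e : (1 : X ≃ₗ[ℝ] X)⁻¹ * t * 1 = t := by group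
  rw [e] at h1
  have h2 : t ∈ D.arr.R → t ∈ D.W := D.mem_W_of_mem_R
  by_cases hR : t ∈ D.arr.R
  · by_cases hp : t ∈ D.parabolic I <;> simp_all
  · simp_all

theorem permS_pow_conj {d : ℕ} {I : Set D.S} (hI : D.IsStable d I) (t : X ≃ₗ[ℝ] X) :
    (D.φ ^ d)⁻¹ * t * D.φ ^ d ∈ D.parabolic I ↔ t ∈ D.parabolic I := by
  have h : (D.parabolic I).map (MulAut.conj (D.φ ^ d)).toMonoidHom = D.parabolic I := by
    rw [parabolic, MonoidHom.map_closure, ← Set.image_comp]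
    congr 1
    conv_rhs => rw [← hI, ← Set.image_comp]
    exact Set.image_congr fun s _ => (D.permS_pow d s).symm
  conv_rhs => rw [← h]
  constructor
  · intro ht
    refine ⟨_, ht, ?_⟩
    change D.φ ^ d * ((D.φ ^ d)⁻¹ * t * D.φ ^ d) * (D.φ ^ d)⁻¹ = t
    simp only [mul_assoc, mul_inv_cancel, mul_one, mul_inv_cancel_left]
  · rintro ⟨r, hr, rfl⟩
    change (D.φ ^ d)⁻¹ * (D.φ ^ d * r * (D.φ ^ d)⁻¹) * D.φ ^ d ∈ _
    have e : (D.φ ^ d)⁻¹ * (D.φ ^ d * r * (D.φ ^ d)⁻¹) * D.φ ^ d = r := by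
      simp only [mul_assoc, inv_mul_cancel, mul_one, inv_mul_cancel_left]
    rw [e]
    exact hr

theorem imageφ_normalizes (b : D.BraidMonoid) :
    D.imageφ b ∈ Subgroup.normalizer (D.W : Set (X ≃ₗ[ℝ] X)) :=
  mul_mem (D.mem_normalizer (D.imM_mem b)) D.normalizes

theorem mem_inv_imageφ (b : D.BraidMonoid) (t : X ≃ₗ[ℝ] X) :
    t ∈ D.inv (D.imageφ b) ↔ Odd (D.crM b t) := by
  rw [← mem_inv_imM_iff]
  have : (D.imageφ b) D.arr.x₀ = D.imM b D.arr.x₀ := by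
    change D.imM b (D.φ D.arr.x₀) = _
    rw [φ_x₀]
  rw [inv, inv, this]

theorem isOfFinOrder_of_pow_eq {T : X ≃ₗ[ℝ] X} {d : ℕ} (hd : 0 < d)
    (h : T ^ d = D.φ ^ d) : IsOfFinOrder T := by
  have h1 : IsOfFinOrder (T ^ d) := h ▸ D.finOrder.pow
  exact (isOfFinOrder_pow.1 h1).resolve_right hd.ne'

section Root

variable {D} {d : ℕ} {b : D.BraidMonoid} {I : Set D.S}

theorem IsRoot.image_pow (hroot : D.IsRoot d b I) : D.imageφ b ^ d = D.φ ^ d := by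
  have h := congrArg D.im hroot
  rwa [im_pow, im_mulφ, im_mul, im_pow, im_φSemi, im_piQuot, mul_one] at h

theorem IsRoot.isOfFinOrder (hd : 0 < d) (hroot : D.IsRoot d b I) : IsOfFinOrder (D.imageφ b) :=
  D.isOfFinOrder_of_pow_eq hd hroot.image_pow

-- Both sides of the root equation are read at the hyperplane of t. The shift by φ^d is harmless
-- because I is φ^d-stable.
open Classical in
theorem IsRoot.sum_crM (hI : D.IsStable d I) (hroot : D.IsRoot d b I) {t : X ≃ₗ[ℝ] X}
    (ht : t ∈ D.arr.R) :
    ∑ j ∈ Finset.range d, D.crM b ((D.imageφ b ^ j)⁻¹ * t * D.imageφ b ^ j) =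
      if t ∈ D.parabolic I then 0 else 2 := by
  have h : D.cr _ t = D.cr _ t := congrArg (fun a => D.cr a t) hroot
  rw [cr_pow, cr_mul, cr_φSemi_pow, im_pow, im_φSemi, cr_piQuot, im_mulφ, D.permS_pow_conj hI,
    D.conj_mem_arr_R (pow_mem D.normalizes d), zero_add] at h
  simp only [cr_mulφ] at h
  change ∑ j ∈ Finset.range d, D.crM b _ = _ at h
  rw [h]
  simp [ht]

theorem IsRoot.conj_mem_R (t : X ≃ₗ[ℝ] X) :
    (D.imageφ b)⁻¹ * t * D.imageφ b ∈ D.arr.R ↔ t ∈ D.arr.R :=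
  D.conj_mem_arr_R (D.imageφ_normalizes b)

/-- The crossing number at t is the term j = 0 of a sum of nonnegative terms that vanishes. -/
theorem IsRoot.crM_eq_zero (hd : 0 < d) (hI : D.IsStable d I) (hroot : D.IsRoot d b I)
    {t : X ≃ₗ[ℝ] X} (ht : t ∈ D.parabolic I) : D.crM b t = 0 := by
  by_contra hne
  have htR := D.mem_R_of_crM_ne_zero hne
  have h := hroot.sum_crM hI htR
  rw [if_pos ht, Finset.sum_eq_zero_iff_of_nonneg (fun j _ => D.crM_nonneg b _)] at h
  have := h 0 (Finset.mem_range.2 hd)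
  simp at this
  exact hne this

/-- If T⁻¹ t T left W_I, the crossing sum would jump from 0 to 2 when its window of length d is
shifted by one. The term that enters is at a φ^d-conjugate of t, so it is 0, and the one that leaves
is nonnegative. Finite order of T then gives the reverse inclusion of conjugates. -/
theorem IsRoot.carries (hd : 0 < d) (hI : D.IsStable d I) (hroot : D.IsRoot d b I) :
    D.Carries (D.imageφ b) I I := by
  set T := D.imageφ b with hT
  have h1 : ∀ t ∈ D.arr.R, t ∈ D.parabolic I → T⁻¹ * t * T ∈ D.parabolic I := by
    intro t ht htI
    have h2 := hroot.sum_crM hI ht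
    have h3 := hroot.sum_crM hI ((IsRoot.conj_mem_R (b := b) t).2 ht)
    rw [if_pos htI] at h2
    by_contra hcon
    rw [if_neg hcon] at h3
    have h4 := Finset.sum_range_succ (fun j => D.crM b ((T ^ j)⁻¹ * t * T ^ j)) d
    have h5 := Finset.sum_range_succ' (fun j => D.crM b ((T ^ j)⁻¹ * t * T ^ j)) d
    have h6 : ∑ j ∈ Finset.range d, D.crM b ((T ^ (j + 1))⁻¹ * t * T ^ (j + 1)) =
        ∑ j ∈ Finset.range d, D.crM b ((T ^ j)⁻¹ * (T⁻¹ * t * T) * T ^ j) := by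
      refine Finset.sum_congr rfl fun j _ => ?_
      congr 1
      rw [pow_succ', mul_inv_rev]
      simp only [mul_assoc]
    have h7 : D.crM b ((T ^ d)⁻¹ * t * T ^ d) = 0 := by
      rw [hroot.image_pow]
      exact hroot.crM_eq_zero hd hI ((D.permS_pow_conj hI t).2 htI)
    have h8 := D.crM_nonneg b ((T ^ 0)⁻¹ * t * T ^ 0)
    rw [h6, h3] at h5
    rw [h2, h7] at h4
    omega
  have h2 : ∀ p ∈ D.parabolic I, T⁻¹ * p * T ∈ D.parabolic I := by
    intro p hp
    have : D.parabolic I ≤ (D.parabolic I).comap (MulAut.conj T⁻¹).toMonoidHom := by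
      conv_lhs => rw [parabolic]
      rw [Subgroup.closure_le]
      rintro _ ⟨s, hs, rfl⟩
      have := h1 s (D.coe_mem_R s) (D.coe_mem_parabolic hs)
      simpa using this
    simpa using this hp
  have h3 : ∀ k : ℕ, ∀ p ∈ D.parabolic I, (T ^ k)⁻¹ * p * T ^ k ∈ D.parabolic I := by
    intro k
    induction k with
    | zero => intro p hp; simpa using hp
    | succ k ih =>
      intro p hp
      have := h2 _ (ih p hp)
      convert this using 1
      rw [pow_succ]
      group
  refine ⟨D.imageφ_normalizes b, fun h => ⟨fun hh => ?_, h2 h⟩, fun t ht h => ?_⟩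
  · obtain ⟨n, hn, hTn⟩ := isOfFinOrder_iff_pow_eq_one.1 (hroot.isOfFinOrder hd)
    obtain ⟨n, rfl⟩ : ∃ m, n = m + 1 := ⟨n - 1, by omega⟩
    have h4 := h3 n _ hh
    have h5 : (T ^ n)⁻¹ = T := by
      rw [inv_eq_iff_mul_eq_one, ← pow_succ]; exact hTn
    rw [h5] at h4
    convert h4 using 1
    rw [← inv_inv (T ^ n), h5]
    group
  · rw [mem_inv_imageφ, hroot.crM_eq_zero hd hI ht] at h
    simp at h

end Root

/-! ### Commutation of the root with the generators of `W_I` -/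

/-- The number of letters of a positive braid. -/
def lenM : D.BraidMonoid →* Multiplicative ℕ :=
  PresentedMonoid.lift (fun _ => Multiplicative.ofAdd 1) (ReflectionCocycle.lift_eq_of_alt (by
    intro i j
    simp [ReflectionCocycle.alt_length]))

theorem lenM_gen (s : D.S) : D.lenM (D.gen s) = Multiplicative.ofAdd 1 := rfl

theorem eq_one_or (a : D.BraidMonoid) : a = 1 ∨ ∃ i c, a = D.gen i * c := by
  induction a using ReflectionCocycle.artin_induction with
  | one => exact Or.inl rfl
  | gen_mul i a _ => exact Or.inr ⟨i, a, rfl⟩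

theorem toAdd_lenM_pos {a : D.BraidMonoid} (ha : a ≠ 1) : 0 < (D.lenM a).toAdd := by
  obtain ⟨i, c, rfl⟩ := (D.eq_one_or a).resolve_left ha
  rw [map_mul, lenM_gen, toAdd_mul, toAdd_ofAdd]
  omega

theorem imM_one : D.imM 1 = 1 := by rw [imM, map_one, map_one]

/-- The first letter j of x is itself crossed, hence lies in K. Conjugation by j then preserves both
the condition on crossings and W_K, so induction applies to the rest. -/
theorem mem_parabolic_of_crM {K : Set D.S} {v : X ≃ₗ[ℝ] X} {P : Subgroup (X ≃ₗ[ℝ] X)}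
    (hK : ∀ j : D.S, v * j * v⁻¹ ∈ P → j ∈ K) (x : D.BraidMonoid)
    (hx : ∀ r, D.crM x r ≠ 0 → v * r * v⁻¹ ∈ P) :
    ∀ r, D.crM x r ≠ 0 → r ∈ D.parabolic K := by
  induction x using ReflectionCocycle.artin_induction with
  | one => intro r hr; exact absurd (D.crM_one r) hr
  | gen_mul j a ih =>
    change ∀ r, D.crM (D.gen j * a) r ≠ 0 → _ at hx
    change ∀ r, D.crM (D.gen j * a) r ≠ 0 → _
    have hj : v * j * v⁻¹ ∈ P := by
      apply hx
      have := D.crM_nonneg a ((j : X ≃ₗ[ℝ] X)⁻¹ * j * j)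
      rw [crM_mul, crM_gen, imM_gen, if_pos rfl]
      omega
    have hjK : (j : X ≃ₗ[ℝ] X) ∈ D.parabolic K := D.coe_mem_parabolic (hK j hj)
    have ih' := ih (fun r hr => by
      have h1 : D.crM (D.gen j * a) (j * r * (j : X ≃ₗ[ℝ] X)⁻¹) ≠ 0 := by
        have h2 := D.crM_nonneg (D.gen j) (j * r * (j : X ≃ₗ[ℝ] X)⁻¹)
        have h3 := D.crM_nonneg a r
        have e : (j : X ≃ₗ[ℝ] X)⁻¹ * (j * r * (j : X ≃ₗ[ℝ] X)⁻¹) * j = r := by group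
        rw [crM_mul, imM_gen, e]
        omega
      have h2 := hx _ h1
      have e : v * r * v⁻¹ = (v * j * v⁻¹)⁻¹ * (v * (j * r * (j : X ≃ₗ[ℝ] X)⁻¹) * v⁻¹) *
        (v * j * v⁻¹) := by group
      rw [e]
      exact mul_mem (mul_mem (inv_mem hj) h2) hj)
    intro r hr
    rw [crM_mul, crM_gen, imM_gen] at hr
    by_cases hrj : r = j
    · rw [hrj]; exact hjK
    · rw [if_neg hrj, zero_add] at hr
      exact (D.conj_mem_parabolic hjK r).1 (ih' _ hr)

/-- This lifts the conjugation from W to the monoid. Induction removes the head v of w: v transports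
W_I to a standard parabolic W_K, and the hypotheses pass to the remaining factor with K in place of
I. In the application z is a power of π_I. -/
theorem gen_conj {z w c : D.BraidMonoid} {I : Set D.S} (h : z * w = w * c) (hz : D.imM z = 1)
    (hzc : ∀ t, D.crM z t ≠ 0 ↔ t ∈ D.arr.R ∧ t ∈ D.parabolic I)
    (hw : ∀ t ∈ D.parabolic I, D.crM w t = 0) {s : D.S} (hs : s ∈ I) :
    ∃ t, D.gen s * w = w * D.gen t := by
  induction hn : (D.lenM w).toAdd using Nat.strong_induction_on generalizing z w c I s with
  | _ n ih =>
  have hM := D.coxeterMatrix_eq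
  rcases D.eq_one_or w with rfl | ⟨i, a, hia⟩
  · exact ⟨s, by simp⟩
  set v := D.cocycle.head hM w with hv
  have hv1 : v ≠ 1 := by
    intro h1
    have h2 := D.cocycle.subset_head_L_mul hM (D.cocycle.s i) a
    rw [D.cocycle.L_s hM] at h2
    change _ ⊆ D.cocycle.N (D.cocycle.head hM (D.gen i * a)) at h2
    rw [← hia, ← hv, h1, ReflectionCocycle.N_s_subset_iff, ReflectionCocycle.N_one] at h2
    exact h2
  obtain ⟨w', hw'⟩ := D.cocycle.L_head_dvd hM w
  rw [← hv] at hw'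
  -- The braid z * w = w * c is left divisible by v, and its head is that of z * L v. Hence v
  -- already divides z * L v.
  obtain ⟨c', hc'⟩ : ∃ c', z * D.cocycle.L D.coxeterMatrix v = D.cocycle.L D.coxeterMatrix v * c' := by
    have h1 := D.cocycle.subset_head_L_mul hM v (w' * c)
    rw [← mul_assoc, ← hw', ← h, D.cocycle.head_mul, ← hv] at h1
    obtain ⟨p, hp⟩ := D.cocycle.dvd_of_subset hM h1
    obtain ⟨q, hq⟩ := D.cocycle.L_head_dvd hM (z * D.cocycle.L D.coxeterMatrix v)
    exact ⟨p * q, by rw [hq, hp, mul_assoc]⟩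
  have hrec : c' * w' = w' * c := by
    apply D.cocycle.artin_mul_left_cancel hM (D.cocycle.L D.coxeterMatrix v)
    rw [← mul_assoc, ← hc', mul_assoc, ← hw', h, ← mul_assoc, ← hw']
  have himv := D.imM_L v
  have himc' : D.imM c' = 1 := by
    have := congrArg D.imM hc'
    rw [imM_mul, imM_mul, hz, one_mul] at this
    exact (mul_eq_left.1 this.symm)
  have hcrc' : ∀ r, D.crM c' r = D.crM z ((v : X ≃ₗ[ℝ] X) * r * (v : X ≃ₗ[ℝ] X)⁻¹) := by
    intro r
    have h1 := congrArg (fun a => D.crM a ((v : X ≃ₗ[ℝ] X) * r * (v : X ≃ₗ[ℝ] X)⁻¹)) hc'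
    simp only [crM_mul, hz, himv] at h1
    have e : (v : X ≃ₗ[ℝ] X)⁻¹ * ((v : X ≃ₗ[ℝ] X) * r * (v : X ≃ₗ[ℝ] X)⁻¹) * v = r := by group
    rw [e] at h1
    simp only [inv_one, one_mul, mul_one] at h1
    omega
  -- The braid c' crosses only the v⁻¹-conjugates of hyperplanes of W_I, and `mem_parabolic_of_crM`
  -- places them in W_K. This is what makes v⁻¹ W_I v standard.
  set K : Set D.S := {j | (v : X ≃ₗ[ℝ] X) * j * (v : X ≃ₗ[ℝ] X)⁻¹ ∈ D.parabolic I} with hK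
  have hKpar : ∀ r, D.crM c' r ≠ 0 → r ∈ D.parabolic K :=
    D.mem_parabolic_of_crM (P := D.parabolic I) (v := v) (fun j hj => hj) c' (fun r hr => by
      rw [hcrc'] at hr
      exact ((hzc _).1 hr).2)
  have hsplit : ∀ t, D.crM w t = D.crM (D.cocycle.L D.coxeterMatrix v) t +
      D.crM w' ((v : X ≃ₗ[ℝ] X)⁻¹ * t * v) := by
    intro t
    conv_lhs => rw [hw']
    rw [crM_mul, himv]
  have hcar : D.Carries (v : X ≃ₗ[ℝ] X) K I := by
    refine ⟨D.mem_normalizer v.2, fun p => ⟨fun hp => ?_, fun hp => ?_⟩, fun t ht ht' => ?_⟩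
    · have : D.parabolic K ≤ (D.parabolic I).comap (MulAut.conj (v : X ≃ₗ[ℝ] X)).toMonoidHom := by
        rw [parabolic, Subgroup.closure_le]
        rintro _ ⟨j, hj, rfl⟩
        exact hj
      have h1 : (v : X ≃ₗ[ℝ] X) * ((v : X ≃ₗ[ℝ] X)⁻¹ * p * v) * (v : X ≃ₗ[ℝ] X)⁻¹ ∈ D.parabolic I :=
        this hp
      simpa only [mul_assoc, mul_inv_cancel, mul_one, mul_inv_cancel_left] using h1
    · have : D.parabolic I ≤
          (D.parabolic K).comap (MulAut.conj (v : X ≃ₗ[ℝ] X)⁻¹).toMonoidHom := by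
        conv_lhs => rw [parabolic]
        rw [Subgroup.closure_le]
        rintro _ ⟨j, hj, rfl⟩
        change (v : X ≃ₗ[ℝ] X)⁻¹ * j * (v : X ≃ₗ[ℝ] X)⁻¹⁻¹ ∈ D.parabolic K
        rw [inv_inv]
        apply hKpar
        rw [hcrc']
        have e : (v : X ≃ₗ[ℝ] X) * ((v : X ≃ₗ[ℝ] X)⁻¹ * j * v) * (v : X ≃ₗ[ℝ] X)⁻¹ = j := by group
        rw [e, hzc]
        exact ⟨D.coe_mem_R j, D.coe_mem_parabolic hj⟩
      have := this hp
      change (v : X ≃ₗ[ℝ] X)⁻¹ * p * (v : X ≃ₗ[ℝ] X)⁻¹⁻¹ ∈ D.parabolic K at this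
      rwa [inv_inv] at this
    · have h1 := hw t ht
      rw [hsplit, crM_L, if_pos ht'] at h1
      have := D.crM_nonneg w' ((v : X ≃ₗ[ℝ] X)⁻¹ * t * v)
      omega
  obtain ⟨j, hjK, hj⟩ := hcar.symm.exists_eq hs
  rw [inv_inv] at hj
  have hvs : D.cocycle.s s * v = v * D.cocycle.s j := by
    apply Subtype.ext
    rw [Subgroup.coe_mul, Subgroup.coe_mul, coe_s, coe_s, ← hj]
    group
  have hcomm : D.gen s * D.cocycle.L D.coxeterMatrix v = D.cocycle.L D.coxeterMatrix v * D.gen j := by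
    have h1 : D.cocycle.s s ∉ D.cocycle.N v := fun h =>
      hcar.notMem_inv s (D.coe_mem_parabolic hs) h
    have h2 : D.cocycle.N (D.cocycle.s s) ⊆ D.cocycle.N (D.cocycle.s s * v) := by
      rwa [ReflectionCocycle.N_s_subset_iff, ReflectionCocycle.s_mem_N_s_mul]
    have h3 : D.cocycle.N v ⊆ D.cocycle.N (v * D.cocycle.s j) := by
      apply D.cocycle.subset_of_len_mul
      rw [← hvs, D.cocycle.len_s_mul_of_notMem h1, ReflectionCocycle.len_s]
    have h4 := D.cocycle.L_mul hM h2
    have h5 := D.cocycle.L_mul hM h3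
    rw [hvs, h5, D.cocycle.L_s hM, D.cocycle.L_s hM] at h4
    exact h4.symm
  have hlt : (D.lenM w').toAdd < n := by
    have h1 : D.cocycle.L D.coxeterMatrix v ≠ 1 := by
      intro h1
      rw [h1, imM_one] at himv
      exact hv1 (Subtype.ext himv.symm)
    have h2 := D.toAdd_lenM_pos h1
    rw [← hn, hw', map_mul, toAdd_mul]
    omega
  obtain ⟨t, ht⟩ := ih _ hlt hrec himc' (I := K) (fun r => by
      have h1 := D.conj_mem_arr_R (D.mem_normalizer (inv_mem v.2)) (t := r)
      have h2 := hcar.symm.conj_mem r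
      rw [inv_inv] at h1 h2
      rw [hcrc', hzc, h1, h2]) (fun r hr => by
      have h1 := hw _ (hcar.conj_mem' hr)
      rw [hsplit] at h1
      have e : (v : X ≃ₗ[ℝ] X)⁻¹ * ((v : X ≃ₗ[ℝ] X) * r * (v : X ≃ₗ[ℝ] X)⁻¹) * v = r := by group
      rw [e] at h1
      have h2 := D.crM_nonneg (D.cocycle.L D.coxeterMatrix v)
        ((v : X ≃ₗ[ℝ] X) * r * (v : X ≃ₗ[ℝ] X)⁻¹)
      have h3 := D.crM_nonneg w' r
      omega) hjK rfl
  exact ⟨t, by rw [hw', ← mul_assoc, hcomm, mul_assoc, ht, mul_assoc]⟩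

end RealReflectionCoset

/-! ### Conjugation by a root in the braid group: assertion (i) -/

namespace RealReflectionCoset

variable {X : Type*} [AddCommGroup X] [Module ℝ X] (D : RealReflectionCoset X)
  [FiniteDimensional ℝ X]

theorem φSemi_pow_conj_gen (k : ℕ) (s : D.S) :
    D.φSemi ^ k * SemidirectProduct.inl (D.toB (D.gen s)) * (D.φSemi ^ k)⁻¹ =
      SemidirectProduct.inl (D.toB (D.gen ((D.permS ^ k) s))) := by
  rw [mul_inv_eq_iff_eq_mul, Φ_mul_inl]
  congr 2
  induction k with
  | zero => rfl
  | succ k ih =>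
    rw [pow_succ', MulAut.mul_apply, ih, φB_gen, pow_succ', Equiv.Perm.mul_apply]

theorem φ_pow_x₀ (k : ℕ) : (D.φ ^ k) D.arr.x₀ = D.arr.x₀ := by
  induction k with
  | zero => rfl
  | succ k ih => rw [pow_succ', LinearEquiv.mul_apply, ih, φ_x₀]

theorem carries_φ_pow {k : ℕ} {I : Set D.S} (hI : D.IsStable k I) : D.Carries (D.φ ^ k) I I where
  normalizes := pow_mem D.normalizes k
  conj_mem := D.permS_pow_conj hI
  notMem_inv t _ h := by
    have h2 := h.2
    rw [φ_pow_x₀] at h2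
    exact h2.not_gt (ReflectionArrangement.F_pos h.1)

theorem commute_φSemi_pow_piElt {k : ℕ} {I : Set D.S} (hI : D.IsStable k I) :
    Commute (D.φSemi ^ k) (SemidirectProduct.inl (D.piElt I)) := by
  have him : D.im (D.φSemi ^ k) = D.φ ^ k := by rw [im_pow, im_φSemi]
  have hc : D.Carries (D.im (D.φSemi ^ k)) I I := by rw [him]; exact D.carries_φ_pow hI
  have h := hc.conj_L (fun s _ => ⟨_, D.φSemi_pow_conj_gen k s⟩)
    (u := D.cocycle.wI I) (v := D.cocycle.wI I)
    ((D.mem_parabolic_iff I _).2 (D.cocycle.wI_mem I)) hc.conj_wI.symm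
  rw [piElt, longestLift_eq, map_pow]
  exact Commute.pow_right (mul_inv_eq_iff_eq_mul.1 h) 2

theorem isStable_univ (k : ℕ) : D.IsStable k Set.univ := by
  rw [IsStable, Set.image_univ, Equiv.range_eq_univ]

theorem commute_inl_pi (a : D.BraidMonoid) :
    Commute (SemidirectProduct.inl (D.toB a) : D.BSemi)
      (SemidirectProduct.inl (D.piElt Set.univ)) := by
  have h := D.cocycle.commute_pi D.coxeterMatrix_eq a
  rw [← ReflectionCocycle.wI_univ] at h
  rw [piElt_eq]
  exact (h.map D.toB).map SemidirectProduct.inl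

theorem commute_φSemi_pow {n : ℕ} (hn : D.φ ^ n = 1) (a : D.BraidMonoid) :
    Commute (D.φSemi ^ n) (SemidirectProduct.inl (D.toB a)) := by
  induction a using ReflectionCocycle.artin_induction with
  | one => rw [map_one, map_one]; exact Commute.one_right _
  | gen_mul i a ih =>
    rw [map_mul, map_mul]
    refine Commute.mul_right ?_ ih
    have h := D.φSemi_pow_conj_gen n i
    have h2 : (D.permS ^ n) i = i := Subtype.ext (by rw [permS_pow, hn]; simp)
    rw [h2] at h
    exact mul_inv_eq_iff_eq_mul.1 h

theorem toB_longestLift_pow (I : Set D.S) (n : ℕ) :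
    D.toB (D.longestLift I ^ (2 * n)) = D.piElt I ^ n := by
  rw [piElt, pow_mul, map_pow, map_pow]

section Root

variable {D} {d : ℕ} {b : D.BraidMonoid} {I : Set D.S}

/-- Solving the n-th power of the root equation for π_I^n expresses it through powers of wφ, φ^(dn)
and π. All of these commute with wφ once φ^n = 1, because φ^n is then central against B⁺. -/
theorem IsRoot.exists_commute (hI : D.IsStable d I) (hroot : D.IsRoot d b I) :
    ∃ n, 0 < n ∧ Commute (D.mulφ b) (SemidirectProduct.inl (D.piElt I ^ n)) := by
  obtain ⟨n, hn, hφn⟩ := isOfFinOrder_iff_pow_eq_one.1 D.finOrder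
  refine ⟨n, hn, ?_⟩
  have hr : D.mulφ b ^ d = D.φSemi ^ d * (SemidirectProduct.inl (D.piElt Set.univ) *
      (SemidirectProduct.inl (D.piElt I))⁻¹) := by
    rw [← map_inv, ← map_mul]; exact hroot
  set P : D.BSemi := SemidirectProduct.inl (D.piElt Set.univ) with hP
  have hbP : Commute (SemidirectProduct.inl (D.toB b)) P := D.commute_inl_pi b
  have hΦP := D.commute_φSemi_pow_piElt (D.isStable_univ d)
  have hΦP1 := D.commute_φSemi_pow_piElt (D.isStable_univ 1)
  rw [pow_one] at hΦP1
  have hΦQ := D.commute_φSemi_pow_piElt hI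
  have hQP : Commute (SemidirectProduct.inl (D.piElt I)) P := by
    rw [D.piElt_eq I]; exact D.commute_inl_pi _
  have hΦb := D.commute_φSemi_pow hφn b
  rw [map_pow]
  set Q : D.BSemi := SemidirectProduct.inl (D.piElt I) with hQ
  have h1 : (D.mulφ b ^ d) ^ n = (D.φSemi ^ d) ^ n * (P ^ n * (Q ^ n)⁻¹) := by
    rw [hr, (hΦP.mul_right hΦQ.inv_right).mul_pow, hQP.symm.inv_right.mul_pow, inv_pow]
  have h2 : Q ^ n = ((D.mulφ b ^ d) ^ n)⁻¹ * ((D.φSemi ^ d) ^ n * P ^ n) := by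
    rw [h1]; group
  have hψP : Commute (D.mulφ b) P := hbP.mul_left hΦP1
  have hψΦ : Commute (D.mulφ b) ((D.φSemi ^ d) ^ n) := by
    rw [← pow_mul, mul_comm d n, pow_mul]
    exact (hΦb.symm.pow_right d).mul_left (((Commute.refl D.φSemi).pow_right n).pow_right d)
  rw [h2]
  exact (((Commute.refl _).pow_right d).pow_right n).inv_right.mul_right
    (hψΦ.mul_right (hψP.pow_right n))

/-- A power of π_I is pure and crosses exactly the hyperplanes of W_I. Moving φ across the
commutation relation, and using that B⁺ embeds in B, puts it in the form required by the monoid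
version of `gen_conj`. -/
theorem IsRoot.gen_conj (hd : 0 < d) (hI : D.IsStable d I) (hroot : D.IsRoot d b I) {s : D.S}
    (hs : s ∈ I) : ∃ t, D.gen s * b = b * D.gen t := by
  classical
  obtain ⟨n, hn, hcomm⟩ := hroot.exists_commute hI
  rw [← D.toB_longestLift_pow] at hcomm
  obtain ⟨c, hc⟩ := D.exists_toB_φB (D.longestLift I ^ (2 * n))
  set z := D.longestLift I ^ (2 * n) with hz
  have h1 : z * b = b * c := by
    apply D.toB_injective
    apply SemidirectProduct.inl_injective (φ := zpowersHom (MulAut D.BraidGroup) D.φB)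
    have h2 := D.Φ_mul_inl 1 (D.toB z)
    rw [pow_one, pow_one, hc] at h2
    have h3 := hcomm.eq
    rw [mulφ, mul_assoc, h2, ← mul_assoc, ← mul_assoc] at h3
    rw [map_mul, map_mul, map_mul, map_mul]
    exact (mul_right_cancel h3).symm
  have hpow : ∀ k : ℕ, D.im (SemidirectProduct.inl (D.piElt I ^ k)) = 1 := fun k => by
    rw [map_pow, im_pow, im_piElt, one_pow]
  have himz : D.imM z = 1 := by rw [imM, ← im_inl, hz, toB_longestLift_pow, hpow]
  have hcr : ∀ t, D.crM z t ≠ 0 ↔ t ∈ D.arr.R ∧ t ∈ D.parabolic I := by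
    intro t
    rw [crM, hz, toB_longestLift_pow, map_pow, cr_pow]
    simp only [im_piElt, one_pow, inv_one, one_mul, mul_one, cr_piElt, Finset.sum_const,
      Finset.card_range]
    split_ifs with h <;> simp [h, hn.ne']
  exact D.gen_conj h1 himz hcr (fun t ht => hroot.crM_eq_zero hd hI ht) hs

theorem IsRoot.exists_conj (hd : 0 < d) (hI : D.IsStable d I) (hroot : D.IsRoot d b I) {t : D.S}
    (ht : t ∈ I) : ∃ s ∈ I, D.mulφ b * SemidirectProduct.inl (D.toB (D.gen s)) * (D.mulφ b)⁻¹ =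
      SemidirectProduct.inl (D.toB (D.gen t)) := by
  obtain ⟨t', ht'⟩ := hroot.gen_conj hd hI ht
  have h1 : D.mulφ b * SemidirectProduct.inl (D.toB (D.gen (D.permS.symm t'))) * (D.mulφ b)⁻¹ =
      SemidirectProduct.inl (D.toB (D.gen t)) := by
    have h2 := D.φSemi_pow_conj_gen 1 (D.permS.symm t')
    rw [pow_one, pow_one, Equiv.apply_symm_apply, mul_inv_eq_iff_eq_mul] at h2
    rw [mul_inv_eq_iff_eq_mul, mulφ, mul_assoc, h2, ← mul_assoc, ← map_mul, ← map_mul, ← ht',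
      map_mul, map_mul, mul_assoc]
  refine ⟨_, ?_, h1⟩
  have h3 := congrArg D.im h1
  rw [im_mul, im_mul, im_inv, im_mulφ, im_gen, im_gen] at h3
  have h4 := D.coe_mem_parabolic ht
  rw [← h3, ← (hroot.carries hd hI).conj_mem] at h4
  rw [← coe_mem_parabolic_iff]
  convert h4 using 1
  group

theorem IsRoot.exists_conj' (hd : 0 < d) (hI : D.IsStable d I) (hroot : D.IsRoot d b I) {s : D.S}
    (hs : s ∈ I) : ∃ t ∈ I, D.mulφ b * SemidirectProduct.inl (D.toB (D.gen s)) * (D.mulφ b)⁻¹ =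
      SemidirectProduct.inl (D.toB (D.gen t)) := by
  obtain ⟨t, ht, h⟩ := (hroot.carries hd hI).exists_eq hs
  obtain ⟨s', hs', h'⟩ := hroot.exists_conj hd hI ht
  have h3 := congrArg D.im h'
  rw [im_mul, im_mul, im_inv, im_mulφ, im_gen, im_gen, ← h] at h3
  have : s' = s := Subtype.ext (by simpa using h3)
  exact ⟨t, ht, this ▸ h'⟩

/-- The root normalizes the lift of `I`. -/
theorem IsRoot.image_boldSet (hd : 0 < d) (hI : D.IsStable d I) (hroot : D.IsRoot d b I) :
    (fun x => D.mulφ b * x * (D.mulφ b)⁻¹) '' D.boldSet I = D.boldSet I := by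
  ext x
  constructor
  · rintro ⟨_, ⟨s, hs, rfl⟩, rfl⟩
    obtain ⟨t, ht, h⟩ := hroot.exists_conj' hd hI hs
    exact ⟨t, ht, h.symm⟩
  · rintro ⟨t, ht, rfl⟩
    obtain ⟨s, hs, h⟩ := hroot.exists_conj hd hI ht
    exact ⟨_, ⟨s, hs, rfl⟩, h⟩

/-- Conjugation by the root on lifts of elements of `W_I`. -/
theorem IsRoot.conj_L (hd : 0 < d) (hI : D.IsStable d I) (hroot : D.IsRoot d b I)
    {u v : D.W} (hu : (u : X ≃ₗ[ℝ] X) ∈ D.parabolic I)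
    (hv : (v : X ≃ₗ[ℝ] X) = D.imageφ b * u * (D.imageφ b)⁻¹) :
    D.mulφ b * SemidirectProduct.inl (D.toB (D.cocycle.L D.coxeterMatrix u)) * (D.mulφ b)⁻¹ =
      SemidirectProduct.inl (D.toB (D.cocycle.L D.coxeterMatrix v)) := by
  have hc := hroot.carries hd hI
  rw [← im_mulφ] at hc hv
  refine hc.conj_L (fun s hs => ?_) hu hv
  obtain ⟨t, -, h⟩ := hroot.exists_conj' hd hI hs
  exact ⟨t, h⟩

end Root

end RealReflectionCoset

/-! ### Real parts and complexified linear forms -/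

section Complexification

variable {X : Type*} [AddCommGroup X] [Module ℝ X]

/-- The real part of a vector of the complexification. -/
def complexRe : ℂ ⊗[ℝ] X →ₗ[ℝ] X :=
  (TensorProduct.lid ℝ X).toLinearMap ∘ₗ LinearMap.rTensor X Complex.reLm

@[simp] theorem complexRe_tmul (c : ℂ) (x : X) : complexRe (c ⊗ₜ[ℝ] x) = c.re • x := by
  simp [complexRe]

/-- The complex-linear extension of a real linear form. -/
def complexForm (f : Module.Dual ℝ X) : ℂ ⊗[ℝ] X →ₗ[ℂ] ℂ :=
  (TensorProduct.AlgebraTensorModule.rid ℝ ℂ ℂ).toLinearMap ∘ₗ LinearMap.baseChange ℂ f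

@[simp] theorem complexForm_tmul (f : Module.Dual ℝ X) (c : ℂ) (x : X) :
    complexForm f (c ⊗ₜ[ℝ] x) = c * f x := by
  simp [complexForm, mul_comm]

theorem complexForm_re (f : Module.Dual ℝ X) (z : ℂ ⊗[ℝ] X) :
    (complexForm f z).re = f (complexRe z) := by
  induction z using TensorProduct.induction_on with
  | zero => simp
  | tmul c x => simp
  | add a b ha hb => simp [ha, hb]

namespace RealReflectionCoset

@[simp] theorem complexify_tmul (g : X ≃ₗ[ℝ] X) (c : ℂ) (x : X) :
    complexify g (c ⊗ₜ[ℝ] x) = c ⊗ₜ[ℝ] g x := rfl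

theorem complexRe_complexify (g : X ≃ₗ[ℝ] X) (z : ℂ ⊗[ℝ] X) :
    complexRe (complexify g z) = g (complexRe z) := by
  induction z using TensorProduct.induction_on with
  | zero => simp
  | tmul c x => simp
  | add a b ha hb => simp [ha, hb]

end RealReflectionCoset

namespace ReflectionArrangement

open RealReflectionCoset

variable {A : ReflectionArrangement X} {t : X ≃ₗ[ℝ] X}

theorem complexify_apply (ht : t ∈ A.R) (z : ℂ ⊗[ℝ] X) :
    complexify t z = z - complexForm (A.F t) z • (1 ⊗ₜ[ℝ] A.root t) := by
  induction z using TensorProduct.induction_on with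
  | zero => simp
  | tmul c x =>
    rw [complexify_tmul, reflection_apply ht, TensorProduct.tmul_sub, complexForm_tmul,
      TensorProduct.smul_tmul', smul_eq_mul, mul_one, TensorProduct.tmul_smul,
      TensorProduct.smul_tmul', Complex.real_smul, mul_comm]
  | add a b ha hb =>
    rw [map_add, ha, hb, map_add, add_smul]
    abel

theorem complexify_eq_iff (ht : t ∈ A.R) (z : ℂ ⊗[ℝ] X) :
    complexify t z = z ↔ complexForm (A.F t) z = 0 := by
  rw [complexify_apply ht, sub_eq_self]
  constructor
  · intro h
    have := congrArg (complexForm (A.F t)) h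
    rw [map_smul, complexForm_tmul, F_root ht, map_zero] at this
    simpa using this
  · intro h
    rw [h, zero_smul]

end ReflectionArrangement

end Complexification

/-! ### Eigenvector projections and stabilizers of vectors -/

namespace RealReflectionCoset

variable {X : Type*} [AddCommGroup X] [Module ℝ X] (D : RealReflectionCoset X)

theorem mem_fixedSpace {I : Set D.S} {z : ℂ ⊗[ℝ] X} :
    z ∈ D.fixedSpace I ↔ ∀ u ∈ D.parabolic I, complexify u z = z := by
  simp [fixedSpace, Submodule.mem_iInf, sub_eq_zero]

/-- Projection of a real vector of finite period to an eigenspace, up to a factor. -/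
def eigenSum (T : X ≃ₗ[ℝ] X) (ζ : ℂ) (L : ℕ) (y : X) : ℂ ⊗[ℝ] X :=
  ∑ k ∈ Finset.range L, (ζ⁻¹ ^ k) ⊗ₜ[ℝ] (T ^ k) y

theorem complexForm_eigenSum (f : Module.Dual ℝ X) (T : X ≃ₗ[ℝ] X) (ζ : ℂ) (L : ℕ) (y : X) :
    complexForm f (eigenSum T ζ L y) = ∑ k ∈ Finset.range L, ζ⁻¹ ^ k * f ((T ^ k) y) := by
  simp [eigenSum]

theorem eigenSum_mem_eigenspace {T : X ≃ₗ[ℝ] X} {ζ : ℂ} (hζ : ζ ≠ 0) {L : ℕ} {y : X}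
    (hL : ζ ^ L = 1) (hy : (T ^ L) y = y) :
    eigenSum T ζ L y ∈ Module.End.eigenspace (complexify T) ζ := by
  rw [Module.End.mem_eigenspace_iff]
  have h1 := Finset.sum_range_succ (fun k => (ζ⁻¹ ^ k) ⊗ₜ[ℝ] (T ^ k) y) L
  have h2 := Finset.sum_range_succ' (fun k => (ζ⁻¹ ^ k) ⊗ₜ[ℝ] (T ^ k) y) L
  rw [hy, inv_pow, hL, inv_one] at h1
  rw [h1, pow_zero, pow_zero] at h2
  have h3 := add_right_cancel h2
  change eigenSum T ζ L y = _ at h3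
  conv_rhs => rw [h3]
  rw [eigenSum, map_sum, Finset.smul_sum]
  refine Finset.sum_congr rfl fun k _ => ?_
  rw [complexify_tmul, TensorProduct.smul_tmul', smul_eq_mul, pow_succ', ← mul_assoc,
    mul_inv_cancel₀ hζ, one_mul, pow_succ', LinearEquiv.mul_apply]

theorem Carries.one (I : Set D.S) [FiniteDimensional ℝ X] : D.Carries 1 I I where
  normalizes := one_mem _
  conj_mem h := by simp
  notMem_inv t _ := D.notMem_inv_one t

theorem Carries.mul [FiniteDimensional ℝ X] {D : RealReflectionCoset X} {I J K : Set D.S}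
    {g h : X ≃ₗ[ℝ] X} (hg : D.Carries g J K) (hh : D.Carries h I J) :
    D.Carries (g * h) I K where
  normalizes := mul_mem hg.normalizes hh.normalizes
  conj_mem k := by
    have e : (g * h)⁻¹ * k * (g * h) = h⁻¹ * (g⁻¹ * k * g) * h := by group
    rw [e, hh.conj_mem, hg.conj_mem]
  notMem_inv t ht := by
    rw [D.mem_inv_mul hg.normalizes hh.normalizes]
    have h1 := hg.notMem_inv t ht
    have h2 := hh.notMem_inv _ ((hg.conj_mem t).2 ht)
    tauto

theorem Carries.pow [FiniteDimensional ℝ X] {D : RealReflectionCoset X} {I : Set D.S}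
    {g : X ≃ₗ[ℝ] X} (hg : D.Carries g I I) (k : ℕ) : D.Carries (g ^ k) I I := by
  induction k with
  | zero => exact Carries.one D I
  | succ k ih => rw [pow_succ]; exact ih.mul hg

theorem eigenSum_mem_fixedSpace [FiniteDimensional ℝ X] {D : RealReflectionCoset X} {I : Set D.S}
    {T : X ≃ₗ[ℝ] X} (hT : D.Carries T I I) {ζ : ℂ} {L : ℕ} {y : X}
    (hy : ∀ u ∈ D.parabolic I, u y = y) : eigenSum T ζ L y ∈ D.fixedSpace I := by
  rw [mem_fixedSpace]
  intro u hu
  rw [eigenSum, map_sum]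
  refine Finset.sum_congr rfl fun k _ => ?_
  rw [complexify_tmul]
  congr 1
  have h1 := hy _ (((hT.pow k).conj_mem u).2 hu)
  have h2 : u * T ^ k = T ^ k * ((T ^ k)⁻¹ * u * T ^ k) := by group
  rw [← LinearEquiv.mul_apply, h2, LinearEquiv.mul_apply, h1]

/-- The stabilizer in `W` of a vector is generated by reflections. -/
theorem mem_closure_of_apply_eq [FiniteDimensional ℝ X] {h : X ≃ₗ[ℝ] X} (hh : h ∈ D.W) {a : X}
    (ha : h a = a) : h ∈ Subgroup.closure {t | t ∈ D.arr.R ∧ t a = a} := by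
  have hW : ∀ {r}, r ∈ D.arr.R → r ∈ D.W := D.mem_W_of_mem_R
  let A : ReflectionArrangement X :=
    { D.arr with
      R := {t | t ∈ D.arr.R ∧ t a = a}
      finite := D.arr.finite.subset fun t ht => ht.1
      isReflection := fun t ht => D.arr.isReflection t ht.1
      conj := fun s hs t ht => ⟨D.arr.conj s hs.1 t ht.1, by
        have : s⁻¹ a = a := by
          conv_lhs => rw [← hs.2]
          exact s.symm_apply_apply a
        rw [LinearEquiv.mul_apply, LinearEquiv.mul_apply, this, ht.2, hs.2]⟩
      invariant := fun t ht => D.arr.invariant t ht.1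
      regular := fun t ht => D.arr.regular t ht.1 }
  have hsign : ∀ t ∈ A.R, ∀ y, 0 < A.F t y ↔ 0 < D.arr.F t y := fun t ht y =>
    ReflectionArrangement.F_pos_iff (A := A) (A' := D.arr) ht ht.1
      (ReflectionArrangement.F_pos ht.1) y
  obtain ⟨g, hg, hpos⟩ := A.exists_mem_closure_walls (h D.arr.x₀) (fun t ht h0 => by
    have := D.F_ne_zero (D.mem_normalizer hh) ht.1
    rw [Ne, ← ReflectionArrangement.apply_eq_iff ht.1] at this
    exact this ((ReflectionArrangement.apply_eq_iff ht _).2 h0))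
  have hgR : g ∈ Subgroup.closure A.R := Subgroup.closure_mono (fun t ht => ht.1) hg
  have hgW : g ∈ D.W := (Subgroup.closure_le D.W).2 (fun t ht => hW ht.1) hgR
  have hga : g a = a := by
    have : Subgroup.closure A.R ≤ MulAction.stabilizer (X ≃ₗ[ℝ] X) a := by
      rw [Subgroup.closure_le]
      exact fun t ht => ht.2
    exact this hgR
  -- The element g brings h x₀ back to the chamber, for the hyperplanes through a, that contains x₀.
  -- It remains to see that k is trivial.
  set k := g * h with hk
  have hkW : k ∈ D.W := mul_mem hgW hh
  have hka : k a = a := by rw [hk, LinearEquiv.mul_apply, ha, hga]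
  have hkpos : ∀ t ∈ A.R, 0 < D.arr.F t (k D.arr.x₀) := fun t ht => (hsign t ht _).1 (hpos t ht)
  have := D.arr.finite.to_subtype
  obtain ⟨ε, hε, hε'⟩ := exists_pos_perturbation
    (fun t : D.arr.R × Bool => D.arr.F t.1 a)
    (fun t : D.arr.R × Bool => D.arr.F t.1 (if t.2 then k D.arr.x₀ else D.arr.x₀))
  -- Hyperplanes off a see q and k q on the side of a, and those through a see both on the positive
  -- side. So k maps the chamber of q to itself, and simple transitivity gives k = 1.
  set q := a + ε • D.arr.x₀ with hq
  have hkq : k q = a + ε • k D.arr.x₀ := by rw [hq, map_add, map_smul, hka]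
  have hside : ∀ t ∈ D.arr.R, (0 < D.arr.F t q ∧ 0 < D.arr.F t (k q)) ∨
      (D.arr.F t q < 0 ∧ D.arr.F t (k q) < 0) := by
    intro t ht
    have h1 := hε' (⟨t, ht⟩, true)
    have h2 := hε' (⟨t, ht⟩, false)
    simp only [if_true, Bool.false_eq_true, if_false] at h1 h2
    rw [hkq, hq, map_add, map_add, map_smul, map_smul, smul_eq_mul, smul_eq_mul]
    rcases lt_trichotomy (D.arr.F t a) 0 with h0 | h0 | h0
    · exact Or.inr ⟨h2.2 h0, h1.2 h0⟩
    · left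
      rw [h0, zero_add, zero_add]
      exact ⟨mul_pos hε (ReflectionArrangement.F_pos ht),
        mul_pos hε (hkpos t ⟨ht, (ReflectionArrangement.apply_eq_iff ht a).2 h0⟩)⟩
    · exact Or.inl ⟨h2.1 h0, h1.1 h0⟩
  obtain ⟨p, hp, hppos⟩ := D.exists_mem_W_pos q (fun t ht => by
    rcases hside t ht with h | h
    · exact h.1.ne'
    · exact h.1.ne)
  have hone : p * k * p⁻¹ = 1 := by
    refine D.eq_of_inv_eq (mul_mem (mul_mem hp hkW) (inv_mem hp)) (one_mem _) fun t => ?_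
    refine iff_of_false (fun ht => ?_) (D.notMem_inv_one t)
    have hconj := (D.conj_mem_arr_R (D.mem_normalizer
      (mul_mem (mul_mem hp hkW) (inv_mem hp)))).2 ht.1
    have h1 := (ReflectionArrangement.F_neg_iff ht.1 hconj
      (ReflectionArrangement.F_pos hconj) (hppos _ hconj)).1 ht.2
    have h2 : (p * k * p⁻¹) (p q) = p (k q) := by
      rw [← LinearEquiv.mul_apply, inv_mul_cancel_right]; rfl
    rw [h2] at h1
    have ht' := (D.conj_mem_arr_R (D.mem_normalizer hp)).2 ht.1
    obtain ⟨c, hc, hF⟩ := ReflectionArrangement.exists_F_comp ht.1 ht'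
    have h3 := hppos t ht.1
    rw [hF] at h1 h3
    rcases hside _ ht' with h4 | h4
    · have := pos_of_mul_pos_left h3 h4.1.le
      exact (mul_pos this h4.2).not_gt h1
    · have := neg_of_mul_pos_left h3 h4.1.le
      exact (mul_pos_of_neg_of_neg this h4.2).not_gt h1
  have hk1 : k = 1 := by
    have : k = p⁻¹ * (p * k * p⁻¹) * p := by group
    rw [this, hone]; group
  have : h = g⁻¹ := eq_inv_of_mul_eq_one_right hk1
  rw [this]
  exact inv_mem hgR

end RealReflectionCoset

/-- A real sequence with sign pattern `+ - +` over a period is not orthogonal to the constant and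
the two first harmonics. -/
theorem sum_sturm_ne_zero {d : ℕ} (hd : 0 < d) {a : ℕ → ℝ} {N : ℕ → ℤ} (hN0 : N 0 = 0)
    (hNmono : Monotone N) (hNd : N d = 2) (ha : ∀ k, a k ≠ 0) (haN : ∀ k, a k < 0 ↔ Odd (N k))
    (h1 : ∑ k ∈ Finset.range d, a k = 0)
    (hc : ∑ k ∈ Finset.range d, a k * Real.cos (2 * Real.pi * k / d) = 0)
    (hs : ∑ k ∈ Finset.range d, a k * Real.sin (2 * Real.pi * k / d) = 0) : False := by
  classical
  have hex1 : ∃ k, 1 ≤ N k := ⟨d, by omega⟩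
  have hex2 : ∃ k, 2 ≤ N k := ⟨d, by omega⟩
  set p := Nat.find hex1 with hp
  set q := Nat.find hex2 with hq
  have hpd : p ≤ d := Nat.find_min' hex1 (by omega)
  have hqd : q ≤ d := Nat.find_min' hex2 (by omega)
  have hd' : (0 : ℝ) < d := by exact_mod_cast hd
  have hNnn : ∀ k, 0 ≤ N k := fun k => hN0 ▸ hNmono (Nat.zero_le k)
  have hsin : ∀ r k : ℕ, r ≤ d → k < d →
      (k < r → Real.sin (Real.pi * (k - r + 1 / 2) / d) < 0) ∧
      (r ≤ k → 0 < Real.sin (Real.pi * (k - r + 1 / 2) / d)) := by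
    intro r k hr hk
    have hr' : (r : ℝ) ≤ d := by exact_mod_cast hr
    have hk' : (k : ℝ) + 1 ≤ d := by exact_mod_cast hk
    have hk0 : (0 : ℝ) ≤ k := Nat.cast_nonneg k
    have hr0 : (0 : ℝ) ≤ r := Nat.cast_nonneg r
    constructor
    · intro hkr
      have hkr' : (k : ℝ) + 1 ≤ r := by exact_mod_cast hkr
      apply Real.sin_neg_of_neg_of_neg_pi_lt
      · apply div_neg_of_neg_of_pos _ hd'
        exact mul_neg_of_pos_of_neg Real.pi_pos (by linarith)
      · rw [lt_div_iff₀ hd', ← neg_mul_eq_neg_mul, ← mul_neg]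
        exact mul_lt_mul_of_pos_left (by linarith) Real.pi_pos
    · intro hkr
      have hkr' : (r : ℝ) ≤ k := by exact_mod_cast hkr
      apply Real.sin_pos_of_pos_of_lt_pi
      · exact div_pos (mul_pos Real.pi_pos (by linarith)) hd'
      · rw [div_lt_iff₀ hd']
        exact mul_lt_mul_of_pos_left (by linarith) Real.pi_pos
  -- The half-integer shifts make each factor nonzero at integers in the period, with its sign
  -- change exactly at p or q. So f has the sign pattern of a.
  set f : ℕ → ℝ := fun k => Real.sin (Real.pi * (k - p + 1 / 2) / d) *
    Real.sin (Real.pi * (k - q + 1 / 2) / d) with hf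
  have hpos : ∀ k ∈ Finset.range d, 0 < a k * (2 * f k) := by
    intro k hk
    rw [Finset.mem_range] at hk
    have hle : k ≤ d := hk.le
    have hk2 := hNmono hle
    have hk0 := hNnn k
    by_cases hkp : k < p
    · have h2 : ¬ 1 ≤ N k := Nat.find_min hex1 hkp
      have hkq : k < q := by
        by_contra hcon
        have h3 := Nat.find_spec hex2
        have h4 := hNmono (not_lt.1 hcon)
        rw [hq] at h4
        omega
      have h3 : ¬ a k < 0 := by
        rw [haN, show N k = 0 by omega]; simp
      have h4 : 0 < a k := lt_of_le_of_ne (not_lt.1 h3) (ha k).symm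
      have h5 := mul_pos_of_neg_of_neg ((hsin p k hpd hk).1 hkp) ((hsin q k hqd hk).1 hkq)
      exact mul_pos h4 (mul_pos two_pos h5)
    · have h2 : 1 ≤ N k := (Nat.find_spec hex1).trans (hNmono (not_lt.1 hkp))
      by_cases hkq : k < q
      · have h3 : ¬ 2 ≤ N k := Nat.find_min hex2 hkq
        have h4 : a k < 0 := by
          rw [haN, show N k = 1 by omega]; exact odd_one
        have h5 := mul_neg_of_pos_of_neg ((hsin p k hpd hk).2 (not_lt.1 hkp))
          ((hsin q k hqd hk).1 hkq)
        exact mul_pos_of_neg_of_neg h4 (mul_neg_of_pos_of_neg two_pos h5)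
      · have h3 : 2 ≤ N k := (Nat.find_spec hex2).trans (hNmono (not_lt.1 hkq))
        have h4 : ¬ a k < 0 := by
          rw [haN, show N k = 2 by omega]; decide
        have h5 : 0 < a k := lt_of_le_of_ne (not_lt.1 h4) (ha k).symm
        have h6 := mul_pos ((hsin p k hpd hk).2 (not_lt.1 hkp))
          ((hsin q k hqd hk).2 (not_lt.1 hkq))
        exact mul_pos h5 (mul_pos two_pos h6)
  have hsum := Finset.sum_pos hpos ⟨0, Finset.mem_range.2 hd⟩
  set θ : ℝ := Real.pi * (1 - p - q) / d with hθ
  -- The product of the two sines is a constant minus a first harmonic, so the three vanishing sums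
  -- annihilate a sum of positive terms.
  have hexp : ∀ k, a k * (2 * f k) = Real.cos (Real.pi * (q - p) / d) * a k -
      Real.cos θ * (a k * Real.cos (2 * Real.pi * k / d)) +
      Real.sin θ * (a k * Real.sin (2 * Real.pi * k / d)) := by
    intro k
    have e1 : Real.pi * (q - p) / d =
        Real.pi * (k - p + 1 / 2) / d - Real.pi * (k - q + 1 / 2) / d := by ring
    have e2 : Real.cos θ * Real.cos (2 * Real.pi * k / d) -
        Real.sin θ * Real.sin (2 * Real.pi * k / d) =
        Real.cos (Real.pi * (k - p + 1 / 2) / d + Real.pi * (k - q + 1 / 2) / d) := by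
      rw [← Real.cos_add]
      congr 1
      rw [hθ]
      ring
    have e3 : 2 * f k = Real.cos (Real.pi * (q - p) / d) -
        (Real.cos θ * Real.cos (2 * Real.pi * k / d) -
        Real.sin θ * Real.sin (2 * Real.pi * k / d)) := by
      rw [e1, e2, Real.cos_sub, Real.cos_add, hf]
      ring
    rw [e3]
    ring
  rw [Finset.sum_congr rfl fun k _ => hexp k, Finset.sum_add_distrib, Finset.sum_sub_distrib,
    ← Finset.mul_sum, ← Finset.mul_sum, ← Finset.mul_sum, h1, hc, hs] at hsum
  simp at hsum

/-! ### Sides of hyperplanes along orbits of a root -/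

namespace RealReflectionCoset

theorem zeta_ne_zero (d : ℕ) : zeta d ≠ 0 := Complex.exp_ne_zero _

theorem zeta_pow (d : ℕ) (hd : 0 < d) : zeta d ^ d = 1 := by
  rw [zeta, ← Complex.exp_nat_mul]
  have : (d : ℂ) ≠ 0 := by exact_mod_cast hd.ne'
  rw [mul_div_cancel₀ _ this, Complex.exp_two_pi_mul_I]

theorem zeta_inv_pow (d k : ℕ) : (zeta d)⁻¹ ^ k =
    Complex.mk (Real.cos (2 * Real.pi * k / d)) (-Real.sin (2 * Real.pi * k / d)) := by
  have h : (zeta d)⁻¹ ^ k = Complex.exp (((-(2 * Real.pi * k / d) : ℝ) : ℂ) * Complex.I) := by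
    rw [zeta, ← Complex.exp_neg, ← Complex.exp_nat_mul]
    congr 1
    push_cast
    ring
  rw [h]
  apply Complex.ext
  · rw [Complex.exp_ofReal_mul_I_re, Real.cos_neg]
  · rw [Complex.exp_ofReal_mul_I_im, Real.sin_neg]

variable {X : Type*} [AddCommGroup X] [Module ℝ X] (D : RealReflectionCoset X)
  [FiniteDimensional ℝ X]

/-- A complex form not vanishing on U has nonvanishing real part somewhere on U, after
multiplication by i if necessary. A generic vector then avoids all these real hyperplanes at once.
-/
theorem exists_generic (U : Submodule ℂ (ℂ ⊗[ℝ] X)) : ∃ x ∈ U, ∀ t ∈ D.arr.R,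
    (∀ z ∈ U, complexify t z = z) ∨ D.arr.F t (complexRe x) ≠ 0 := by
  have := D.arr.finite.to_subtype
  obtain ⟨x, hx, h⟩ := Module.Dual.exists_forall_mem_ne_zero_of_forall_exists
    (U.restrictScalars ℝ) (fun t : {t : D.arr.R // ¬ ∀ z ∈ U, complexify (t : X ≃ₗ[ℝ] X) z = z} =>
      (D.arr.F t.1).comp complexRe) (by
    rintro ⟨t, ht⟩
    push Not at ht
    obtain ⟨z, hz, hzt⟩ := ht
    rw [Ne, ReflectionArrangement.complexify_eq_iff t.2] at hzt
    by_cases h0 : (complexForm (D.arr.F t) z).re = 0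
    · refine ⟨Complex.I • z, U.smul_mem _ hz, ?_⟩
      change D.arr.F t (complexRe (Complex.I • z)) ≠ 0
      rw [← complexForm_re, map_smul, smul_eq_mul, Complex.I_mul_re, neg_ne_zero]
      exact fun h1 => hzt (Complex.ext h0 h1)
    · refine ⟨z, hz, ?_⟩
      change D.arr.F t (complexRe z) ≠ 0
      rwa [← complexForm_re])
  refine ⟨x, hx, fun t ht => ?_⟩
  by_cases hU : ∀ z ∈ U, complexify t z = z
  · exact Or.inl hU
  · exact Or.inr (h ⟨⟨t, ht⟩, hU⟩)

/-- The pointwise stabilizer of a subspace is generated by reflections. -/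
theorem centralizer_le {U : Submodule ℂ (ℂ ⊗[ℝ] X)} {P : Subgroup (X ≃ₗ[ℝ] X)}
    (h : ∀ t ∈ D.arr.R, (∀ z ∈ U, complexify t z = z) → t ∈ P) : D.centralizer U ≤ P := by
  obtain ⟨x, hx, hgen⟩ := D.exists_generic U
  rintro g ⟨hgW, hg⟩
  have h1 : g (complexRe x) = complexRe x := by rw [← complexRe_complexify, hg x hx]
  have h2 := D.mem_closure_of_apply_eq hgW h1
  refine (Subgroup.closure_le P).2 ?_ h2
  rintro t ⟨ht, hta⟩
  rcases hgen t ht with h3 | h3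
  · exact h t ht h3
  · exact absurd ((ReflectionArrangement.apply_eq_iff ht _).1 hta) h3

/-- A vector in the closed chamber of `W` whose stabilizer is `W_I`. -/
theorem exists_vector (I : Set D.S) : ∃ y : X, (∀ u ∈ D.parabolic I, u y = y) ∧
    (∀ t ∈ D.arr.R, t ∉ D.parabolic I → 0 < D.arr.F t y) ∧
    ∀ g, D.Carries g I I → g D.arr.x₀ = D.arr.x₀ → g y = y := by
  classical
  have hfin : (D.parabolic I : Set (X ≃ₗ[ℝ] X)).Finite :=
    (Set.finite_coe_iff.1 D.finite).subset (D.parabolic_le I)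
  refine ⟨∑ u ∈ hfin.toFinset, u D.arr.x₀, fun v hv => ?_, fun t ht htI => ?_, fun g hg hgx => ?_⟩
  · rw [map_sum]
    refine Finset.sum_nbij' (fun u => v * u) (fun u => v⁻¹ * u) ?_ ?_ ?_ ?_ ?_
    · intro u hu
      simp only [Set.Finite.mem_toFinset, SetLike.mem_coe] at hu ⊢
      exact mul_mem hv hu
    · intro u hu
      simp only [Set.Finite.mem_toFinset, SetLike.mem_coe] at hu ⊢
      exact mul_mem (inv_mem hv) hu
    · intro u _; group
    · intro u _; group
    · intro u _; rfl
  · rw [map_sum]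
    refine Finset.sum_pos (fun u hu => ?_) ⟨1, by simp [one_mem]⟩
    simp only [Set.Finite.mem_toFinset, SetLike.mem_coe] at hu
    have h1 := D.F_ne_zero (D.mem_normalizer (D.parabolic_le I hu)) ht
    by_contra hcon
    exact htI (D.inv_subset_parabolic hu ⟨ht, lt_of_le_of_ne (not_lt.1 hcon) h1⟩)
  · rw [map_sum]
    have hgx' : g⁻¹ D.arr.x₀ = D.arr.x₀ := by
      conv_lhs => rw [← hgx]
      exact g.symm_apply_apply _
    refine Finset.sum_nbij' (fun u => g * u * g⁻¹) (fun u => g⁻¹ * u * g) ?_ ?_ ?_ ?_ ?_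
    · intro u hu
      simp only [Set.Finite.mem_toFinset, SetLike.mem_coe] at hu ⊢
      exact hg.conj_mem' hu
    · intro u hu
      simp only [Set.Finite.mem_toFinset, SetLike.mem_coe] at hu ⊢
      exact (hg.conj_mem u).2 hu
    · intro u _; group
    · intro u _; group
    · intro u _
      rw [LinearEquiv.mul_apply, LinearEquiv.mul_apply, hgx']

variable {D} {I : Set D.S} {g : X ≃ₗ[ℝ] X} {y : X}

/-- Elements carrying the chamber of `W_I` to itself move vectors to the same side of hyperplanes
as their action on chambers indicates. -/
theorem Carries.F_apply (hg : D.Carries g I I)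
    (hy : ∀ t ∈ D.arr.R, t ∉ D.parabolic I → 0 < D.arr.F t y) {t : X ≃ₗ[ℝ] X} (ht : t ∈ D.arr.R)
    (htI : t ∉ D.parabolic I) :
    D.arr.F t (g y) ≠ 0 ∧ (D.arr.F t (g y) < 0 ↔ t ∈ D.inv g) := by
  have ht' := (D.conj_mem_arr_R hg.normalizes).2 ht
  have htI' := mt (hg.conj_mem t).1 htI
  have hpos := hy _ ht' htI'
  constructor
  · obtain ⟨c, hc, hF⟩ := ReflectionArrangement.exists_F_comp ht ht'
    rw [hF]
    exact mul_ne_zero hc hpos.ne'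
  · rw [ReflectionArrangement.F_neg_iff ht ht' hpos (ReflectionArrangement.F_pos ht')]
    exact ⟨fun h => ⟨ht, h⟩, fun h => h.2⟩

variable {d : ℕ} {b : D.BraidMonoid}

theorem mem_inv_imageφ_pow (b : D.BraidMonoid) (k : ℕ) (t : X ≃ₗ[ℝ] X) :
    t ∈ D.inv (D.imageφ b ^ k) ↔ Odd (D.cr (D.mulφ b ^ k) t) := by
  induction k with
  | zero => rw [pow_zero, pow_zero, cr_one]; exact iff_of_false (D.notMem_inv_one t) (by simp)
  | succ k ih =>
    rw [pow_succ, pow_succ, D.mem_inv_mul (pow_mem (D.imageφ_normalizes b) k)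
      (D.imageφ_normalizes b), cr_mul, im_pow, im_mulφ, ih, mem_inv_imageφ, cr_mulφ, Int.odd_add,
      ← Int.not_odd_iff_even]
    change ¬ (_ ↔ Odd (D.crM b _)) ↔ (_ ↔ ¬ Odd (D.crM b _))
    tauto

theorem cr_mulφ_pow_mono (b : D.BraidMonoid) (t : X ≃ₗ[ℝ] X) :
    Monotone fun k => D.cr (D.mulφ b ^ k) t := by
  refine monotone_nat_of_le_succ fun k => ?_
  rw [pow_succ, cr_mul, cr_mulφ]
  exact le_add_of_nonneg_right (D.crM_nonneg b _)

theorem IsRoot.cr_pow_eq (hI : D.IsStable d I) (hroot : D.IsRoot d b I) {t : X ≃ₗ[ℝ] X}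
    (ht : t ∈ D.arr.R) (htI : t ∉ D.parabolic I) : D.cr (D.mulφ b ^ d) t = 2 := by
  have h := hroot.sum_crM hI ht
  rw [if_neg htI] at h
  rw [cr_pow, im_mulφ]
  simp only [cr_mulφ]
  exact h

/-- The vectors `T ^ k y` are not balanced on the two sides of a hyperplane fixed by `V`. -/
theorem IsRoot.F_sum_ne_zero (hd : 0 < d) (hI : D.IsStable d I) (hroot : D.IsRoot d b I)
    (hyI : ∀ u ∈ D.parabolic I, u y = y)
    (hy : ∀ t ∈ D.arr.R, t ∉ D.parabolic I → 0 < D.arr.F t y)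
    (hTy : (D.imageφ b ^ d) y = y) {t : X ≃ₗ[ℝ] X} (ht : t ∈ D.arr.R) (htI : t ∉ D.parabolic I)
    (htU : ∀ z ∈ D.fixedSpace I ⊓ Module.End.eigenspace (complexify (D.imageφ b)) (zeta d),
      complexify t z = z) :
    D.arr.F t (∑ k ∈ Finset.range d, (D.imageφ b ^ k) y) ≠ 0 := by
  intro h0
  have hT := hroot.carries hd hI
  set T := D.imageφ b with hTdef
  have hz : eigenSum T (zeta d) d y ∈
      D.fixedSpace I ⊓ Module.End.eigenspace (complexify T) (zeta d) :=
    ⟨eigenSum_mem_fixedSpace hT hyI,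
      eigenSum_mem_eigenspace (zeta_ne_zero d) (zeta_pow d hd) hTy⟩
  have h2 := (ReflectionArrangement.complexify_eq_iff ht _).1 (htU _ hz)
  rw [complexForm_eigenSum] at h2
  rw [map_sum] at h0
  -- The counts N k are the crossings of (wφ)^k, which increase from 0 to 2 over the period. Since t
  -- fixes U, its form kills the projection of y to the eigenspace; the real and imaginary parts
  -- give the two harmonics.
  refine sum_sturm_ne_zero hd (a := fun k => D.arr.F t ((T ^ k) y))
    (N := fun k => D.cr (D.mulφ b ^ k) t) (by simp [cr_one]) (cr_mulφ_pow_mono b t)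
    (hroot.cr_pow_eq hI ht htI) (fun k => ((hT.pow k).F_apply hy ht htI).1)
    (fun k => ?_) h0 ?_ ?_
  · rw [← mem_inv_imageφ_pow]
    exact ((hT.pow k).F_apply hy ht htI).2
  · have := congrArg Complex.re h2
    rw [Complex.re_sum] at this
    simp only [zeta_inv_pow, Complex.re_mul_ofReal, Complex.zero_re] at this
    simpa only [mul_comm] using this
  · have := congrArg Complex.im h2
    rw [Complex.im_sum] at this
    simp only [zeta_inv_pow, Complex.im_mul_ofReal, Complex.zero_im, neg_mul,
      Finset.sum_neg_distrib, neg_eq_zero] at this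
    simpa only [mul_comm] using this

end RealReflectionCoset

theorem ReflectionArrangement.exists_F_eq_mul {X : Type*} [AddCommGroup X] [Module ℝ X]
    {A A' : ReflectionArrangement X} {t : X ≃ₗ[ℝ] X} (ht : t ∈ A.R) (ht' : t ∈ A'.R) :
    ∃ c : ℝ, c ≠ 0 ∧ ∀ y, A.F t y = c * A'.F t y := by
  have key : ∀ y, 2 * A.F t y = A'.F t y * A.F t (A'.root t) := by
    intro y
    have h1 := reflection_apply ht y
    rw [reflection_apply ht' y, sub_right_inj] at h1
    have h2 := congrArg (A.F t) h1
    rw [map_smul, map_smul, F_root ht, smul_eq_mul, smul_eq_mul] at h2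
    linarith
  have hkey : ∀ y, A.F t y = A.F t (A'.root t) / 2 * A'.F t y := fun y => by linarith [key y]
  refine ⟨A.F t (A'.root t) / 2, fun h => ?_, hkey⟩
  have h1 := hkey A.x₀
  rw [h, zero_mul] at h1
  exact (F_pos ht).ne' h1

/-! ### W_I as a pointwise stabilizer: assertion (ii) -/

namespace RealReflectionCoset

variable {X : Type*} [AddCommGroup X] [Module ℝ X] {D : RealReflectionCoset X}
  [FiniteDimensional ℝ X] {I : Set D.S} {d : ℕ} {b : D.BraidMonoid}

/-- If `T ^ k` preserves a hyperplane outside those of `W_I`, and its side, then `d` divides `k`. -/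
theorem IsRoot.dvd_of_conj_eq (hI : D.IsStable d I) (hroot : D.IsRoot d b I)
    {t : X ≃ₗ[ℝ] X} (ht : t ∈ D.arr.R) (htI : t ∉ D.parabolic I) {k : ℕ}
    (hk : (D.imageφ b ^ k)⁻¹ * t * D.imageφ b ^ k = t) (hinv : t ∉ D.inv (D.imageφ b ^ k)) :
    d ∣ k := by
  set T := D.imageφ b with hT
  rw [hT, mem_inv_imageφ_pow, Int.not_odd_iff_even] at hinv
  obtain ⟨e, he⟩ := hinv
  -- The crossings of (wφ)^(kd) are counted in two ways: T^k fixes t and (wφ)^k crosses it an even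
  -- number 2e of times, while (wφ)^d crosses each conjugate twice. Hence 2de = 2k.
  have h1 : D.cr ((D.mulφ b ^ k) ^ d) t = d * (e + e) := by
    rw [cr_pow, im_pow, im_mulφ, ← hT]
    have : ∀ j : ℕ, ((T ^ k) ^ j)⁻¹ * t * (T ^ k) ^ j = t := by
      intro j
      have hc : Commute t (T ^ k) := by
        rw [mul_assoc, inv_mul_eq_iff_eq_mul] at hk
        exact hk
      rw [mul_assoc, (hc.pow_right j).eq, inv_mul_cancel_left]
    rw [Finset.sum_congr rfl fun j _ => by rw [this j, he], Finset.sum_const, Finset.card_range,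
      nsmul_eq_mul]
  have h2 : D.cr ((D.mulφ b ^ d) ^ k) t = k * 2 := by
    rw [cr_pow, im_pow, im_mulφ, ← hT]
    have : ∀ j : ℕ, D.cr (D.mulφ b ^ d) (((T ^ d) ^ j)⁻¹ * t * (T ^ d) ^ j) = 2 := by
      intro j
      refine hroot.cr_pow_eq hI ?_ ?_
      · exact (D.conj_mem_arr_R (pow_mem (pow_mem (D.imageφ_normalizes b) d) j)).2 ht
      · rw [hT, hroot.image_pow]
        exact fun h => htI ((((D.carries_φ_pow hI).pow j).conj_mem t).1 h)
    rw [Finset.sum_congr rfl fun j _ => this j, Finset.sum_const, Finset.card_range,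
      nsmul_eq_mul]
  rw [← pow_mul, mul_comm d k, pow_mul, h1] at h2
  have h3 : (k : ℤ) = d * e := by linarith
  exact Int.natCast_dvd_natCast.1 ⟨e, h3⟩

/-- A T-stable chamber is built for the reflections fixing U. If one of them lay outside W_I, some
wall β of this chamber would too. The eigenvector made from a vertex opposite β lies in U, but β
takes a positive value on it. -/
theorem mem_parabolic_of_fixes (hd : 0 < d) (hI : D.IsStable d I) (hroot : D.IsRoot d b I)
    {t₀ : X ≃ₗ[ℝ] X} (ht₀ : t₀ ∈ D.arr.R)
    (ht₀U : ∀ z ∈ D.fixedSpace I ⊓ Module.End.eigenspace (complexify (D.imageφ b)) (zeta d),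
      complexify t₀ z = z) : t₀ ∈ D.parabolic I := by
  by_contra ht₀I
  have hT := hroot.carries hd hI
  obtain ⟨y, hyI, hy, hyφ⟩ := D.exists_vector I
  have hTy : (D.imageφ b ^ d) y = y := by
    rw [hroot.image_pow]
    exact hyφ _ (D.carries_φ_pow hI) (D.φ_pow_x₀ d)
  have hmne' : ∀ t ∈ D.arr.R, t ∉ D.parabolic I → (∀ z ∈ D.fixedSpace I ⊓
      Module.End.eigenspace (complexify (D.imageφ b)) (zeta d), complexify t z = z) → _ :=
    fun t ht htI htU => hroot.F_sum_ne_zero hd hI hyI hy hTy ht htI htU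
  set T := D.imageφ b with hTdef
  set U := D.fixedSpace I ⊓ Module.End.eigenspace (complexify T) (zeta d) with hU
  -- This vector is fixed by T and W_I, and by the Sturm argument it lies on no hyperplane of a
  -- reflection fixing U outside W_I.
  set m := ∑ k ∈ Finset.range d, (T ^ k) y with hm
  have hTm : T m = m := by
    have h1 : T m = ∑ k ∈ Finset.range d, (T ^ (k + 1)) y := by
      rw [hm, map_sum]
      refine Finset.sum_congr rfl fun k _ => ?_
      rw [pow_succ']; rfl
    have h2 := Finset.sum_range_succ (fun k => (T ^ k) y) d
    have h3 := Finset.sum_range_succ' (fun k => (T ^ k) y) d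
    rw [h2, hTy, pow_zero] at h3
    rw [h1]
    exact (add_right_cancel h3).symm
  have hum : ∀ u ∈ D.parabolic I, u m = m := by
    intro u hu
    rw [hm, map_sum]
    refine Finset.sum_congr rfl fun k _ => ?_
    have h1 := hyI _ (((hT.pow k).conj_mem u).2 hu)
    have h2 : u * T ^ k = T ^ k * ((T ^ k)⁻¹ * u * T ^ k) := by group
    rw [← LinearEquiv.mul_apply, h2, LinearEquiv.mul_apply, h1]
  have hm0 : ∀ t ∈ D.arr.R, t ∈ D.parabolic I → D.arr.F t m = 0 := fun t ht htI =>
    (ReflectionArrangement.apply_eq_iff ht m).1 (hum t htI)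
  let R' : Set (X ≃ₗ[ℝ] X) := {t | t ∈ D.arr.R ∧ ∀ z ∈ U, complexify t z = z}
  have hmne : ∀ t ∈ R', t ∉ D.parabolic I → D.arr.F t m ≠ 0 := fun t ht htI =>
    hmne' t ht.1 htI ht.2
  have := D.arr.finite.to_subtype
  obtain ⟨ε, hε, hεm⟩ := exists_pos_perturbation (fun t : D.arr.R => D.arr.F t m)
    (fun t : D.arr.R => D.arr.F t D.arr.x₀)
  have hx' : ∀ t, D.arr.F t (m + ε • D.arr.x₀) = D.arr.F t m + ε * D.arr.F t D.arr.x₀ := by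
    intro t
    rw [map_add, map_smul, smul_eq_mul]
  -- The base point is m pushed slightly towards x₀. Outside W_I the signs are those of m, and
  -- inside W_I those of x₀; T preserves both kinds, so it preserves the chamber.
  let A : ReflectionArrangement X :=
    { D.arr with
      R := R'
      finite := D.arr.finite.subset fun t ht => ht.1
      isReflection := fun t ht => D.arr.isReflection t ht.1
      conj := fun s hs t ht => ⟨D.arr.conj s hs.1 t ht.1, fun z hz => by
        have : complexify s⁻¹ z = z := by
          conv_lhs => rw [← hs.2 z hz]
          rw [← Module.End.mul_apply, ← complexify_mul, inv_mul_cancel, complexify_one]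
          rfl
        rw [complexify_mul, complexify_mul, Module.End.mul_apply, Module.End.mul_apply, this,
          ht.2 z hz, hs.2 z hz]⟩
      invariant := fun t ht => D.arr.invariant t ht.1
      x₀ := m + ε • D.arr.x₀
      regular := fun t ht h => by
        rw [ReflectionArrangement.apply_eq_iff ht.1, hx'] at h
        by_cases htI : t ∈ D.parabolic I
        · rw [hm0 t ht.1 htI, zero_add] at h
          exact (mul_pos hε (ReflectionArrangement.F_pos ht.1)).ne' h
        · rcases (hmne t ht htI).lt_or_gt with h1 | h1
          · exact ((hεm ⟨t, ht.1⟩).2 h1).ne h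
          · exact ((hεm ⟨t, ht.1⟩).1 h1).ne' h }
  have hAin : ∀ t ∈ A.R, t ∈ D.parabolic I → ∀ z, 0 < A.F t z ↔ 0 < D.arr.F t z := by
    intro t ht htI z
    refine ReflectionArrangement.F_pos_iff ht ht.1 ?_ z
    change 0 < D.arr.F t (m + ε • D.arr.x₀)
    rw [hx', hm0 t ht.1 htI, zero_add]
    exact mul_pos hε (ReflectionArrangement.F_pos ht.1)
  have hAm0 : ∀ t ∈ A.R, t ∈ D.parabolic I → A.F t m = 0 := fun t ht htI =>
    (ReflectionArrangement.apply_eq_iff ht m).1 (hum t htI)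
  have hAm : ∀ t ∈ A.R, t ∉ D.parabolic I → 0 < A.F t m := by
    intro t ht htI
    obtain ⟨c, hc, hF⟩ := ReflectionArrangement.exists_F_eq_mul (A' := D.arr) ht ht.1
    have h1 : 0 < A.F t (m + ε • D.arr.x₀) := ReflectionArrangement.F_pos ht
    rw [hF, hx'] at h1
    rw [hF]
    rcases (hmne t ht htI).lt_or_gt with h2 | h2
    · have h3 := neg_of_mul_pos_left h1 ((hεm ⟨t, ht.1⟩).2 h2).le
      exact mul_pos_of_neg_of_neg h3 h2
    · have h3 := pos_of_mul_pos_left h1 ((hεm ⟨t, ht.1⟩).1 h2).le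
      exact mul_pos h3 h2
  -- The scalar action on U makes conjugation preserve the reflections that fix U. The class
  -- contains the powers of T and is closed under inverses, which is what permuting the walls
  -- requires.
  let Good : (X ≃ₗ[ℝ] X) → Prop := fun g => D.Carries g I I ∧ g m = m ∧
    ∀ z ∈ U, ∃ c : ℂ, c ≠ 0 ∧ complexify g z = c • z
  have hGoodpow : ∀ k : ℕ, Good (T ^ k) := by
    intro k
    refine ⟨hT.pow k, ?_, fun z hz => ⟨zeta d ^ k, pow_ne_zero _ (zeta_ne_zero d), ?_⟩⟩
    · induction k with
      | zero => rfl
      | succ k ih => rw [pow_succ, LinearEquiv.mul_apply, hTm, ih]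
    · induction k with
      | zero => rw [pow_zero, pow_zero, complexify_one, one_smul]; rfl
      | succ k ih =>
        rw [pow_succ, complexify_mul, Module.End.mul_apply, Module.End.mem_eigenspace_iff.1 hz.2,
          map_smul, ih, smul_smul, ← pow_succ']
  have hGoodinv : ∀ g, Good g → Good g⁻¹ := by
    rintro g ⟨h1, h2, h3⟩
    refine ⟨h1.symm, ?_, fun z hz => ?_⟩
    · conv_lhs => rw [← h2]
      exact g.symm_apply_apply m
    · obtain ⟨c, hc, h4⟩ := h3 z hz
      refine ⟨c⁻¹, inv_ne_zero hc, ?_⟩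
      have h5 : complexify g⁻¹ (complexify g z) = z := by
        rw [← Module.End.mul_apply, ← complexify_mul, inv_mul_cancel, complexify_one]
        rfl
      rw [h4, map_smul] at h5
      rw [← h5, smul_smul, inv_mul_cancel₀ hc, one_smul, h5]
  have hconj : ∀ g, Good g → ∀ t ∈ A.R, g⁻¹ * t * g ∈ A.R := by
    rintro g ⟨h1, h2, h3⟩ t ht
    refine ⟨(D.conj_mem_arr_R h1.normalizes).2 ht.1, fun z hz => ?_⟩
    obtain ⟨c, hc, h4⟩ := h3 z hz
    rw [complexify_mul, complexify_mul, Module.End.mul_apply, Module.End.mul_apply, h4, map_smul,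
      ht.2 z hz, ← h4, ← Module.End.mul_apply, ← complexify_mul, inv_mul_cancel, complexify_one]
    rfl
  have hcomp : ∀ g, Good g → ∀ t ∈ A.R, ∃ c : ℝ, 0 < c ∧
      ∀ z, A.F t (g z) = c * A.F (g⁻¹ * t * g) z := by
    intro g hg t ht
    have ht' := hconj g hg t ht
    obtain ⟨c, hc, hF⟩ := ReflectionArrangement.exists_F_comp ht ht'
    refine ⟨c, ?_, hF⟩
    by_cases htI : t ∈ D.parabolic I
    · have htI' := (hg.1.conj_mem t).2 htI
      have h1 : 0 < A.F (g⁻¹ * t * g) D.arr.x₀ :=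
        (hAin _ ht' htI' _).2 (ReflectionArrangement.F_pos ht'.1)
      have h2 : 0 < A.F t (g D.arr.x₀) := by
        rw [hAin t ht htI]
        have h3 := D.F_ne_zero hg.1.normalizes ht.1
        by_contra hcon
        exact hg.1.notMem_inv t htI ⟨ht.1, lt_of_le_of_ne (not_lt.1 hcon) h3⟩
      rw [hF] at h2
      exact pos_of_mul_pos_left h2 h1.le
    · have htI' := mt (hg.1.conj_mem t).1 htI
      have h1 := hAm _ ht' htI'
      have h2 := hAm _ ht htI
      rw [← hg.2.1, hF] at h2
      exact pos_of_mul_pos_left h2 h1.le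
  have hwall : ∀ g, Good g → ∀ s ∈ A.walls, g⁻¹ * s * g ∈ A.walls := by
    rintro g hg s ⟨hs, z, hz, hz'⟩
    refine ⟨hconj g hg s hs, g⁻¹ z, ?_, fun r hr hrs => ?_⟩
    · obtain ⟨c, hc, hF⟩ := hcomp g hg s hs
      have h1 := hF (g⁻¹ z)
      rw [← LinearEquiv.mul_apply, mul_inv_cancel, LinearEquiv.coe_one, id_eq, hz] at h1
      exact (mul_eq_zero.1 h1.symm).resolve_left hc.ne'
    · obtain ⟨c, hc, hF⟩ := hcomp _ (hGoodinv g hg) r hr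
      rw [hF]
      refine mul_pos hc (hz' _ (hconj _ (hGoodinv g hg) r hr) fun h => hrs ?_)
      rw [← h]
      group
  have hIwall : ∀ s : D.S, s ∈ I → (s : X ≃ₗ[ℝ] X) ∈ A.walls := by
    intro s hs
    have hsI := D.coe_mem_parabolic hs
    have hsR : (s : X ≃ₗ[ℝ] X) ∈ A.R :=
      ⟨D.coe_mem_R s, fun z hz => mem_fixedSpace (D := D).1 hz.1 _ hsI⟩
    have hsw : (s : X ≃ₗ[ℝ] X) ∈ D.arr.walls := by rw [walls_eq]; exact s.2
    obtain ⟨-, z₀, hz₀, hz₀'⟩ := hsw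
    have := A.finite.to_subtype
    obtain ⟨δ, hδ, hδ'⟩ := exists_pos_perturbation (fun t : A.R => A.F t m)
      (fun t : A.R => A.F t z₀)
    refine ⟨hsR, m + δ • z₀, ?_, fun t ht hts => ?_⟩
    · rw [map_add, map_smul, hAm0 _ hsR hsI, (ReflectionArrangement.apply_eq_iff hsR z₀).1
        ((ReflectionArrangement.apply_eq_iff hsR.1 z₀).2 hz₀)]
      simp
    · rw [map_add, map_smul, smul_eq_mul]
      by_cases htI : t ∈ D.parabolic I
      · rw [hAm0 t ht htI, zero_add]
        exact mul_pos hδ ((hAin t ht htI _).2 (hz₀' t ht.1 hts))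
      · exact (hδ' ⟨t, ht⟩).1 (hAm t ht htI)
  -- Near -m, on the side of x₀, the form of t₀ is negative while the forms of W_I are positive. So
  -- a wall with a negative value there is outside W_I.
  obtain ⟨β, hβw, hβI⟩ : ∃ β ∈ A.walls, β ∉ D.parabolic I := by
    have := A.finite.to_subtype
    obtain ⟨δ, hδ, hδ'⟩ := exists_pos_perturbation (fun t : A.R => A.F t (-m))
      (fun t : A.R => A.F t D.arr.x₀)
    have ht₀R : t₀ ∈ A.R := ⟨ht₀, ht₀U⟩
    obtain ⟨β, hβ, hneg⟩ := ReflectionArrangement.exists_wall_neg (A := A)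
      (y := -m + δ • D.arr.x₀) ht₀R (by
        rw [map_add, map_smul]
        refine (hδ' ⟨t₀, ht₀R⟩).2 ?_
        rw [map_neg, neg_lt_zero]
        exact hAm t₀ ht₀R ht₀I)
    refine ⟨β, hβ, fun hβI => ?_⟩
    rw [map_add, map_neg, map_smul, smul_eq_mul, hAm0 β hβ.1 hβI, neg_zero, zero_add] at hneg
    exact (mul_pos hδ ((hAin β hβ.1 hβI _).2 (ReflectionArrangement.F_pos hβ.1.1))).not_gt hneg
  obtain ⟨v, hv, hv'⟩ := ReflectionArrangement.exists_vertex hβw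
  obtain ⟨L, hL, hTL⟩ := isOfFinOrder_iff_pow_eq_one.1 (hroot.isOfFinOrder hd)
  rw [← hTdef] at hTL
  have hvI : ∀ u ∈ D.parabolic I, u v = v := by
    intro u hu
    have : D.parabolic I ≤ MulAction.stabilizer (X ≃ₗ[ℝ] X) v := by
      rw [parabolic, Subgroup.closure_le]
      rintro _ ⟨s, hs, rfl⟩
      have h1 := hIwall s hs
      refine (ReflectionArrangement.apply_eq_iff h1.1 v).2 (hv' _ h1 fun h => hβI ?_)
      rw [← h]
      exact D.coe_mem_parabolic hs
    exact this hu
  have hpU : eigenSum T (zeta d) (d * L) v ∈ U :=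
    ⟨eigenSum_mem_fixedSpace hT hvI, eigenSum_mem_eigenspace (zeta_ne_zero d)
      (by rw [pow_mul, zeta_pow d hd, one_pow])
      (by rw [mul_comm, pow_mul, hTL, one_pow]; rfl)⟩
  have h0 := (ReflectionArrangement.complexify_eq_iff hβw.1 _).1 (hβw.1.2 _ hpU)
  rw [complexForm_eigenSum] at h0
  -- Since T^k permutes the walls and v lies on all of them but β, a term survives only when T^k
  -- fixes β. Then d ∣ k, the root of unity is 1 and the term is positive; k = 0 does occur.
  have hpos : 0 < (∑ k ∈ Finset.range (d * L), (zeta d)⁻¹ ^ k * (A.F β ((T ^ k) v) : ℂ)).re := by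
    rw [Complex.re_sum]
    have hterm : ∀ k, 0 ≤ ((zeta d)⁻¹ ^ k * (A.F β ((T ^ k) v) : ℂ)).re := by
      intro k
      obtain ⟨c, hc, hF⟩ := hcomp _ (hGoodpow k) β hβw.1
      by_cases hk : (T ^ k)⁻¹ * β * T ^ k = β
      · have hdvd : d ∣ k := by
          refine hroot.dvd_of_conj_eq hI hβw.1.1 hβI hk fun hinv => ?_
          obtain ⟨e, he, hE⟩ := ReflectionArrangement.exists_F_eq_mul (A' := D.arr) hβw.1 hβw.1.1
          have h1 := hF D.arr.x₀
          rw [hk, hE, hE, mul_left_comm] at h1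
          have h2 := mul_left_cancel₀ he h1
          exact (mul_pos hc (ReflectionArrangement.F_pos hβw.1.1)).not_gt (h2 ▸ hinv.2)
        obtain ⟨j, rfl⟩ := hdvd
        rw [pow_mul, inv_pow, zeta_pow d hd, inv_one, one_pow, one_mul, Complex.ofReal_re, hF, hk]
        exact (mul_pos hc hv).le
      · rw [hF, hv' _ (hwall _ (hGoodpow k) β hβw) hk]
        simp
    refine Finset.sum_pos' (fun k _ => hterm k) ⟨0, Finset.mem_range.2 (Nat.mul_pos hd hL), ?_⟩
    simpa using hv
  rw [h0] at hpos
  exact lt_irrefl _ hpos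

/-- The parabolic subgroup attached to a root is the pointwise stabilizer of an eigenspace. -/
theorem IsRoot.parabolic_eq (hd : 0 < d) (hI : D.IsStable d I) (hroot : D.IsRoot d b I) :
    D.parabolic I = D.centralizer
      (D.fixedSpace I ⊓ Module.End.eigenspace (complexify (D.imageφ b)) (zeta d)) := by
  apply le_antisymm
  · exact fun u hu => ⟨D.parabolic_le I hu, fun x hx => (D.mem_fixedSpace).1 hx.1 u hu⟩
  · exact D.centralizer_le fun t ht htU => mem_parabolic_of_fixes hd hI hroot ht htU

theorem centralizer_antitone {U V : Submodule ℂ (ℂ ⊗[ℝ] X)} (h : U ≤ V) :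
    D.centralizer V ≤ D.centralizer U := fun _ hu => ⟨hu.1, fun x hx => hu.2 x (h hx)⟩

theorem IsRoot.centralizer_le (hd : 0 < d) (hI : D.IsStable d I) (hroot : D.IsRoot d b I) :
    D.centralizer (Module.End.eigenspace (complexify (D.imageφ b)) (zeta d)) ≤ D.parabolic I := by
  rw [hroot.parabolic_eq hd hI]
  exact centralizer_antitone inf_le_right

end RealReflectionCoset

namespace RealReflectionCoset

variable {X : Type*} [AddCommGroup X] [Module ℝ X] (D : RealReflectionCoset X)

/-! ### Averaging over a parabolic subgroup -/

theorem parabolic_finite (I : Set D.S) : (D.parabolic I : Set (X ≃ₗ[ℝ] X)).Finite :=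
  (Set.finite_coe_iff.1 D.finite).subset (D.parabolic_le I)

/-- The sum of the elements of `W_I`. -/
def avg (I : Set D.S) : Module.End ℂ (ℂ ⊗[ℝ] X) :=
  ∑ u ∈ (D.parabolic_finite I).toFinset, complexify u

theorem avg_apply (I : Set D.S) (z : ℂ ⊗[ℝ] X) :
    D.avg I z = ∑ u ∈ (D.parabolic_finite I).toFinset, complexify u z := by
  rw [avg, LinearMap.sum_apply]

theorem complexify_mul_apply (g h : X ≃ₗ[ℝ] X) (z : ℂ ⊗[ℝ] X) :
    complexify (g * h) z = complexify g (complexify h z) := by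
  rw [complexify_mul]; rfl

theorem complexify_inv_apply (g : X ≃ₗ[ℝ] X) (z : ℂ ⊗[ℝ] X) :
    complexify g⁻¹ (complexify g z) = z := by
  rw [← complexify_mul_apply, inv_mul_cancel, complexify_one]; rfl

theorem avg_mem_fixedSpace (I : Set D.S) (z : ℂ ⊗[ℝ] X) : D.avg I z ∈ D.fixedSpace I := by
  rw [mem_fixedSpace]
  intro v hv
  rw [avg_apply, map_sum]
  refine Finset.sum_nbij' (fun u => v * u) (fun u => v⁻¹ * u) ?_ ?_ ?_ ?_ ?_
  · intro u hu
    simp only [Set.Finite.mem_toFinset, SetLike.mem_coe] at hu ⊢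
    exact mul_mem hv hu
  · intro u hu
    simp only [Set.Finite.mem_toFinset, SetLike.mem_coe] at hu ⊢
    exact mul_mem (inv_mem hv) hu
  · intro u _; group
  · intro u _; group
  · intro u _; rw [complexify_mul_apply]

theorem avg_complexify {I : Set D.S} {v : X ≃ₗ[ℝ] X} (hv : v ∈ D.parabolic I) (z : ℂ ⊗[ℝ] X) :
    D.avg I (complexify v z) = D.avg I z := by
  rw [avg_apply, avg_apply]
  refine Finset.sum_nbij' (fun u => u * v) (fun u => u * v⁻¹) ?_ ?_ ?_ ?_ ?_
  · intro u hu
    simp only [Set.Finite.mem_toFinset, SetLike.mem_coe] at hu ⊢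
    exact mul_mem hu hv
  · intro u hu
    simp only [Set.Finite.mem_toFinset, SetLike.mem_coe] at hu ⊢
    exact mul_mem hu (inv_mem hv)
  · intro u _; group
  · intro u _; group
  · intro u _; rw [complexify_mul_apply]

theorem complexify_avg {I : Set D.S} {g : X ≃ₗ[ℝ] X}
    (hg : ∀ h, g⁻¹ * h * g ∈ D.parabolic I ↔ h ∈ D.parabolic I) (z : ℂ ⊗[ℝ] X) :
    complexify g (D.avg I z) = D.avg I (complexify g z) := by
  rw [avg_apply, avg_apply, map_sum]
  refine Finset.sum_nbij' (fun u => g * u * g⁻¹) (fun u => g⁻¹ * u * g) ?_ ?_ ?_ ?_ ?_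
  · intro u hu
    simp only [Set.Finite.mem_toFinset, SetLike.mem_coe] at hu ⊢
    rw [← hg]
    convert hu using 1
    group
  · intro u hu
    simp only [Set.Finite.mem_toFinset, SetLike.mem_coe] at hu ⊢
    exact (hg u).2 hu
  · intro u _; group
  · intro u _; group
  · intro u _
    rw [complexify_mul_apply, complexify_mul_apply, complexify_inv_apply]

theorem avg_eq_smul {I : Set D.S} {z : ℂ ⊗[ℝ] X} (hz : z ∈ D.fixedSpace I) :
    D.avg I z = ((D.parabolic_finite I).toFinset.card : ℂ) • z := by
  rw [avg_apply, Finset.sum_congr rfl fun u hu => D.mem_fixedSpace.1 hz u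
    (by simpa using hu), Finset.sum_const, Nat.cast_smul_eq_nsmul]

theorem card_parabolic_ne_zero (I : Set D.S) :
    ((D.parabolic_finite I).toFinset.card : ℂ) ≠ 0 := by
  have : (1 : X ≃ₗ[ℝ] X) ∈ (D.parabolic_finite I).toFinset := by simp [one_mem]
  exact_mod_cast (Finset.card_pos.2 ⟨_, this⟩).ne'

theorem avg_rootSpan {I : Set D.S} {z : ℂ ⊗[ℝ] X} (hz : z ∈ D.rootSpan I) : D.avg I z = 0 := by
  have : D.rootSpan I ≤ LinearMap.ker (D.avg I) := by
    rw [rootSpan]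
    refine iSup₂_le fun s hs => ?_
    rintro _ ⟨y, rfl⟩
    rw [LinearMap.mem_ker, LinearMap.sub_apply, map_sub, D.avg_complexify hs.1]
    exact sub_self _
  exact this hz

theorem eq_zero_of_mem_rootSpan {I : Set D.S} {z : ℂ ⊗[ℝ] X} (hz : z ∈ D.rootSpan I)
    (hz' : z ∈ D.fixedSpace I) : z = 0 := by
  have h := D.avg_eq_smul hz'
  rw [D.avg_rootSpan hz] at h
  exact (smul_eq_zero.1 h.symm).resolve_left (D.card_parabolic_ne_zero I)

theorem complexify_sub_mem_rootSpan {I : Set D.S} {u : X ≃ₗ[ℝ] X} (hu : u ∈ D.parabolic I)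
    (z : ℂ ⊗[ℝ] X) : complexify u z - z ∈ D.rootSpan I := by
  induction hu using Subgroup.closure_induction generalizing z with
  | mem x hx =>
    obtain ⟨s, hs, rfl⟩ := hx
    have h1 : (s : X ≃ₗ[ℝ] X) ∈ reflectionsOf (D.parabolic I) :=
      ⟨Subgroup.subset_closure ⟨s, hs, rfl⟩, s.2.1.2⟩
    have h2 : LinearMap.range (complexify (s : X ≃ₗ[ℝ] X) - 1) ≤ D.rootSpan I :=
      le_iSup₂_of_le (f := fun s (_ : s ∈ reflectionsOf (D.parabolic I)) =>
        LinearMap.range (complexify s - 1)) _ h1 le_rfl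
    exact h2 ⟨z, rfl⟩
  | one =>
    rw [complexify_one, Module.End.one_apply, sub_self]
    exact zero_mem _
  | mul x y _ _ hx hy =>
    rw [complexify_mul_apply]
    have := add_mem (hx (complexify y z)) (hy z)
    rwa [sub_add_sub_cancel] at this
  | inv x _ hx =>
    have h := neg_mem (hx (complexify x⁻¹ z))
    have h1 : complexify x (complexify x⁻¹ z) = z := by
      have := complexify_inv_apply x⁻¹ z
      rwa [inv_inv] at this
    rwa [h1, neg_sub] at h

theorem complexify_mem_rootSpan {I : Set D.S} {u : X ≃ₗ[ℝ] X} (hu : u ∈ D.parabolic I)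
    {z : ℂ ⊗[ℝ] X} (hz : z ∈ D.rootSpan I) : complexify u z ∈ D.rootSpan I := by
  have := add_mem (D.complexify_sub_mem_rootSpan hu z) hz
  rwa [sub_add_cancel] at this

theorem smul_sub_avg_mem_rootSpan (I : Set D.S) (z : ℂ ⊗[ℝ] X) :
    ((D.parabolic_finite I).toFinset.card : ℂ) • z - D.avg I z ∈ D.rootSpan I := by
  rw [avg_apply, Nat.cast_smul_eq_nsmul, ← Finset.sum_const, ← Finset.sum_sub_distrib]
  refine Submodule.sum_mem _ fun u hu => ?_
  rw [← neg_sub]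
  exact neg_mem (D.complexify_sub_mem_rootSpan (by simpa using hu) z)

/-- If no eigenvector lies in the span of the root lines, the eigenspace is fixed by `W_I`. -/
theorem eigenspace_le_fixedSpace {I : Set D.S} {g : X ≃ₗ[ℝ] X} {ζ : ℂ}
    (hg : ∀ h, g⁻¹ * h * g ∈ D.parabolic I ↔ h ∈ D.parabolic I)
    (h : ∀ x ∈ D.rootSpan I, complexify g x = ζ • x → x = 0) :
    Module.End.eigenspace (complexify g) ζ ≤ D.fixedSpace I := by
  intro z hz
  rw [Module.End.mem_eigenspace_iff] at hz
  -- Averaging commutes with g, so this component of z in the root span is again an eigenvector and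
  -- must vanish.
  have h1 := h _ (D.smul_sub_avg_mem_rootSpan I z) (by
    rw [map_sub, map_smul, D.complexify_avg hg, hz, map_smul, smul_sub, smul_comm])
  rw [sub_eq_zero] at h1
  have h2 := D.avg_mem_fixedSpace I z
  rw [← h1] at h2
  exact (Submodule.smul_mem_iff _ (D.card_parabolic_ne_zero I)).1 h2

variable {D} [FiniteDimensional ℝ X] {I : Set D.S} {d : ℕ} {b : D.BraidMonoid}

theorem imM_mem_parabolic {v : D.BraidMonoid} (hv : v ∈ D.parabolicMonoid I) :
    D.imM v ∈ D.parabolic I := by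
  induction hv using Submonoid.closure_induction with
  | mem x hx =>
    obtain ⟨s, hs, rfl⟩ := hx
    rw [imM_gen]
    exact D.coe_mem_parabolic hs
  | one => rw [imM_one]; exact one_mem _
  | mul x y _ _ hx hy => rw [imM_mul]; exact mul_mem hx hy

theorem imageφ_mul (v b : D.BraidMonoid) : D.imageφ (v * b) = D.imM v * D.imageφ b := by
  rw [imageφ, map_mul, map_mul, mul_assoc]; rfl

theorem conj_mem_parabolic_mul {g u : X ≃ₗ[ℝ] X}
    (hg : ∀ h, g⁻¹ * h * g ∈ D.parabolic I ↔ h ∈ D.parabolic I) (hu : u ∈ D.parabolic I)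
    (h : X ≃ₗ[ℝ] X) : (u * g)⁻¹ * h * (u * g) ∈ D.parabolic I ↔ h ∈ D.parabolic I := by
  have e : (u * g)⁻¹ * h * (u * g) = g⁻¹ * (u⁻¹ * h * u) * g := by group
  rw [e, hg, D.conj_mem_parabolic hu]

/-- A root that is not maximal has an eigenvector in the span of the root lines. -/
theorem IsRoot.exists_eigenvector (hd : 0 < d) (hI : D.IsStable d I) (hroot : D.IsRoot d b I)
    (h : ¬ D.IsMaximalRoot d b I) : ∃ u ∈ D.parabolic I, ∃ x ∈ D.rootSpan I, x ≠ 0 ∧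
      complexify (u * D.imageφ b) x = zeta d • x := by
  rw [IsMaximalRoot, not_not] at h
  obtain ⟨J, hJI, hJ, v, hv, hroot'⟩ := h
  have hvI := imM_mem_parabolic hv
  refine ⟨D.imM v, hvI, ?_⟩
  by_contra hcon
  push Not at hcon
  have h1 := D.eigenspace_le_fixedSpace (g := D.imM v * D.imageφ b) (ζ := zeta d)
    (conj_mem_parabolic_mul (hroot.carries hd hI).conj_mem hvI) (fun x hx hxe => by
      by_contra hx0
      exact hcon x hx hx0 hxe)
  rw [← imageφ_mul] at h1
  -- Assertion (ii) for the root v * b and J bounds the stabilizer of its eigenspace, which by `h1`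
  -- contains W_I.
  have h2 : D.parabolic I ≤ D.parabolic J := by
    refine le_trans (fun u hu => ?_) (hroot'.centralizer_le hd hJ)
    exact ⟨D.parabolic_le I hu, fun x hx => D.mem_fixedSpace.1 (h1 hx) u hu⟩
  obtain ⟨s, hs, hsJ⟩ := Set.exists_of_ssubset hJI
  exact hsJ (D.coe_mem_parabolic_iff.1 (h2 (D.coe_mem_parabolic hs)))

end RealReflectionCoset

namespace RealReflectionCoset

variable {X : Type*} [AddCommGroup X] [Module ℝ X] (D : RealReflectionCoset X)
  [FiniteDimensional ℝ X]

/-! ### Eigenvectors with dominant real part -/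

/-- Transitivity on chambers is available only for regular points, so a is first moved towards x₀;
the weak inequalities survive the return to a. -/
theorem exists_parabolic_dominant (I : Set D.S) (a : X) : ∃ k ∈ D.parabolic I,
    ∀ t ∈ D.arr.R, t ∈ D.parabolic I → 0 ≤ D.arr.F t (k a) := by
  let A : ReflectionArrangement X :=
    { D.arr with
      R := {t | t ∈ D.arr.R ∧ t ∈ D.parabolic I}
      finite := D.arr.finite.subset fun t ht => ht.1
      isReflection := fun t ht => D.arr.isReflection t ht.1
      conj := fun s hs t ht => ⟨D.arr.conj s hs.1 t ht.1,
        mul_mem (mul_mem hs.2 ht.2) (inv_mem hs.2)⟩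
      invariant := fun t ht => D.arr.invariant t ht.1
      regular := fun t ht => D.arr.regular t ht.1 }
  have hsign : ∀ t ∈ A.R, ∀ y, 0 < A.F t y ↔ 0 < D.arr.F t y := fun t ht y =>
    ReflectionArrangement.F_pos_iff (A := A) (A' := D.arr) ht ht.1
      (ReflectionArrangement.F_pos ht.1) y
  have := D.arr.finite.to_subtype
  obtain ⟨ε, hε, hε'⟩ := exists_pos_perturbation (fun t : D.arr.R => D.arr.F t a)
    (fun t : D.arr.R => D.arr.F t D.arr.x₀)
  have hq : ∀ t, D.arr.F t (a + ε • D.arr.x₀) = D.arr.F t a + ε * D.arr.F t D.arr.x₀ := by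
    intro t
    rw [map_add, map_smul, smul_eq_mul]
  have hq0 : ∀ t ∈ D.arr.R, D.arr.F t (a + ε • D.arr.x₀) ≠ 0 := by
    intro t ht
    rw [hq]
    rcases lt_trichotomy (D.arr.F t a) 0 with h | h | h
    · exact ((hε' ⟨t, ht⟩).2 h).ne
    · rw [h, zero_add]
      exact (mul_pos hε (ReflectionArrangement.F_pos ht)).ne'
    · exact ((hε' ⟨t, ht⟩).1 h).ne'
  obtain ⟨k, hk, hpos⟩ := A.exists_mem_closure_walls (a + ε • D.arr.x₀) (fun t ht h0 => by
    have h1 := (ReflectionArrangement.apply_eq_iff ht _).2 h0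
    rw [ReflectionArrangement.apply_eq_iff ht.1] at h1
    exact hq0 t ht.1 h1)
  have hkI : k ∈ D.parabolic I :=
    (Subgroup.closure_le (D.parabolic I)).2 (fun t ht => ht.1.2) hk
  refine ⟨k, hkI, fun t ht htI => ?_⟩
  have h1 := (hsign t ⟨ht, htI⟩ _).1 (hpos t ⟨ht, htI⟩)
  have ht' := (D.conj_mem_arr_R (D.mem_normalizer (D.parabolic_le I hkI))).2 ht
  obtain ⟨c, hc, hF⟩ := ReflectionArrangement.exists_F_comp ht ht'
  rw [hF, hq] at h1
  rw [hF]
  rcases lt_trichotomy (D.arr.F (k⁻¹ * t * k) a) 0 with h | h | h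
  · exact (mul_pos_of_neg_of_neg (neg_of_mul_pos_left h1 ((hε' ⟨_, ht'⟩).2 h).le) h).le
  · rw [h, mul_zero]
  · exact (mul_pos (pos_of_mul_pos_left h1 ((hε' ⟨_, ht'⟩).1 h).le) h).le

variable {D} {I : Set D.S}

theorem complexify_conj_eq {k t : X ≃ₗ[ℝ] X} {z : ℂ ⊗[ℝ] X} :
    complexify (k⁻¹ * t * k) z = z ↔ complexify t (complexify k z) = complexify k z := by
  rw [complexify_mul_apply, complexify_mul_apply]
  constructor
  · intro h
    have := congrArg (complexify k) h
    rw [← complexify_mul_apply, mul_inv_cancel, complexify_one] at this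
    exact this
  · intro h
    rw [h, complexify_inv_apply]

/-- A generic complex multiple of x has real part only on hyperplanes whose reflection fixes x
itself. An element of W_I then makes the real part dominant. The generic multiple is nonzero since
x, lying in the root span, is not fixed by W_I. -/
theorem exists_dominant_eigenvector {T : X ≃ₗ[ℝ] X} {ζ : ℂ} (hT : D.Carries T I I)
    (h : ∃ u ∈ D.parabolic I, ∃ x ∈ D.rootSpan I, x ≠ 0 ∧ complexify (u * T) x = ζ • x) :
    ∃ u ∈ D.parabolic I, ∃ x ∈ D.rootSpan I, x ≠ 0 ∧ complexify (u * T) x = ζ • x ∧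
      ∀ t ∈ D.arr.R, t ∈ D.parabolic I → 0 ≤ D.arr.F t (complexRe x) ∧
        (D.arr.F t (complexRe x) = 0 → complexify t x = x) := by
  obtain ⟨u, hu, x, hx, hx0, hux⟩ := h
  obtain ⟨x', hx', hgen⟩ := D.exists_generic (Submodule.span ℂ {x})
  obtain ⟨c, rfl⟩ := Submodule.mem_span_singleton.1 hx'
  have hc : c ≠ 0 := by
    rintro rfl
    refine hx0 (D.eq_zero_of_mem_rootSpan hx ?_)
    have h1 : ∀ t ∈ D.arr.R, complexify t x = x := by
      intro t ht
      rcases hgen t ht with h2 | h2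
      · exact h2 x (Submodule.mem_span_singleton_self x)
      · simp at h2
    have h2 : ∀ v ∈ D.parabolic I, v ∈ D.centralizer (Submodule.span ℂ {x}) := by
      have : D.parabolic I ≤ D.centralizer (Submodule.span ℂ {x}) := by
        rw [parabolic, Subgroup.closure_le]
        rintro _ ⟨s, -, rfl⟩
        refine ⟨s.2.1.1, fun z hz => ?_⟩
        obtain ⟨e, rfl⟩ := Submodule.mem_span_singleton.1 hz
        rw [map_smul, h1 s (D.coe_mem_R s)]
      exact this
    exact D.mem_fixedSpace.2 fun v hv => (h2 v hv).2 x (Submodule.mem_span_singleton_self x)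
  have hgen' : ∀ t ∈ D.arr.R, D.arr.F t (complexRe (c • x)) = 0 → complexify t (c • x) = c • x := by
    intro t ht h0
    rcases hgen t ht with h2 | h2
    · exact h2 _ hx'
    · exact absurd h0 h2
  obtain ⟨k, hk, hdom⟩ := D.exists_parabolic_dominant I (complexRe (c • x))
  have hkW := D.parabolic_le I hk
  have hTk : T * k⁻¹ * T⁻¹ ∈ D.parabolic I := hT.conj_mem' (inv_mem hk)
  -- Conjugating u T by k stays in the coset W_I T, because T normalizes W_I.
  refine ⟨k * u * (T * k⁻¹ * T⁻¹), mul_mem (mul_mem hk hu) hTk, complexify k (c • x),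
    D.complexify_mem_rootSpan hk (Submodule.smul_mem _ _ hx), ?_, ?_, fun t ht htI => ⟨?_, ?_⟩⟩
  · intro h0
    have := complexify_inv_apply k (c • x)
    rw [h0, map_zero] at this
    exact smul_ne_zero hc hx0 this.symm
  · have e : k * u * (T * k⁻¹ * T⁻¹) * T = k * (u * T) * k⁻¹ := by group
    rw [e, complexify_mul_apply, complexify_inv_apply, complexify_mul_apply, map_smul, hux,
      smul_comm, map_smul]
  · rw [complexRe_complexify]
    exact hdom t ht htI
  · intro h0
    have ht' := (D.conj_mem_arr_R (D.mem_normalizer hkW)).2 ht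
    obtain ⟨e, he, hF⟩ := ReflectionArrangement.exists_F_comp ht ht'
    rw [complexRe_complexify, hF] at h0
    have h1 := hgen' _ ht' ((mul_eq_zero.1 h0).resolve_left he)
    exact complexify_conj_eq.1 h1

/-- The stabilizer in `W_I` of a vector with dominant real part is standard parabolic. -/
theorem mem_parabolic_of_apply_eq {x : ℂ ⊗[ℝ] X}
    (hdom : ∀ t ∈ D.arr.R, t ∈ D.parabolic I → 0 ≤ D.arr.F t (complexRe x) ∧
        (D.arr.F t (complexRe x) = 0 → complexify t x = x)) {w : X ≃ₗ[ℝ] X}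
    (hw : w ∈ D.parabolic I) (hwx : w (complexRe x) = complexRe x) :
    w ∈ D.parabolic {s | s ∈ I ∧ complexify (s : X ≃ₗ[ℝ] X) x = x} := by
  set J : Set D.S := {s | s ∈ I ∧ complexify (s : X ≃ₗ[ℝ] X) x = x} with hJ
  obtain ⟨p, hp, q, hpq, hq⟩ := D.cocycle.exists_par_decomp J ⟨w, D.parabolic_le I hw⟩
  rw [← mem_parabolic_iff] at hp
  have hpq' : w = p * q := congrArg Subtype.val hpq
  have hJI : D.parabolic J ≤ D.parabolic I :=
    Subgroup.closure_mono (Set.image_mono fun s hs => hs.1)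
  have hpx : (p : X ≃ₗ[ℝ] X) (complexRe x) = complexRe x := by
    have : D.parabolic J ≤ MulAction.stabilizer (X ≃ₗ[ℝ] X) (complexRe x) := by
      rw [parabolic, Subgroup.closure_le]
      rintro _ ⟨s, hs, rfl⟩
      change (s : X ≃ₗ[ℝ] X) (complexRe x) = complexRe x
      rw [← complexRe_complexify, hs.2]
    exact this hp
  have hqx : (q : X ≃ₗ[ℝ] X) (complexRe x) = complexRe x := by
    rw [hpq', LinearEquiv.mul_apply] at hwx
    apply (p : X ≃ₗ[ℝ] X).injective
    rw [hwx, hpx]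
  have hqI : (q : X ≃ₗ[ℝ] X) ∈ D.parabolic I := by
    have : (q : X ≃ₗ[ℝ] X) = (p : X ≃ₗ[ℝ] X)⁻¹ * w := by rw [hpq']; group
    rw [this]
    exact mul_mem (inv_mem (hJI hp)) hw
  -- A simple inversion s of q would be in I but not in J, so its form is positive on the real part
  -- of x. The negative factor comparing it with its q-conjugate contradicts dominance, as q fixes
  -- that real part.
  have hq1 : q = 1 := by
    by_contra hne
    obtain ⟨s, hs⟩ := D.cocycle.exists_s_mem_N hne
    have hsI : s ∈ I := D.coe_mem_parabolic_iff.1 (D.inv_subset_parabolic hqI hs)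
    have hsJ : s ∉ J := fun h => hq _ (D.cocycle.s_mem_par h) hs
    have hsR := D.coe_mem_R s
    have hsdom := hdom s hsR (D.coe_mem_parabolic hsI)
    have hpos : 0 < D.arr.F s (complexRe x) :=
      lt_of_le_of_ne hsdom.1 fun h => hsJ ⟨hsI, hsdom.2 h.symm⟩
    have hs' := (D.conj_mem_arr_R (D.mem_normalizer q.2)).2 hsR
    obtain ⟨c, hc, hF⟩ := ReflectionArrangement.exists_F_comp hsR hs'
    have h1 : D.arr.F s ((q : X ≃ₗ[ℝ] X) D.arr.x₀) < 0 := hs.2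
    rw [hF] at h1
    have h2 := neg_of_mul_neg_left h1 (ReflectionArrangement.F_pos hs').le
    have h3 := (hdom _ hs' ((D.conj_mem_parabolic hqI _).2 (D.coe_mem_parabolic hsI))).1
    have h4 := hF (complexRe x)
    rw [hqx] at h4
    have := mul_nonpos_of_nonpos_of_nonneg h2.le h3
    linarith
  rw [hpq', hq1]
  simpa using hp

/-- An eigenvector in the span of the root lines gives an element of the coset that preserves the
chamber of a proper standard parabolic subgroup, its stabilizer. -/
theorem exists_adapted {T : X ≃ₗ[ℝ] X} {ζ : ℂ} (hT : D.Carries T I I) (hζ : ζ ≠ 0)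
    (h : ∃ u ∈ D.parabolic I, ∃ x ∈ D.rootSpan I, x ≠ 0 ∧ complexify (u * T) x = ζ • x) :
    ∃ u ∈ D.parabolic I, ∃ x : ℂ ⊗[ℝ] X, ∃ J, J ⊂ I ∧ complexify (u * T) x = ζ • x ∧
      (∀ w ∈ D.parabolic I, w ∈ D.parabolic J ↔ complexify w x = x) ∧
      (∀ t ∈ D.arr.R, t ∈ D.parabolic I → t ∉ D.parabolic J → 0 < D.arr.F t (complexRe x)) ∧
      D.Carries (u * T) J J := by
  obtain ⟨u, hu, x, hx, hx0, hux, hdom⟩ := exists_dominant_eigenvector hT h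
  set J : Set D.S := {s | s ∈ I ∧ complexify (s : X ≃ₗ[ℝ] X) x = x} with hJ
  have hJIle : D.parabolic J ≤ D.parabolic I :=
    Subgroup.closure_mono (Set.image_mono fun s hs => hs.1)
  have hJx : ∀ w ∈ D.parabolic J, complexify w x = x := by
    have : D.parabolic J ≤ D.centralizer (Submodule.span ℂ {x}) := by
      rw [parabolic, Subgroup.closure_le]
      rintro _ ⟨s, hs, rfl⟩
      refine ⟨s.2.1.1, fun z hz => ?_⟩
      obtain ⟨e, rfl⟩ := Submodule.mem_span_singleton.1 hz
      rw [map_smul, hs.2]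
    exact fun w hw => (this hw).2 x (Submodule.mem_span_singleton_self x)
  have hmem : ∀ w ∈ D.parabolic I, w ∈ D.parabolic J ↔ complexify w x = x := by
    intro w hw
    refine ⟨hJx w, fun hwx => mem_parabolic_of_apply_eq hdom hw ?_⟩
    rw [← complexRe_complexify, hwx]
  have hJne : J ≠ I := by
    intro h1
    rw [h1] at hJx
    exact hx0 (D.eq_zero_of_mem_rootSpan hx (D.mem_fixedSpace.2 hJx))
  -- The factor p fixes x, so it can be dropped without losing the eigenvector. The remaining q has
  -- no inversion in W_J, hence q T preserves the chamber of W_J.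
  obtain ⟨p, hp, q, hpq, hq⟩ := D.cocycle.exists_par_decomp J ⟨u, D.parabolic_le I hu⟩
  rw [← mem_parabolic_iff] at hp
  have hpq' : u = p * q := congrArg Subtype.val hpq
  have hq' : (q : X ≃ₗ[ℝ] X) = (p : X ≃ₗ[ℝ] X)⁻¹ * u := by rw [hpq']; group
  have hqI : (q : X ≃ₗ[ℝ] X) ∈ D.parabolic I := by
    rw [hq']
    exact mul_mem (inv_mem (hJIle hp)) hu
  have hqx : complexify ((q : X ≃ₗ[ℝ] X) * T) x = ζ • x := by
    rw [hq', mul_assoc, complexify_mul_apply, hux, map_smul, hJx _ (inv_mem hp)]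
  refine ⟨q, hqI, x, J, (Set.ssubset_iff_subset_ne).2 ⟨fun s hs => hs.1, hJne⟩, hqx, hmem,
    fun t ht htI htJ => ?_, ⟨?_, fun w => ?_, fun t htJ ht => ?_⟩⟩
  · refine lt_of_le_of_ne (hdom t ht htI).1 fun h0 => htJ ?_
    exact (hmem t htI).2 ((hdom t ht htI).2 h0.symm)
  · exact mul_mem (D.mem_normalizer q.2) hT.normalizes
  · have h1 := conj_mem_parabolic_mul hT.conj_mem hqI w
    have h2 : complexify (((q : X ≃ₗ[ℝ] X) * T)⁻¹ * w * ((q : X ≃ₗ[ℝ] X) * T)) x = x ↔ complexify w x = x := by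
      rw [complexify_conj_eq, hqx, map_smul]
      exact ⟨fun h => smul_right_injective _ hζ h, fun h => by rw [h]⟩
    by_cases hwI : w ∈ D.parabolic I
    · rw [hmem _ (h1.2 hwI), hmem _ hwI, h2]
    · exact iff_of_false (fun h => hwI (h1.1 (hJIle h))) (fun h => hwI (hJIle h))
  · rw [D.mem_inv_mul (D.mem_normalizer q.2) hT.normalizes] at ht
    have h1 : t ∉ D.inv q := by
      intro h
      have h2 := hq ⟨t, D.parabolic_le J htJ⟩ ((D.mem_parabolic_iff J _).1 htJ)
      exact h2 h
    have h2 := hT.notMem_inv _ ((D.conj_mem_parabolic hqI t).2 (hJIle htJ))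
    tauto

end RealReflectionCoset

/-! ### Rotation angles and the positive lift of π_I / π_J -/

theorem cos_neg_iff_of_mem {α : ℝ} (h1 : -(Real.pi / 2) < α) (h2 : α < 2 * Real.pi + Real.pi / 2) :
    Real.cos α < 0 ↔ Real.pi / 2 < α ∧ α < 3 * Real.pi / 2 := by
  constructor
  · intro h
    constructor
    · by_contra hcon
      exact (Real.cos_nonneg_of_mem_Icc ⟨h1.le, not_lt.1 hcon⟩).not_gt h
    · by_contra hcon
      have h3 := Real.cos_nonneg_of_mem_Icc (x := α - 2 * Real.pi) ⟨by linarith, by linarith⟩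
      rw [Real.cos_sub_two_pi] at h3
      exact h3.not_gt h
  · rintro ⟨h3, h4⟩
    exact Real.cos_neg_of_pi_div_two_lt_of_lt h3 (by linarith)

namespace RealReflectionCoset

theorem zeta_pow_mul_re (d j : ℕ) (z : ℂ) :
    (zeta d ^ j * z).re = ‖z‖ * Real.cos (z.arg + 2 * Real.pi * j / d) := by
  have h : zeta d ^ j * z =
      (‖z‖ : ℂ) * Complex.exp (((z.arg + 2 * Real.pi * j / d : ℝ) : ℂ) * Complex.I) := by
    conv_lhs => rw [← Complex.norm_mul_exp_arg_mul_I z]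
    rw [zeta, ← Complex.exp_nat_mul, mul_left_comm, ← Complex.exp_add]
    congr 2
    push_cast
    ring
  rw [h, Complex.re_ofReal_mul, Complex.exp_ofReal_mul_I_re]

/-- A number with positive real part has argument strictly between -π/2 and π/2, so one turn
contains a single interval where the rotated real part is negative. -/
theorem zeta_pow_mul_re_neg_iff {d j : ℕ} (hd : 0 < d) (hj : j ≤ d) {z : ℂ} (hz : 0 < z.re) :
    (zeta d ^ j * z).re < 0 ↔ Real.pi / 2 < z.arg + 2 * Real.pi * j / d ∧
      z.arg + 2 * Real.pi * j / d < 3 * Real.pi / 2 := by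
  have hz0 : 0 < ‖z‖ := norm_pos_iff.2 fun h => by rw [h] at hz; simp at hz
  have harg := abs_lt.1 (Complex.abs_arg_lt_pi_div_two_iff.2 (Or.inl hz))
  have hd' : (0 : ℝ) < d := by exact_mod_cast hd
  have hj' : (j : ℝ) ≤ d := by exact_mod_cast hj
  have h0 : 0 ≤ 2 * Real.pi * j / d := by positivity
  have h1 : 2 * Real.pi * j / d ≤ 2 * Real.pi := by
    rw [div_le_iff₀ hd']
    exact mul_le_mul_of_nonneg_left hj' Real.two_pi_pos.le
  rw [zeta_pow_mul_re, ← cos_neg_iff_of_mem (by linarith) (by linarith)]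
  constructor
  · intro h
    exact neg_of_mul_neg_right h hz0.le
  · exact mul_neg_of_pos_of_neg hz0

variable {X : Type*} [AddCommGroup X] [Module ℝ X] {D : RealReflectionCoset X}
  [FiniteDimensional ℝ X] {I J : Set D.S}

theorem _root_.ReflectionCocycle.mem_N_inv_mul {G ι : Type*} [Group G]
    (K : ReflectionCocycle G ι) (z p t : G) :
    t ∈ K.N (z⁻¹ * p) ↔ ¬ (z * t * z⁻¹ ∈ K.N z ↔ z * t * z⁻¹ ∈ K.N p) := by
  have h := K.mem_N_mul (z * t * z⁻¹) z (z⁻¹ * p)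
  rw [mul_inv_cancel_left] at h
  have e : z⁻¹ * (z * t * z⁻¹) * z = t := by group
  rw [e] at h
  tauto

theorem L_mem_parabolicMonoid {w : D.W} (hw : (w : X ≃ₗ[ℝ] X) ∈ D.parabolic I) :
    D.cocycle.L D.coxeterMatrix w ∈ D.parabolicMonoid I := by
  obtain ⟨l, hlI, rfl, hl⟩ :=
    D.cocycle.exists_reduced_of_mem_par ((D.mem_parabolic_iff I w).1 hw)
  rw [D.cocycle.L_word D.coxeterMatrix_eq hl.symm]
  refine Submonoid.list_prod_mem _ fun a ha => ?_
  obtain ⟨s, hs, rfl⟩ := List.mem_map.1 ha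
  exact Submonoid.subset_closure ⟨s, hlI s hs, rfl⟩

theorem commute_L_wI_sq {m : D.BraidMonoid} (hm : m ∈ D.parabolicMonoid I) :
    Commute m (D.cocycle.L D.coxeterMatrix (D.cocycle.wI I) ^ 2) := by
  induction hm using Submonoid.closure_induction with
  | mem x hx =>
    obtain ⟨s, hs, rfl⟩ := hx
    exact D.cocycle.gen_mul_L_wI_sq D.coxeterMatrix_eq hs
  | one => exact Commute.one_left _
  | mul x y _ _ hx hy => exact hx.mul_left hy

theorem mem_N_wI_mul_wI (hJI : J ⊆ I) (t : D.W) :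
    t ∈ D.cocycle.N (D.cocycle.wI J * D.cocycle.wI I) ↔
      t ∈ D.cocycle.refl ∧ t ∈ D.cocycle.par I ∧ t ∉ D.cocycle.par J := by
  have hw := D.cocycle.wI_mem J
  have hw' := D.cocycle.par_mono hJI hw
  rw [D.cocycle.mem_N_mul, ReflectionCocycle.N_wI, ReflectionCocycle.N_wI, Set.mem_inter_iff,
    Set.mem_inter_iff, D.cocycle.mem_refl_conj, SetLike.mem_coe, SetLike.mem_coe,
    Subgroup.mul_mem_cancel_right _ hw', Subgroup.mul_mem_cancel_left _ (inv_mem hw')]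
  have : t ∈ D.cocycle.par J → t ∈ D.cocycle.par I := fun h => D.cocycle.par_mono hJI h
  tauto

/-- The lift of `π_I / π_J` to the braid monoid. -/
theorem toB_L_mul_L_inv (hJI : J ⊆ I) :
    D.toB (D.cocycle.L D.coxeterMatrix (D.cocycle.wI J * D.cocycle.wI I)) *
      D.toB (D.cocycle.L D.coxeterMatrix (D.cocycle.wI J * D.cocycle.wI I)⁻¹) =
        D.piElt I * (D.piElt J)⁻¹ := by
  have hM := D.coxeterMatrix_eq
  set z := D.cocycle.wI J * D.cocycle.wI I with hz
  have hwJ := D.cocycle.wI_mul_self J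
  have hzI : z ∈ D.cocycle.par I :=
    mul_mem (D.cocycle.par_mono hJI (D.cocycle.wI_mem J)) (D.cocycle.wI_mem I)
  -- Both w_I = w_J z and w_I = z⁻¹ w_J are reduced, so π_I is the product of the lifts of w_J, z,
  -- z⁻¹ and w_J. The outer factors then combine because the lift of w_J commutes with π_I.
  have h1 : D.cocycle.wI J * z = D.cocycle.wI I := by rw [hz, ← mul_assoc, hwJ, one_mul]
  have h2 : z⁻¹ * D.cocycle.wI J = D.cocycle.wI I := by
    rw [inv_mul_eq_iff_eq_mul, hz, mul_assoc, D.cocycle.wI_mul_self, mul_one]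
  have h3 := D.cocycle.L_mul hM (u := D.cocycle.wI J) (v := z) (by
    rw [h1, ReflectionCocycle.N_wI, ReflectionCocycle.N_wI]
    exact Set.inter_subset_inter_right _ (D.cocycle.par_mono hJI))
  have h4 := D.cocycle.L_mul hM (u := z⁻¹) (v := D.cocycle.wI J) (by
    rw [h2, ReflectionCocycle.N_wI]
    exact Set.subset_inter (D.cocycle.N_subset_refl _) (D.cocycle.N_subset_par (inv_mem hzI)))
  rw [h1] at h3
  rw [h2] at h4
  have h5 : Commute (D.toB (D.cocycle.L D.coxeterMatrix (D.cocycle.wI J))) (D.piElt I) := by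
    rw [piElt_eq]
    refine (commute_L_wI_sq (L_mem_parabolicMonoid ?_)).map D.toB
    exact (D.mem_parabolic_iff I _).2 (D.cocycle.par_mono hJI (D.cocycle.wI_mem J))
  have h6 := congrArg D.toB h3
  have h7 := congrArg D.toB h4
  rw [map_mul] at h6 h7
  have h8 : D.piElt I = D.toB (D.cocycle.L D.coxeterMatrix (D.cocycle.wI I)) *
    D.toB (D.cocycle.L D.coxeterMatrix (D.cocycle.wI I)) := by rw [piElt, longestLift_eq, sq]
  have h9 : D.piElt J = D.toB (D.cocycle.L D.coxeterMatrix (D.cocycle.wI J)) *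
    D.toB (D.cocycle.L D.coxeterMatrix (D.cocycle.wI J)) := by rw [piElt, longestLift_eq, sq]
  rw [eq_mul_inv_iff_mul_eq, h9]
  apply mul_left_cancel (a := D.toB (D.cocycle.L D.coxeterMatrix (D.cocycle.wI J)))
  rw [h5.eq, h8]
  nth_rewrite 1 [h6]
  nth_rewrite 1 [h7]
  simp only [mul_assoc]

end RealReflectionCoset

/-! ### Building a root for a smaller J from an eigenvector -/

namespace RealReflectionCoset

variable {X : Type*} [AddCommGroup X] [Module ℝ X] {D : RealReflectionCoset X}
  [FiniteDimensional ℝ X] {I J : Set D.S} {d : ℕ} {b : D.BraidMonoid}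

/-- The lift of an element of `W` to `B ⋊ ⟨φ⟩`. -/
def lift (D : RealReflectionCoset X) (w : D.W) : D.BSemi :=
  SemidirectProduct.inl (D.toB (D.cocycle.L D.coxeterMatrix w))

theorem lift_one : D.lift 1 = 1 := by
  rw [lift, D.cocycle.L_one D.coxeterMatrix_eq, map_one, map_one]

theorem lift_mul {u v : D.W} (h : D.cocycle.N u ⊆ D.cocycle.N (u * v)) :
    D.lift (u * v) = D.lift u * D.lift v := by
  rw [lift, D.cocycle.L_mul D.coxeterMatrix_eq h, map_mul, map_mul]; rfl

theorem IsRoot.pow_conj_lift (hd : 0 < d) (hI : D.IsStable d I) (hroot : D.IsRoot d b I)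
    {u : D.W} (hu : (u : X ≃ₗ[ℝ] X) ∈ D.parabolic I) {q : ℕ → D.W}
    (hq : ∀ j, (q j : X ≃ₗ[ℝ] X) = D.imageφ b ^ j * u * (D.imageφ b ^ j)⁻¹) (j : ℕ) :
    D.mulφ b ^ j * D.lift u = D.lift (q j) * D.mulφ b ^ j := by
  have hT := hroot.carries hd hI
  induction j with
  | zero =>
    have : q 0 = u := Subtype.ext (by rw [hq]; simp)
    rw [this, pow_zero, one_mul, mul_one]
  | succ j ih =>
    have h1 : (q j : X ≃ₗ[ℝ] X) ∈ D.parabolic I := by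
      rw [hq]; exact (hT.pow j).conj_mem' hu
    have h2 := hroot.conj_L hd hI (u := q j) (v := q (j + 1)) h1 (by
      rw [hq, hq, pow_succ']; group)
    rw [mul_inv_eq_iff_eq_mul] at h2
    change D.mulφ b * D.lift (q j) = D.lift (q (j + 1)) * D.mulφ b at h2
    rw [pow_succ', mul_assoc, ih, ← mul_assoc, h2, mul_assoc]

/-- Product of a sequence of lifts going up to `z`, and then down to `1`. -/
theorem mul_pow_eq_lift_mul_lift_inv {ψ : D.BSemi} {u z : D.W} {p q : ℕ → D.W} {d e : ℕ}
    (he : e < d) (hp0 : p 0 = 1) (hpd : p d = 1) (hpq : ∀ j, p (j + 1) = p j * q j)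
    (hψ : ∀ j, ψ ^ j * D.lift u = D.lift (q j) * ψ ^ j)
    (hup : ∀ j < e, D.cocycle.N (p j) ⊆ D.cocycle.N (p (j + 1)))
    (hz : ∀ j ≤ d, D.cocycle.N (p j) ⊆ D.cocycle.N z)
    (hmid : D.cocycle.N z ⊆ D.cocycle.N (p e) ∪ D.cocycle.N (p (e + 1)))
    (hdown : ∀ j, e < j → j < d → D.cocycle.N (p (j + 1)) ⊆ D.cocycle.N (p j)) :
    (D.lift u * ψ) ^ d = D.lift z * D.lift z⁻¹ * ψ ^ d := by
  have hstep : ∀ n a, (D.lift u * ψ) ^ n = a * ψ ^ n →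
      (D.lift u * ψ) ^ (n + 1) = a * D.lift (q n) * ψ ^ (n + 1) := by
    intro n a h
    rw [pow_succ, h, mul_assoc, ← mul_assoc (ψ ^ n), hψ, mul_assoc (D.lift (q n)), ← pow_succ,
      mul_assoc]
  have hq : ∀ n, q n = (p n)⁻¹ * p (n + 1) := fun n => by rw [hpq, inv_mul_cancel_left]
  have h1 : ∀ n ≤ e, (D.lift u * ψ) ^ n = D.lift (p n) * ψ ^ n := by
    intro n
    induction n with
    | zero => intro _; rw [hp0, lift_one, pow_zero, pow_zero, mul_one]
    | succ n ih =>
      intro hn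
      rw [hstep n _ (ih (by omega)), hpq, lift_mul]
      rw [← hpq]
      exact hup n (by omega)
  have h2 : (D.lift u * ψ) ^ (e + 1) =
      D.lift z * D.lift (z⁻¹ * p (e + 1)) * ψ ^ (e + 1) := by
    -- The turning step need not stop at z. The hypothesis `hmid` makes q e a reduced product of a
    -- climb from p e to z and a descent to p (e + 1).
    have e1 : q e = (p e)⁻¹ * z * (z⁻¹ * p (e + 1)) := by rw [hq]; group
    have e2 : D.lift z = D.lift (p e) * D.lift ((p e)⁻¹ * z) := by
      rw [← lift_mul, mul_inv_cancel_left]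
      rw [mul_inv_cancel_left]
      exact hz e he.le
    have e3 : D.lift (q e) = D.lift ((p e)⁻¹ * z) * D.lift (z⁻¹ * p (e + 1)) := by
      rw [← lift_mul, ← e1]
      rw [← e1, hq]
      intro t ht
      rw [ReflectionCocycle.mem_N_inv_mul] at ht ⊢
      have h3 := @hz e he.le (p e * t * (p e)⁻¹)
      have h4 := @hmid (p e * t * (p e)⁻¹)
      rw [Set.mem_union] at h4
      tauto
    rw [hstep e _ (h1 e le_rfl), e3, e2]
    simp only [mul_assoc]
  have h3 : ∀ n, e + 1 ≤ n → n ≤ d →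
      (D.lift u * ψ) ^ n = D.lift z * D.lift (z⁻¹ * p n) * ψ ^ n := by
    intro n hn
    induction n, hn using Nat.le_induction with
    | base => exact fun _ => h2
    | succ n hn ih =>
      intro hnd
      have e1 : z⁻¹ * p (n + 1) = z⁻¹ * p n * q n := by rw [hpq, mul_assoc]
      have e2 : D.lift (z⁻¹ * p (n + 1)) = D.lift (z⁻¹ * p n) * D.lift (q n) := by
        rw [← lift_mul, ← e1]
        rw [← e1]
        intro t ht
        rw [ReflectionCocycle.mem_N_inv_mul] at ht ⊢
        have h4 := @hz n (by omega) (z * t * z⁻¹)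
        have h5 := @hdown n (by omega) (by omega) (z * t * z⁻¹)
        tauto
      rw [hstep n _ (ih (by omega)), e2, mul_assoc (D.lift z)]
  rw [h3 d he le_rfl, hpd, mul_one]

/-- A root with an eigenvector in the span of the root lines is not maximal. -/
theorem IsRoot.not_isMaximalRoot (hd : 0 < d) (hI : D.IsStable d I) (hroot : D.IsRoot d b I)
    (h : ∃ u ∈ D.parabolic I, ∃ x ∈ D.rootSpan I, x ≠ 0 ∧
      complexify (u * D.imageφ b) x = zeta d • x) : ¬ D.IsMaximalRoot d b I := by
  have hT := hroot.carries hd hI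
  obtain ⟨u, hu, x, J, hJI, hux, hmem, hpos, hcar⟩ := exists_adapted hT (zeta_ne_zero d) h
  set T := D.imageφ b with hTdef
  set g := u * T with hg
  have hJIle : D.parabolic J ≤ D.parabolic I := Subgroup.closure_mono (Set.image_mono hJI.subset)
  -- the elements `p j = g ^ j T ^ (-j)` of `W_I`
  have hqI : ∀ j : ℕ, T ^ j * u * (T ^ j)⁻¹ ∈ D.parabolic I := fun j => (hT.pow j).conj_mem' hu
  have hpsucc : ∀ j : ℕ, g ^ (j + 1) * (T ^ (j + 1))⁻¹ =
      g ^ j * (T ^ j)⁻¹ * (T ^ j * u * (T ^ j)⁻¹) := by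
    intro j
    rw [pow_succ, pow_succ, hg]
    group
  have hpI : ∀ j : ℕ, g ^ j * (T ^ j)⁻¹ ∈ D.parabolic I := by
    intro j
    induction j with
    | zero => simp [one_mem]
    | succ j ih => rw [hpsucc]; exact mul_mem ih (hqI j)
  set p : ℕ → D.W := fun j => ⟨g ^ j * (T ^ j)⁻¹, D.parabolic_le I (hpI j)⟩ with hp
  set q : ℕ → D.W := fun j => ⟨T ^ j * u * (T ^ j)⁻¹, D.parabolic_le I (hqI j)⟩ with hq
  set z := D.cocycle.wI J * D.cocycle.wI I with hz
  have hgx : ∀ j : ℕ, complexify (g ^ j) x = zeta d ^ j • x := by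
    intro j
    induction j with
    | zero => rw [pow_zero, pow_zero, complexify_one, one_smul]; rfl
    | succ j ih => rw [pow_succ, complexify_mul_apply, hux, map_smul, ih, smul_smul, ← pow_succ']
  have hgN : ∀ j : ℕ, g ^ j ∈ Subgroup.normalizer (D.W : Set (X ≃ₗ[ℝ] X)) := fun j =>
    pow_mem hcar.normalizes j
  have hzN : ∀ t : D.W, t ∈ D.cocycle.N z ↔ (t : X ≃ₗ[ℝ] X) ∈ D.arr.R ∧
      (t : X ≃ₗ[ℝ] X) ∈ D.parabolic I ∧ (t : X ≃ₗ[ℝ] X) ∉ D.parabolic J := by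
    intro t
    rw [hz, mem_N_wI_mul_wI hJI.subset, mem_refl_iff, mem_parabolic_iff, mem_parabolic_iff]
  have hgI : ∀ (j : ℕ) (t : X ≃ₗ[ℝ] X), (g ^ j)⁻¹ * t * g ^ j ∈ D.parabolic I ↔
      t ∈ D.parabolic I := by
    intro j t
    have e : (g ^ j)⁻¹ * t * g ^ j =
      (T ^ j)⁻¹ * ((g ^ j * (T ^ j)⁻¹)⁻¹ * t * (g ^ j * (T ^ j)⁻¹)) * T ^ j := by group
    rw [e, (hT.pow j).conj_mem, D.conj_mem_parabolic (hpI j)]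
  let a : D.W → ℝ := fun t => (complexForm (D.arr.F t) x).arg
  have hzre : ∀ t ∈ D.cocycle.N z, 0 < (complexForm (D.arr.F t) x).re := by
    intro t ht
    obtain ⟨h1, h2, h3⟩ := (hzN t).1 ht
    rw [complexForm_re]
    exact hpos t h1 h2 h3
  have ha : ∀ t ∈ D.cocycle.N z, -(Real.pi / 2) < a t ∧ a t < Real.pi / 2 := fun t ht =>
    abs_lt.1 (Complex.abs_arg_lt_pi_div_two_iff.2 (Or.inl (hzre t ht)))
  -- On W_I, T^j creates no inversion, so p j and g^j have the same inversions there. Outside W_J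
  -- these are detected by the real part of the form of t on g^j x, that is, on x rotated by 2πj/d;
  -- on W_J, g creates none.
  have hpN : ∀ j ≤ d, ∀ t : D.W, t ∈ D.cocycle.N (p j) ↔ t ∈ D.cocycle.N z ∧
      Real.pi / 2 < a t + 2 * Real.pi * j / d ∧ a t + 2 * Real.pi * j / d < 3 * Real.pi / 2 := by
    intro j hj t
    rw [mem_N_iff]
    by_cases htI : (t : X ≃ₗ[ℝ] X) ∈ D.arr.R ∧ (t : X ≃ₗ[ℝ] X) ∈ D.parabolic I
    · obtain ⟨htR, htI⟩ := htI
      have h1 : (t : X ≃ₗ[ℝ] X) ∈ D.inv (g ^ j * (T ^ j)⁻¹) ↔ (t : X ≃ₗ[ℝ] X) ∈ D.inv (g ^ j) := by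
        have h2 := D.mem_inv_mul (hgN j) (inv_mem (hT.pow j).normalizes) t
        have h3 := (hT.pow j).symm.notMem_inv _ ((hgI j t).2 htI)
        tauto
      rw [hp, h1]
      by_cases htJ : (t : X ≃ₗ[ℝ] X) ∈ D.parabolic J
      · exact iff_of_false ((hcar.pow j).notMem_inv _ htJ) fun h => ((hzN t).1 h.1).2.2 htJ
      · have htz := (hzN t).2 ⟨htR, htI, htJ⟩
        rw [and_iff_right htz, ← zeta_pow_mul_re_neg_iff hd hj (hzre t htz), ← smul_eq_mul,
          ← map_smul, ← hgx, complexForm_re, complexRe_complexify]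
        have ht' := (D.conj_mem_arr_R (hgN j)).2 htR
        rw [← ReflectionArrangement.F_neg_iff htR ht' (ReflectionArrangement.F_pos ht')
          (hpos _ ht' ((hgI j t).2 htI) (mt ((hcar.pow j).conj_mem t).1 htJ))]
        exact ⟨fun h => h.2, fun h => ⟨htR, h⟩⟩
    · refine iff_of_false (fun h => htI ⟨h.1, D.inv_subset_parabolic (hpI j) h⟩) fun h => htI ?_
      exact ⟨((hzN t).1 h.1).1, ((hzN t).1 h.1).2.1⟩
  have hd' : (0 : ℝ) < d := by exact_mod_cast hd
  have hpi := Real.pi_pos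
  -- After a full turn every argument would be at least 3π/2, so no inversion is left. This gives
  -- g^d = φ^d, and thus φ^d fixes x and stabilizes J.
  have hpd : p d = 1 := by
    apply D.cocycle.eq_one_of_N_eq_empty
    ext t
    rw [hpN d le_rfl]
    refine iff_of_false (fun h => ?_) (Set.notMem_empty t)
    have h1 := ha t h.1
    have h2 := h.2.2
    rw [mul_div_assoc, div_self hd'.ne'] at h2
    linarith
  have hp0 : p 0 = 1 := Subtype.ext (by simp [hp])
  have hfix : complexify (D.φ ^ d) x = x := by
    have h1 : g ^ d * (T ^ d)⁻¹ = 1 := congrArg Subtype.val hpd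
    rw [← hroot.image_pow, ← hTdef, ← mul_inv_eq_one.1 h1, hgx, zeta_pow d hd, one_smul]
  have hzd : ∀ j ≤ d, D.cocycle.N (p j) ⊆ D.cocycle.N z := fun j hj t ht => ((hpN j hj t).1 ht).1
  obtain ⟨v, hv, hvpow⟩ : ∃ v ∈ D.parabolicMonoid I,
      (SemidirectProduct.inl (D.toB v) * D.mulφ b) ^ d = D.lift z * D.lift z⁻¹ * D.mulφ b ^ d := by
    have hzI : (z : X ≃ₗ[ℝ] X) ∈ D.parabolic I := by
      rw [mem_parabolic_iff]
      exact mul_mem (D.cocycle.par_mono hJI.subset (D.cocycle.wI_mem J)) (D.cocycle.wI_mem I)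
    by_cases hd1 : d = 1
    -- For d = 1 a single step makes the whole turn, and u is trivial, so its lift cannot record π_I
    -- / π_J. The loop through z is taken explicitly.
    · refine ⟨D.cocycle.L D.coxeterMatrix z * D.cocycle.L D.coxeterMatrix z⁻¹,
        mul_mem (L_mem_parabolicMonoid hzI) (L_mem_parabolicMonoid (inv_mem hzI)), ?_⟩
      rw [hd1, pow_one, pow_one, map_mul, map_mul]
      rfl
    · have hq0 : q 0 = ⟨u, D.parabolic_le I hu⟩ := Subtype.ext (by simp [hq])
      refine ⟨D.cocycle.L D.coxeterMatrix ⟨u, D.parabolic_le I hu⟩, L_mem_parabolicMonoid hu, ?_⟩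
      have hle : ∀ j : ℕ, 2 * (j + 1) ≤ d → 2 * Real.pi * (j + 1 : ℕ) / d ≤ Real.pi := by
        intro j hj
        have hj' : (2 * ((j + 1 : ℕ) : ℝ)) ≤ d := by exact_mod_cast hj
        rw [div_le_iff₀ hd']
        nlinarith
      have hge : ∀ j : ℕ, d ≤ 2 * j → Real.pi ≤ 2 * Real.pi * j / d := by
        intro j hj
        have hj' : (d : ℝ) ≤ 2 * j := by exact_mod_cast hj
        rw [le_div_iff₀ hd']
        nlinarith
      have hsucc : ∀ j : ℕ, 2 * Real.pi * (j + 1 : ℕ) / d =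
          2 * Real.pi * j / d + 2 * Real.pi / d := by
        intro j
        push_cast
        ring
      have hstep0 : 0 < 2 * Real.pi / d := by positivity
      have hstep : 2 * Real.pi / d ≤ Real.pi := by
        have : (2 : ℝ) ≤ d := by
          have : 2 ≤ d := by omega
          exact_mod_cast this
        rw [div_le_iff₀ hd']
        nlinarith
      -- The choice e = d / 2 is the last step with 2πe/d ≤ π. Up to it hyperplanes can only be
      -- entered, and after it they can only be left.
      refine mul_pow_eq_lift_mul_lift_inv (p := p) (q := q) (e := d / 2) (by omega) hp0 hpd
        (fun j => Subtype.ext (hpsucc j)) (hroot.pow_conj_lift hd hI hu fun j => rfl) ?_ hzd ?_ ?_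
      · intro j hj t ht
        rw [hpN _ (by omega)] at ht ⊢
        have h1 := ha t ht.1
        have h2 := hle j (by omega)
        have h3 := hsucc j
        exact ⟨ht.1, by linarith [ht.2.1], by linarith⟩
      -- A hyperplane not yet entered at step e is entered at step e + 1, since by then the rotation
      -- is at least π; it has not been left, because one step is less than π when d > 2. For d = 2
      -- the rotation at step e is already π and all hyperplanes are entered there.
      · intro t ht
        have h1 := ha t ht
        rw [Set.mem_union, hpN _ (by omega), hpN _ (by omega)]
        have h2 := hge (d / 2 + 1) (by omega)
        have h3 := hsucc (d / 2)
        by_cases h4 : Real.pi / 2 < a t + 2 * Real.pi * (d / 2 : ℕ) / d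
        · refine Or.inl ⟨ht, h4, ?_⟩
          have h5 : 2 * Real.pi * (d / 2 : ℕ) / d ≤ Real.pi := by
            have := hle (d / 2 - 1) (by omega)
            rwa [Nat.sub_add_cancel (by omega)] at this
          linarith
        · rcases lt_or_ge 2 d with hd2 | hd2
          · have hstep' : 2 * Real.pi / d < Real.pi := by
              have : (2 : ℝ) < d := by exact_mod_cast hd2
              rw [div_lt_iff₀ hd']
              nlinarith
            exact Or.inr ⟨ht, by linarith, by linarith⟩
          · have := hge (d / 2) (by omega)
            exact absurd (by linarith) h4
      · intro j hj1 hj2 t ht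
        rw [hpN _ (by omega)] at ht ⊢
        have h1 := ha t ht.1
        have h2 := hge j (by omega)
        have h3 := hsucc j
        exact ⟨ht.1, by linarith, by linarith [ht.2.2]⟩
  rw [IsMaximalRoot, not_not]
  have hJiff : ∀ s : D.S, s ∈ J ↔ s ∈ I ∧ complexify (s : X ≃ₗ[ℝ] X) x = x := by
    intro s
    refine ⟨fun hs => ⟨hJI.subset hs, ?_⟩, fun hs => ?_⟩
    · exact (hmem _ (D.coe_mem_parabolic (hJI.subset hs))).1 (D.coe_mem_parabolic hs)
    · exact D.coe_mem_parabolic_iff.1 ((hmem _ (D.coe_mem_parabolic hs.1)).2 hs.2)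
  have hperm : ∀ s : D.S, complexify ((D.permS ^ d) s : X ≃ₗ[ℝ] X) x = x ↔
      complexify (s : X ≃ₗ[ℝ] X) x = x := by
    intro s
    have h1 := complexify_conj_eq (k := D.φ ^ d) (t := ((D.permS ^ d) s : X ≃ₗ[ℝ] X)) (z := x)
    have e : (D.φ ^ d)⁻¹ * ((D.permS ^ d) s : X ≃ₗ[ℝ] X) * D.φ ^ d = s := by
      rw [permS_pow]
      simp only [mul_assoc, inv_mul_cancel, mul_one, inv_mul_cancel_left]
    rw [e, hfix] at h1
    exact h1.symm
  have hJ : D.IsStable d J := by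
    ext s
    constructor
    · rintro ⟨s', hs', rfl⟩
      obtain ⟨h1, h2⟩ := (hJiff s').1 hs'
      exact (hJiff _).2 ⟨hI ▸ Set.mem_image_of_mem _ h1, (hperm s').2 h2⟩
    · intro hs
      obtain ⟨h1, h2⟩ := (hJiff s).1 hs
      rw [← hI] at h1
      obtain ⟨s', hs', rfl⟩ := h1
      exact ⟨s', (hJiff s').2 ⟨hs', (hperm s').1 h2⟩, rfl⟩
  refine ⟨J, hJI, hJ, v, hv, ?_⟩
  have hψ : D.mulφ (v * b) = SemidirectProduct.inl (D.toB v) * D.mulφ b := by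
    rw [mulφ, mulφ, map_mul, map_mul, mul_assoc]
  have hpi' : D.lift z * D.lift z⁻¹ = SemidirectProduct.inl (D.piElt I) *
      (SemidirectProduct.inl (D.piElt J))⁻¹ := by
    rw [lift, lift, ← map_mul, toB_L_mul_L_inv hJI.subset, map_mul, map_inv]
  have hΦI := D.commute_φSemi_pow_piElt hI
  have hΦJ := D.commute_φSemi_pow_piElt hJ
  have hIJ : Commute (SemidirectProduct.inl (D.piElt I) : D.BSemi)
      (SemidirectProduct.inl (D.piElt J)) := by
    rw [piElt_eq, piElt_eq]
    exact (((commute_L_wI_sq (pow_mem (L_mem_parabolicMonoid (hJIle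
      ((D.mem_parabolic_iff J _).2 (D.cocycle.wI_mem J)))) 2)).map D.toB).map
      SemidirectProduct.inl).symm
  have hPI : Commute (SemidirectProduct.inl (D.piElt I) : D.BSemi)
      (SemidirectProduct.inl (D.piElt Set.univ)) := by
    rw [D.piElt_eq I]; exact D.commute_inl_pi _
  have hPJ : Commute (SemidirectProduct.inl (D.piElt J) : D.BSemi)
      (SemidirectProduct.inl (D.piElt Set.univ)) := by
    rw [D.piElt_eq J]; exact D.commute_inl_pi _
  have hr : D.mulφ b ^ d = D.φSemi ^ d * (SemidirectProduct.inl (D.piElt Set.univ) *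
      (SemidirectProduct.inl (D.piElt I))⁻¹) := by
    rw [← map_inv, ← map_mul]; exact hroot
  -- It remains to move π_I / π_J past φ^d and π, where the two factors π_I cancel.
  rw [IsRoot, hψ, hvpow, hpi', hr, piQuot, map_mul, map_inv]
  set P : D.BSemi := SemidirectProduct.inl (D.piElt Set.univ)
  set Q : D.BSemi := SemidirectProduct.inl (D.piElt I)
  set Q' : D.BSemi := SemidirectProduct.inl (D.piElt J)
  have h1 : Q * Q'⁻¹ * D.φSemi ^ d = D.φSemi ^ d * (Q * Q'⁻¹) :=
    (hΦI.mul_right hΦJ.inv_right).symm.eq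
  have h2 : Q * Q'⁻¹ * P = P * (Q * Q'⁻¹) := (hPI.mul_left hPJ.inv_left).eq
  have h3 : Q * Q'⁻¹ = Q'⁻¹ * Q := hIJ.inv_right.eq
  rw [← mul_assoc, h1, mul_assoc, ← mul_assoc (Q * Q'⁻¹), h2, h3, mul_assoc P, mul_inv_cancel_right]

end RealReflectionCoset

end

/-! ### The theorem -/

theorem mainTheorem3 {X : Type*} [AddCommGroup X] [Module ℝ X] [FiniteDimensional ℝ X]
    (D : RealReflectionCoset X) (d : ℕ) (hd : 0 < d) (b : D.BraidMonoid) (I : Set D.S)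
    (hI : D.IsStable d I) (hroot : D.IsRoot d b I)
    (V : Submodule ℂ (TensorProduct ℝ ℂ X))
    (hV : V = Module.End.eigenspace (RealReflectionCoset.complexify (D.imageφ b))
      (RealReflectionCoset.zeta d)) :
    (fun x => D.mulφ b * x * (D.mulφ b)⁻¹) '' D.boldSet I = D.boldSet I ∧
    D.parabolic I = D.centralizer (D.fixedSpace I ⊓ V) ∧
    D.centralizer V ≤ D.parabolic I ∧
    (D.IsMaximalRoot d b I ↔
      ¬ ∃ u ∈ D.parabolic I, ∃ x ∈ D.rootSpan I, x ≠ 0 ∧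
        RealReflectionCoset.complexify (u * D.imageφ b) x = RealReflectionCoset.zeta d • x) := by
  subst hV
  refine ⟨hroot.image_boldSet hd hI, hroot.parabolic_eq hd hI, hroot.centralizer_le hd hI,
    fun hmax hex => hroot.not_isMaximalRoot hd hI hex hmax, fun hne => ?_⟩
  by_contra hmax
  exact hne (hroot.exists_eigenvector hd hI hmax)
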